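/- **Setting.** Let $\mathcal X\subset\mathbb R^d$ and let $\lambda_X,\lambda_Y$ be $\sigma$-finite measures on $\mathcal X$ and $\mathbb R$ (for instance Lebesgue measure). Let $p,q$ be probability densities on $\mathcal X$ with respect to $\lambda_X$, and for every $x\in\mathcal X$ let $w(\cdot\mid x)$ be a probability density with respect to $\lambda_Y$, measurable in $(y,x)$. The train pair $(Y,X)$ has density $w(y|x)p(x)$ and the test pair $(\widetilde Y,\widetilde X)$ has density $w(y|x)q(x)$; $\mathbb E_p,\mathbb E_q$ are the corresponding expectations. Put $r(x)=q(x)/p(x)$, $f_0(x)=\int y\,w(y|x)\,d\lambda_Y(y)$ and $\sigma^2(x)=\int (y-f_0(x))^2w(y|x)\,d\lambda_Y(y)$. Assume: 1. There is $C>0$ such that almost surely $|Y|$, $|\widetilde Y|$ and all coordinates of $X$ and $\widetilde X$ are less than $C$ in absolute value. 2. $q(x)=0$ wherever $p(x)=0$, and $r(x)<C_r$ for all $x\in\mathcal X$, for some constant $C_r<\infty$. 3. $\Theta\subset\mathbb R^k$ is compact and $\{g_\beta:\beta\in\Theta\}$ are measurable functions on $\mathcal X$ such that, for every $x$, $\beta\mapsto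 g_\beta(x)$ is continuous on $\Theta$ and twice differentiable in the interior of $\Theta$. The model is correctly specified: $f_0=g_\beta$ on $\mathcal X$ for some $\beta\in\Theta$. The test risk $\mathbb E_q[(\widetilde Y-g_\beta(\widetilde X))^2]$ has a unique minimizer $\widetilde\beta_0$ over $\Theta$. Let $\beta_0$ be a minimizer over $\Theta$ of the train risk $\mathbb E_p[(Y-g_\beta(X))^2]$. Then $\beta_0$ lies in the interior of $\Theta$, $g_\beta(x)$ is bounded uniformly over $\Theta\times\mathcal X$, and the gradient $\dot g_{\beta_0}(x)$ and the Hessian $\ddot g_{\beta_0}(x)$ with respect to $\beta$ are bounded uniformly over $x\in\mathcal X$. **Estimator.** Let $n$ and $m=\rho n$ be even sample sizes, with $\rho>0$ fixed, and let $n\to\infty$ (along any sequence of such sizes). After the random split, each fold $\ell\in\{1,2\}$ has $n/2$ train points $(Y_{(i,\ell)},X_{(i,\ell)})$ and $m/2$ test covariates $\widetilde X_{(j,\ell)}$; all of these are independent, the former with density $w(y|x)p(x)$ and the latter with density $q$. For each $\ell$, $\widehat f_{(-\ell)}$ and $\widehat r_{(-\ell)}$ are real functions on $\mathcal X$ computed,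 jointly measurably, from the data of the other fold only. Let $\widehat\beta^{\mathrm{DR}}$ be a random vector that almost surely minimizes over $\Theta$ $$\sum_{\ell=1}^2\Big[\tfrac{2}{n}\sum_{i=1}^{n/2}\big\{(Y_{(i,\ell)}-g_\beta(X_{(i,\ell)}))^2-(\widehat f_{(-\ell)}(X_{(i,\ell)})-g_\beta(X_{(i,\ell)}))^2\big\}\widehat r_{(-\ell)}(X_{(i,\ell)})+\tfrac2m\sum_{j=1}^{m/2}(\widehat f_{(-\ell)}(\widetilde X_{(j,\ell)})-g_\beta(\widetilde X_{(j,\ell)}))^2\Big],$$ and let $h(\beta)\in\mathbb R^k$ be $-\frac12$ times the gradient of this function, $\dot h(\beta)$ the Jacobian matrix of $h$. Write $\|\cdot\|_2$ for the $L^2$ norm with respect to the law of $X$. Assume: 4. There is an invertible $k\times k$ matrix $D$ such that, for every sequence of $\Theta$-valued random vectors $\beta_n^*\to\widetilde\beta_0$ in probability, $\dot h(\beta_n^*)\to D^\top$ entrywise in probability. 5. For $\ell=1,2$: $\|\widehat r_{(-\ell)}-r\|_2=o_p(1)$, $\|\widehat f_{(-\ell)}-f_0\|_2=o_p(1)$ and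 $\|\widehat r_{(-\ell)}-r\|_2\,\|\widehat f_{(-\ell)}-f_0\|_2=o_p(\min\{n,m\}^{-1/2})$. **Conclusion.** The matrix $G=\mathbb E_q[\dot g_{\beta_0}(\widetilde X)\dot g_{\beta_0}(\widetilde X)^\top]$ is invertible. With $$\Omega=G^{-1}\,\mathbb E_q\big[\sigma^2(\widetilde X)\,r(\widetilde X)\,\dot g_{\beta_0}(\widetilde X)\dot g_{\beta_0}(\widetilde X)^\top\big]\,G^{-1}$$ and $\widehat f^{\mathrm{DR}}(x)=g_{\widehat\beta^{\mathrm{DR}}}(x)$, for every $x\in\mathcal X$ one has $\dot g_{\beta_0}(x)^\top\Omega\,\dot g_{\beta_0}(x)\ge0$ and $$\sqrt n\,\big(f_0(x)-\widehat f^{\mathrm{DR}}(x)\big)\xrightarrow{\ d\ }\mathcal N\big(0,\ \dot g_{\beta_0}(x)^\top\,\Omega\,\dot g_{\beta_0}(x)\big).$$ -/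

import Mathlib

open MeasureTheory ProbabilityTheory Filter Topology
open scoped NNReal ENNReal Matrix

noncomputable section

namespace DRShift

/-- Parameter vectors. -/
abbrev Param (k : ℕ) := EuclideanSpace ℝ (Fin k)

/-! ### The covariate shift population -/

/-- Densities of a covariate shift problem, with respect to dominating measures `lamX` for the
covariate and `lamY` for the outcome: `p` and `q` are the train and test covariate densities and
`w y x` is the conditional density of the outcome `y` given the covariate `x`, common to both
populations. -/
structure CovariateShift {X : Type*} [MeasurableSpace X] (lamX : Measure X) (lamY : Measure ℝ) where
  p : X → ℝ≥0
  q : X → ℝ≥0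
  w : ℝ → X → ℝ≥0
  measurable_p : Measurable p
  measurable_q : Measurable q
  measurable_w : Measurable fun z : ℝ × X => w z.1 z.2
  lintegral_p : ∫⁻ x, (p x : ℝ≥0∞) ∂lamX = 1
  lintegral_q : ∫⁻ x, (q x : ℝ≥0∞) ∂lamX = 1
  lintegral_w : ∀ x, ∫⁻ y, (w y x : ℝ≥0∞) ∂lamY = 1

namespace CovariateShift

variable {X : Type*} [MeasurableSpace X] {lamX : Measure X} {lamY : Measure ℝ}

/-- Joint law of the train pair, written (covariate, outcome), with density `w(y|x) p(x)`. -/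
def trainLaw (S : CovariateShift lamX lamY) : Measure (X × ℝ) :=
  (lamX.prod lamY).withDensity fun z => ((S.w z.2 z.1 * S.p z.1 : ℝ≥0) : ℝ≥0∞)

/-- Joint law of the test pair, written (covariate, outcome), with density `w(y|x) q(x)`. -/
def testLaw (S : CovariateShift lamX lamY) : Measure (X × ℝ) :=
  (lamX.prod lamY).withDensity fun z => ((S.w z.2 z.1 * S.q z.1 : ℝ≥0) : ℝ≥0∞)

/-- Law of the train covariate, with density `p`. -/
def trainCov (S : CovariateShift lamX lamY) : Measure X :=
  lamX.withDensity fun x => (S.p x : ℝ≥0∞)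

/-- Law of the test covariate, with density `q`. -/
def testCov (S : CovariateShift lamX lamY) : Measure X :=
  lamX.withDensity fun x => (S.q x : ℝ≥0∞)

/-- The density ratio `q(x) / p(x)`. -/
def ratio (S : CovariateShift lamX lamY) (x : X) : ℝ := (S.q x : ℝ) / (S.p x : ℝ)

/-- The regression function: the mean of the conditional density `w(·|x)`. -/
def f0 (S : CovariateShift lamX lamY) (x : X) : ℝ := ∫ y, y * (S.w y x : ℝ) ∂lamY

/-- The conditional variance of the outcome given the covariate `x`. -/
def sigmaSq (S : CovariateShift lamX lamY) (x : X) : ℝ :=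
  ∫ y, (y - S.f0 x) ^ 2 * (S.w y x : ℝ) ∂lamY

/-- Overlap with a bounded density ratio: `p` vanishes only where `q` does, and `q / p` is bounded
by a constant. -/
def Overlap (S : CovariateShift lamX lamY) : Prop :=
  (∀ x, S.p x = 0 → S.q x = 0) ∧ ∃ Cr : ℝ, 0 < Cr ∧ ∀ x, S.ratio x < Cr

end CovariateShift

/-- Outcomes and all coordinates of the covariates are almost surely bounded by one constant, in
the train and in the test population. -/
def BoundedData {d : ℕ} {𝒳 : Set (EuclideanSpace ℝ (Fin d))} {lamX : Measure 𝒳}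
    {lamY : Measure ℝ} (S : CovariateShift lamX lamY) : Prop :=
  ∃ C : ℝ, 0 < C ∧
    (∀ᵐ z ∂S.trainLaw, |z.2| < C ∧ ∀ i, |(z.1 : EuclideanSpace ℝ (Fin d)) i| < C) ∧
    (∀ᵐ z ∂S.testLaw, |z.2| < C ∧ ∀ i, |(z.1 : EuclideanSpace ℝ (Fin d)) i| < C)

/-! ### The parametric regression model -/

section Model

variable {X : Type*} [MeasurableSpace X] {k : ℕ}

/-- Mean squared error of the model `g` under the joint law `P`. -/
def risk (P : Measure (X × ℝ)) (g : Param k → X → ℝ) (β : Param k) : ℝ :=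
  ∫ z, (z.2 - g β z.1) ^ 2 ∂P

/-- `β` minimizes `R` over `Θ`. -/
def IsArgmin (Θ : Set (Param k)) (R : Param k → ℝ) (β : Param k) : Prop :=
  β ∈ Θ ∧ IsMinOn R Θ β

/-- The gradient of `β ↦ g β x`, as a vector of partial derivatives. -/
def gdot (g : Param k → X → ℝ) (β : Param k) (x : X) : Fin k → ℝ :=
  fun a => fderiv ℝ (fun b => g b x) β (EuclideanSpace.single a 1)

/-- The Hessian matrix of `β ↦ g β x`. -/
def gddot (g : Param k → X → ℝ) (β : Param k) (x : X) : Matrix (Fin k) (Fin k) ℝ :=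
  fun a b => fderiv ℝ (fun c => gdot g c x a) β (EuclideanSpace.single b 1)

/-- Regularity of the model: measurable in the covariate, continuous in the parameter on `Θ`,
twice differentiable in the parameter in the interior of `Θ`. -/
structure RegularModel (Θ : Set (Param k)) (g : Param k → X → ℝ) : Prop where
  measurable : ∀ β ∈ Θ, Measurable (g β)
  continuousOn : ∀ x, ContinuousOn (fun β => g β x) Θ
  differentiable : ∀ x, ∀ β ∈ interior Θ, DifferentiableAt ℝ (fun b => g b x) β
  twice_differentiable : ∀ x, ∀ β ∈ interior Θ,
    DifferentiableAt ℝ (fun b => fderiv ℝ (fun c => g c x) b) β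

/-- The model is uniformly bounded, and so are its first and second parameter derivatives at
`β`. -/
def BoundedModel (Θ : Set (Param k)) (g : Param k → X → ℝ) (β : Param k) : Prop :=
  ∃ B : ℝ, (∀ b ∈ Θ, ∀ x, |g b x| ≤ B) ∧ (∀ x a, |gdot g β x a| ≤ B) ∧
    ∀ x a b, |gddot g β x a b| ≤ B

/-- The matrix `E_q[ġ ġᵀ]`. -/
def gramMatrix {lamX : Measure X} {lamY : Measure ℝ} (S : CovariateShift lamX lamY)
    (g : Param k → X → ℝ) (β : Param k) : Matrix (Fin k) (Fin k) ℝ :=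
  fun a b => ∫ x, gdot g β x a * gdot g β x b ∂S.testCov

/-- The matrix `E_q[σ² r ġ ġᵀ]`. -/
def noiseMatrix {lamX : Measure X} {lamY : Measure ℝ} (S : CovariateShift lamX lamY)
    (g : Param k → X → ℝ) (β : Param k) : Matrix (Fin k) (Fin k) ℝ :=
  fun a b => ∫ x, S.sigmaSq x * S.ratio x * (gdot g β x a * gdot g β x b) ∂S.testCov

/-- The asymptotic covariance `Ω = E_q[ġ ġᵀ]⁻¹ E_q[σ² r ġ ġᵀ] E_q[ġ ġᵀ]⁻¹`. -/
def asympCov {lamX : Measure X} {lamY : Measure ℝ} (S : CovariateShift lamX lamY)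
    (g : Param k → X → ℝ) (β : Param k) : Matrix (Fin k) (Fin k) ℝ :=
  (gramMatrix S g β)⁻¹ * noiseMatrix S g β * (gramMatrix S g β)⁻¹

/-- The asymptotic variance `ġ(x)ᵀ Ω ġ(x)` at the point `x`. -/
def asympVar {lamX : Measure X} {lamY : Measure ℝ} (S : CovariateShift lamX lamY)
    (g : Param k → X → ℝ) (β : Param k) (x : X) : ℝ :=
  gdot g β x ⬝ᵥ (asympCov S g β *ᵥ gdot g β x)

end Model

/-! ### Two-fold cross-fitting -/

section CrossFit

variable {X : Type*} [MeasurableSpace X] {k : ℕ}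

/-- The data after the split into two folds (labelled by `Bool`): `N` labelled train points and
`M` unlabelled test covariates in each fold. -/
abbrev Sample (X : Type*) (N M : ℕ) := (Bool → Fin N → X × ℝ) × (Bool → Fin M → X)

/-- The law of a sample all of whose points are independent, the train points having law `P` and
the test covariates having law `Q`. -/
def sampleLaw (P : Measure (X × ℝ)) (Q : Measure X) (N M : ℕ) : Measure (Sample X N M) :=
  (Measure.pi fun _ => Measure.pi fun _ => P).prod (Measure.pi fun _ => Measure.pi fun _ => Q)

/-- An estimator of a function of the covariate: the data of one fold determine a function. -/
abbrev NuisanceEstimator (X : Type*) (N M : ℕ) := (Fin N → X × ℝ) → (Fin M → X) → X → ℝ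

/-- The estimate of a nuisance function that is used on fold `l`; it is computed from the data of
the opposite fold. -/
def crossFit {N M : ℕ} (e : Bool → NuisanceEstimator X N M) (s : Sample X N M) (l : Bool) : X → ℝ :=
  e l (s.1 (!l)) (s.2 (!l))

/-- The doubly robust empirical risk of fold `l`. -/
def drRisk {N M : ℕ} (g : Param k → X → ℝ) (fhat rhat : Bool → NuisanceEstimator X N M)
    (s : Sample X N M) (l : Bool) (β : Param k) : ℝ :=
  (1 / (N : ℝ)) * ∑ i, (((s.1 l i).2 - g β (s.1 l i).1) ^ 2
      - (crossFit fhat s l (s.1 l i).1 - g β (s.1 l i).1) ^ 2) * crossFit rhat s l (s.1 l i).1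
    + (1 / (M : ℝ)) * ∑ j, (crossFit fhat s l (s.2 l j) - g β (s.2 l j)) ^ 2

/-- The score `h(β)` of the doubly robust risk, that is, `-1/2` times the gradient of the sum of
`drRisk` over the two folds. -/
def score {N M : ℕ} (g : Param k → X → ℝ) (fhat rhat : Bool → NuisanceEstimator X N M)
    (s : Sample X N M) (β : Param k) : Fin k → ℝ := fun a =>
  ∑ l : Bool,
    ((1 / (N : ℝ)) * ∑ i, gdot g β (s.1 l i).1 a
        * ((s.1 l i).2 - crossFit fhat s l (s.1 l i).1) * crossFit rhat s l (s.1 l i).1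
      + (1 / (M : ℝ)) * ∑ j, gdot g β (s.2 l j) a * (crossFit fhat s l (s.2 l j) - g β (s.2 l j)))

/-- The Jacobian matrix `ḣ(β)` of the score. -/
def scoreJacobian {N M : ℕ} (g : Param k → X → ℝ) (fhat rhat : Bool → NuisanceEstimator X N M)
    (s : Sample X N M) (β : Param k) : Matrix (Fin k) (Fin k) ℝ :=
  fun a b => fderiv ℝ (fun c => score g fhat rhat s c a) β (EuclideanSpace.single b 1)

/-- Joint measurability, in the data and the covariate, of the estimators of both folds. -/
def MeasurableEstimator {N M : ℕ} (e : Bool → NuisanceEstimator X N M) : Prop :=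
  ∀ l, Measurable fun z : (Fin N → X × ℝ) × (Fin M → X) × X => e l z.1 z.2.1 z.2.2

end CrossFit

/-! ### Stochastic orders and asymptotic conditions -/

section Asymptotics

variable {𝓞 : Type*} [MeasurableSpace 𝓞] {X : Type*} [MeasurableSpace X] {k : ℕ}

/-- `Z n = o_p(1)` for nonnegative extended real random variables. -/
def IsLittleOp (μ : Measure 𝓞) (Z : ℕ → 𝓞 → ℝ≥0∞) : Prop :=
  ∀ ε : ℝ≥0∞, 0 < ε → Tendsto (fun n => μ {ω | ε ≤ Z n ω}) atTop (𝓝 0)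

/-- Random variable: the `L²` distance, under the train covariate law, of the estimate used on
fold `l` from the target function. -/
def l2Error {N M : ℕ} (P : Measure X) (e : Bool → NuisanceEstimator X N M) (target : X → ℝ)
    (s : Sample X N M) (l : Bool) : ℝ≥0∞ :=
  eLpNorm (fun x => crossFit e s l x - target x) 2 P

/-- Convergence of the nuisance estimators in `L²`, with a product rate
`o_p(min(n, m)^(-1/2))`, where `n = 2 N` and `m = 2 M` are the sample sizes. -/
structure NuisanceRates {lamX : Measure X} {lamY : Measure ℝ} (S : CovariateShift lamX lamY)
    (μ : Measure 𝓞) (N M : ℕ → ℕ) (sample : ∀ n, 𝓞 → Sample X (N n) (M n))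
    (fhat rhat : ∀ n, Bool → NuisanceEstimator X (N n) (M n)) : Prop where
  ratio_consistent : ∀ l, IsLittleOp μ fun n ω =>
    l2Error S.trainCov (rhat n) S.ratio (sample n ω) l
  regression_consistent : ∀ l, IsLittleOp μ fun n ω =>
    l2Error S.trainCov (fhat n) S.f0 (sample n ω) l
  product_rate : ∀ l, IsLittleOp μ fun n ω =>
    ENNReal.ofReal (Real.sqrt (min (2 * N n : ℝ) (2 * M n : ℝ))) *
      (l2Error S.trainCov (rhat n) S.ratio (sample n ω) l *
        l2Error S.trainCov (fhat n) S.f0 (sample n ω) l)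

/-- There is one invertible matrix `D` such that the score Jacobian, evaluated at any sequence of
random parameters in `Θ` that converges in probability to `β`, converges entrywise in probability
to `Dᵀ`. -/
def JacobianCondition (μ : Measure 𝓞) (Θ : Set (Param k)) (β : Param k) (g : Param k → X → ℝ)
    (N M : ℕ → ℕ) (sample : ∀ n, 𝓞 → Sample X (N n) (M n))
    (fhat rhat : ∀ n, Bool → NuisanceEstimator X (N n) (M n)) : Prop :=
  ∃ D : Matrix (Fin k) (Fin k) ℝ, IsUnit D.det ∧
    ∀ βs : ℕ → 𝓞 → Param k, (∀ n, Measurable (βs n)) → (∀ n ω, βs n ω ∈ Θ) →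
      TendstoInMeasure μ βs atTop (fun _ => β) →
      ∀ a b, TendstoInMeasure μ
        (fun n ω => scoreJacobian g (fhat n) (rhat n) (sample n ω) (βs n ω) a b)
        atTop (fun _ => Dᵀ a b)

end Asymptotics

end DRShift

end

noncomputable section

namespace DRShift

/-! ### Events of probability tending to one -/

section Whp

variable {Ω : ℕ → Type*} [∀ n, MeasurableSpace (Ω n)] {ν : ∀ n, Measure (Ω n)}

/-- The events `P n` hold with probability tending to one. -/
def Whp (ν : ∀ n, Measure (Ω n)) (P : ∀ n, Ω n → Prop) : Prop :=
  Tendsto (fun n => ν n {ω | ¬ P n ω}) atTop (𝓝 0)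

theorem Whp.mono_ae {P Q : ∀ n, Ω n → Prop} (h : Whp ν P)
    (hPQ : ∀ᶠ n in atTop, ∀ᵐ ω ∂ν n, P n ω → Q n ω) : Whp ν Q := by
  refine tendsto_of_tendsto_of_tendsto_of_le_of_le' tendsto_const_nhds h
    (Eventually.of_forall fun _ => zero_le) ?_
  filter_upwards [hPQ] with n hn
  refine measure_mono_ae ?_
  filter_upwards [hn] with ω hω hQ hP
  exact hQ (hω hP)

theorem Whp.mono {P Q : ∀ n, Ω n → Prop} (h : Whp ν P)
    (hPQ : ∀ n ω, P n ω → Q n ω) : Whp ν Q :=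
  h.mono_ae (Eventually.of_forall fun n => Eventually.of_forall fun ω => hPQ n ω)

theorem whp_of_ae {P : ∀ n, Ω n → Prop} (h : ∀ᶠ n in atTop, ∀ᵐ ω ∂ν n, P n ω) : Whp ν P := by
  refine Tendsto.congr' ?_ tendsto_const_nhds
  filter_upwards [h] with n hn
  exact (ae_iff.1 hn).symm

theorem Whp.and {P Q : ∀ n, Ω n → Prop} (h : Whp ν P) (h' : Whp ν Q) :
    Whp ν fun n ω => P n ω ∧ Q n ω := by
  have := Tendsto.add h h'
  rw [add_zero] at this
  refine tendsto_of_tendsto_of_tendsto_of_le_of_le tendsto_const_nhds this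
    (fun _ => zero_le) fun n => ?_
  refine (measure_mono fun ω hω => ?_).trans (measure_union_le _ _)
  simp only [Set.mem_ofPred_eq, Set.mem_union] at hω ⊢
  tauto

theorem whp_forall_finset {ι : Type*} (s : Finset ι) {P : ι → ∀ n, Ω n → Prop}
    (h : ∀ i ∈ s, Whp ν (P i)) : Whp ν fun n ω => ∀ i ∈ s, P i n ω := by
  classical
  induction s using Finset.induction_on with
  | empty => exact whp_of_ae (by simp)
  | insert i s _ ih =>
    refine ((h i (Finset.mem_insert_self i s)).and
      (ih fun j hj => h j (Finset.mem_insert_of_mem hj))).mono fun n ω hω j hj => ?_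
    rcases Finset.mem_insert.1 hj with rfl | hj
    · exact hω.1
    · exact hω.2 j hj

theorem whp_forall {ι : Type*} [Fintype ι] {P : ι → ∀ n, Ω n → Prop}
    (h : ∀ i, Whp ν (P i)) : Whp ν fun n ω => ∀ i, P i n ω :=
  (whp_forall_finset Finset.univ fun i _ => h i).mono fun _ _ hω i => hω i (Finset.mem_univ i)

theorem Whp.comp {Ω' : ℕ → Type*} [∀ n, MeasurableSpace (Ω' n)] {ν' : ∀ n, Measure (Ω' n)}
    {f : ∀ n, Ω n → Ω' n} (hf : ∀ n, AEMeasurable (f n) (ν n))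
    (hmap : ∀ n, (ν n).map (f n) = ν' n) {P : ∀ n, Ω' n → Prop} (h : Whp ν' P) :
    Whp ν fun n ω => P n (f n ω) := by
  refine tendsto_of_tendsto_of_tendsto_of_le_of_le tendsto_const_nhds h
    (fun _ => zero_le) fun n => ?_
  have := Measure.le_map_apply (hf n) {ω | ¬ P n ω}
  rwa [hmap n] at this

theorem Whp.of_comp {Ω' : ℕ → Type*} [∀ n, MeasurableSpace (Ω' n)] {ν' : ∀ n, Measure (Ω' n)}
    {f : ∀ n, Ω n → Ω' n} (hf : ∀ n, AEMeasurable (f n) (ν n))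
    (hmap : ∀ n, (ν n).map (f n) = ν' n) {P : ∀ n, Ω' n → Prop}
    (hP : ∀ n, MeasurableSet {ω | P n ω})
    (h : Whp ν fun n ω => P n (f n ω)) : Whp ν' P := by
  refine Tendsto.congr (fun n => ?_) h
  have := Measure.map_apply_of_aemeasurable (hf n) (hP n).compl
  rw [hmap n] at this
  exact this.symm

theorem not_whp_false [∀ n, IsProbabilityMeasure (ν n)] : ¬ Whp ν fun _ _ => False := by
  intro h
  have h' : Tendsto (fun _ : ℕ => (1 : ℝ≥0∞)) atTop (𝓝 0) :=
    Tendsto.congr (fun n => by simp) h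
  exact one_ne_zero (tendsto_nhds_unique tendsto_const_nhds h')

end Whp

/-! ### Convergence in probability to zero -/

section SmallInProb

variable {Ω : ℕ → Type*} [∀ n, MeasurableSpace (Ω n)] {ν : ∀ n, Measure (Ω n)}

/-- `Z n = o_p(1)` for extended nonnegative random variables on varying spaces. -/
def SmallInProb (ν : ∀ n, Measure (Ω n)) (Z : ∀ n, Ω n → ℝ≥0∞) : Prop :=
  ∀ ε : ℝ≥0∞, 0 < ε → Whp ν fun n ω => Z n ω < ε

theorem IsLittleOp.smallInProb {𝓞 : Type*} [MeasurableSpace 𝓞] {μ : Measure 𝓞}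
    {Z : ℕ → 𝓞 → ℝ≥0∞} (h : IsLittleOp μ Z) : SmallInProb (fun _ => μ) Z := by
  intro ε hε
  simpa only [Whp, not_lt] using h ε hε

theorem SmallInProb.mono_ae {Z W : ∀ n, Ω n → ℝ≥0∞} (h : SmallInProb ν W)
    (hZW : ∀ᶠ n in atTop, ∀ᵐ ω ∂ν n, Z n ω ≤ W n ω) : SmallInProb ν Z := fun ε hε =>
  (h ε hε).mono_ae (hZW.mono fun _ hn => hn.mono fun _ hω hlt => hω.trans_lt hlt)

theorem SmallInProb.mono {Z W : ∀ n, Ω n → ℝ≥0∞} (h : SmallInProb ν W)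
    (hZW : ∀ n ω, Z n ω ≤ W n ω) : SmallInProb ν Z :=
  h.mono_ae (Eventually.of_forall fun n => Eventually.of_forall fun ω => hZW n ω)

theorem SmallInProb.add {Z W : ∀ n, Ω n → ℝ≥0∞} (h : SmallInProb ν Z) (h' : SmallInProb ν W) :
    SmallInProb ν fun n ω => Z n ω + W n ω := by
  intro ε hε
  have h2 : 0 < ε / 2 := ENNReal.half_pos hε.ne'
  refine ((h _ h2).and (h' _ h2)).mono fun n ω hω => ?_
  calc Z n ω + W n ω < ε / 2 + ε / 2 := ENNReal.add_lt_add hω.1 hω.2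
    _ = ε := ENNReal.add_halves ε

theorem SmallInProb.sum {ι : Type*} (s : Finset ι) {Z : ι → ∀ n, Ω n → ℝ≥0∞}
    (h : ∀ i ∈ s, SmallInProb ν (Z i)) : SmallInProb ν fun n ω => ∑ i ∈ s, Z i n ω := by
  classical
  induction s using Finset.induction_on with
  | empty => exact fun ε hε => whp_of_ae (by simp [hε])
  | insert i s hi ih =>
    refine ((h i (Finset.mem_insert_self i s)).add
      (ih fun j hj => h j (Finset.mem_insert_of_mem hj))).mono fun n ω => ?_
    rw [Finset.sum_insert hi]

theorem SmallInProb.const_mul {Z : ∀ n, Ω n → ℝ≥0∞} (h : SmallInProb ν Z) {c : ℝ≥0∞}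
    (hc : c ≠ ∞) : SmallInProb ν fun n ω => c * Z n ω := by
  intro ε hε
  rcases eq_or_ne c 0 with rfl | h0
  · exact whp_of_ae (by simp [hε])
  · refine (h (ε / c) (ENNReal.div_pos hε.ne' hc)).mono fun n ω hω => ?_
    change c * Z n ω < ε
    rw [mul_comm]
    exact (ENNReal.lt_div_iff_mul_lt (Or.inl h0) (Or.inl hc)).1 hω

theorem SmallInProb.pow_two {Z : ∀ n, Ω n → ℝ≥0∞} (h : SmallInProb ν Z) :
    SmallInProb ν fun n ω => Z n ω ^ 2 := by
  intro ε hε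
  refine (h (min ε 1) (lt_min hε one_pos)).mono fun n ω hω => ?_
  calc Z n ω ^ 2 = Z n ω * Z n ω := sq _
    _ ≤ 1 * Z n ω := by gcongr; exact (hω.trans_le (min_le_right _ _)).le
    _ = Z n ω := one_mul _
    _ < ε := hω.trans_le (min_le_left _ _)

theorem SmallInProb.mul {Z W : ∀ n, Ω n → ℝ≥0∞} (h : SmallInProb ν Z) (h' : SmallInProb ν W) :
    SmallInProb ν fun n ω => Z n ω * W n ω := by
  intro ε hε
  refine ((h 1 one_pos).and (h' ε hε)).mono fun n ω hω => ?_
  calc Z n ω * W n ω ≤ 1 * W n ω := by gcongr; exact hω.1.le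
    _ = W n ω := one_mul _
    _ < ε := hω.2

theorem SmallInProb.of_pow_two {Z : ∀ n, Ω n → ℝ≥0∞} (h : SmallInProb ν fun n ω => Z n ω ^ 2) :
    SmallInProb ν Z := by
  intro ε hε
  refine (h (ε ^ 2) (ENNReal.pow_pos hε 2)).mono fun n ω hω => ?_
  by_contra hcon
  exact absurd hω (not_lt.2 (pow_le_pow_left' (not_lt.1 hcon) 2))

theorem SmallInProb.whp_abs_lt {Z : ∀ n, Ω n → ℝ} (h : SmallInProb ν fun n ω => ‖Z n ω‖ₑ)
    {ε : ℝ} (hε : 0 < ε) : Whp ν fun n ω => |Z n ω| < ε := by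
  refine (h (ENNReal.ofReal ε) (ENNReal.ofReal_pos.2 hε)).mono fun n ω hω => ?_
  change ‖Z n ω‖ₑ < _ at hω
  rw [Real.enorm_eq_ofReal_abs] at hω
  exact (ENNReal.ofReal_lt_ofReal_iff hε).1 hω

theorem smallInProb_of_whp_abs_lt {Z : ∀ n, Ω n → ℝ}
    (h : ∀ ε : ℝ, 0 < ε → Whp ν fun n ω => |Z n ω| < ε) :
    SmallInProb ν fun n ω => ‖Z n ω‖ₑ := by
  intro ε hε
  rcases eq_or_ne ε ∞ with rfl | hε'
  · exact whp_of_ae (by simp)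
  · refine (h ε.toReal (ENNReal.toReal_pos hε.ne' hε')).mono fun n ω hω => ?_
    change ‖Z n ω‖ₑ < _
    rw [Real.enorm_eq_ofReal_abs]
    exact (ENNReal.ofReal_lt_iff_lt_toReal (abs_nonneg _) hε').2 hω

theorem smallInProb_of_ne_top {Z : ∀ n, Ω n → ℝ≥0∞}
    (h : ∀ ε : ℝ≥0∞, 0 < ε → ε ≠ ∞ → Whp ν fun n ω => Z n ω < ε) : SmallInProb ν Z := by
  intro ε hε
  rcases eq_or_ne ε ∞ with rfl | hε'
  · exact (h 1 one_pos ENNReal.one_ne_top).mono fun n ω hω => lt_top_of_lt hω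
  · exact h ε hε hε'

theorem smallInProb_of_lintegral {Z : ∀ n, Ω n → ℝ≥0∞} (hZ : ∀ n, AEMeasurable (Z n) (ν n))
    (h : Tendsto (fun n => ∫⁻ ω, Z n ω ∂ν n) atTop (𝓝 0)) : SmallInProb ν Z := by
  refine smallInProb_of_ne_top fun ε hε hε' => ?_
  have h2 : Tendsto (fun n => (∫⁻ ω, Z n ω ∂ν n) / ε) atTop (𝓝 0) := by
    simpa using ENNReal.Tendsto.div_const h (Or.inr hε.ne')
  refine tendsto_of_tendsto_of_tendsto_of_le_of_le tendsto_const_nhds h2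
    (fun _ => zero_le) fun n => ?_
  simpa only [not_lt] using meas_ge_le_lintegral_div (hZ n) hε.ne' hε'

theorem SmallInProb.comp {Ω' : ℕ → Type*} [∀ n, MeasurableSpace (Ω' n)]
    {ν' : ∀ n, Measure (Ω' n)} {f : ∀ n, Ω n → Ω' n} (hf : ∀ n, AEMeasurable (f n) (ν n))
    (hmap : ∀ n, (ν n).map (f n) = ν' n) {Z : ∀ n, Ω' n → ℝ≥0∞} (h : SmallInProb ν' Z) :
    SmallInProb ν fun n ω => Z n (f n ω) := fun ε hε =>
  (h ε hε).comp hf hmap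

theorem SmallInProb.of_comp {Ω' : ℕ → Type*} [∀ n, MeasurableSpace (Ω' n)]
    {ν' : ∀ n, Measure (Ω' n)} {f : ∀ n, Ω n → Ω' n} (hf : ∀ n, AEMeasurable (f n) (ν n))
    (hmap : ∀ n, (ν n).map (f n) = ν' n) {Z : ∀ n, Ω' n → ℝ≥0∞} (hZ : ∀ n, Measurable (Z n))
    (h : SmallInProb ν fun n ω => Z n (f n ω)) : SmallInProb ν' Z := fun ε hε =>
  Whp.of_comp (ν' := ν') (P := fun n ω => Z n ω < ε) hf hmap
    (fun n => measurableSet_lt (hZ n) measurable_const) (h ε hε)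

/-- Conditional Markov inequality: on a product space, a random variable whose conditional mean
given the second factor is `o_p(1)` is itself `o_p(1)`. -/
theorem smallInProb_of_conditional {Ω' : ℕ → Type*} [∀ n, MeasurableSpace (Ω' n)]
    {ν' : ∀ n, Measure (Ω' n)} [∀ n, IsProbabilityMeasure (ν n)]
    [∀ n, IsProbabilityMeasure (ν' n)]
    {F : ∀ n, Ω n × Ω' n → ℝ≥0∞} (hF : ∀ n, Measurable (F n))
    {c : ∀ n, Ω' n → ℝ≥0∞} (hc : SmallInProb ν' c)
    (hFc : ∀ᶠ n in atTop, ∀ o, ∫⁻ ω, F n (ω, o) ∂ν n ≤ c n o) :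
    SmallInProb (fun n => (ν n).prod (ν' n)) F := by
  refine smallInProb_of_ne_top fun ε hε hε' => ?_
  refine ENNReal.tendsto_nhds_zero.2 fun η hη => ?_
  set δ : ℝ≥0∞ := min 1 (ε * (η / 2)) with hδ
  have hη2 : 0 < η / 2 := ENNReal.half_pos hη.ne'
  have hδ0 : 0 < δ := lt_min one_pos (ENNReal.mul_pos hε.ne' hη2.ne')
  have hev := ENNReal.tendsto_nhds_zero.1 (hc δ hδ0) (η / 2) hη2
  filter_upwards [hev, hFc] with n hn hFn
  have hm : Measurable fun z : Ω' n × Ω n => F n (z.2, z.1) := (hF n).comp measurable_swap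
  set a : Ω' n → ℝ≥0∞ := fun o => ∫⁻ ω, F n (ω, o) ∂ν n with ha
  have ham : Measurable a := hm.lintegral_prod_right'
  set B : Set (Ω' n) := {o | a o < δ} with hB
  have hBm : MeasurableSet B := measurableSet_lt ham measurable_const
  have hBc : ν' n Bᶜ ≤ η / 2 := by
    refine (measure_mono fun o ho => ?_).trans hn
    exact fun hco => ho ((hFn o).trans_lt hco)
  have hsub : {z : Ω n × Ω' n | ¬ F n z < ε} ⊆
      Prod.snd ⁻¹' Bᶜ ∪ ({z | ε ≤ F n z} ∩ Prod.snd ⁻¹' B) := by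
    intro z hz
    by_cases h : z.2 ∈ B
    · exact Or.inr ⟨not_lt.1 hz, h⟩
    · exact Or.inl h
  refine (measure_mono hsub).trans ((measure_union_le _ _).trans ?_)
  have h1 : ((ν n).prod (ν' n)) (Prod.snd ⁻¹' Bᶜ) = ν' n Bᶜ := by
    rw [← Measure.map_apply measurable_snd hBm.compl]
    simp
  have h2 : ((ν n).prod (ν' n)) ({z | ε ≤ F n z} ∩ Prod.snd ⁻¹' B) ≤ η / 2 := by
    have hms : MeasurableSet ({z : Ω n × Ω' n | ε ≤ F n z} ∩ Prod.snd ⁻¹' B) :=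
      (measurableSet_le measurable_const (hF n)).inter (measurable_snd hBm)
    rw [Measure.prod_apply_symm hms]
    have hle : ∀ o, ν n ((fun ω => (ω, o)) ⁻¹' ({z : Ω n × Ω' n | ε ≤ F n z} ∩
        Prod.snd ⁻¹' B)) ≤ η / 2 := by
      intro o
      by_cases ho : o ∈ B
      · have h3 : ν n {ω | ε ≤ F n (ω, o)} ≤ (∫⁻ ω, F n (ω, o) ∂ν n) / ε :=
          meas_ge_le_lintegral_div ((hF n).comp measurable_prodMk_right).aemeasurable hε.ne' hε'
        refine (measure_mono fun ω hω => hω.1).trans (h3.trans ?_)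
        refine ENNReal.div_le_of_le_mul' ?_
        exact (le_of_lt ho).trans (min_le_right _ _)
      · have h4 : ((fun ω => (ω, o)) ⁻¹' ({z : Ω n × Ω' n | ε ≤ F n z} ∩
            Prod.snd ⁻¹' B)) = ∅ := by
          ext ω; simp [ho]
        rw [h4]; simp
    calc ∫⁻ o, _ ∂ν' n ≤ ∫⁻ _, η / 2 ∂ν' n := lintegral_mono hle
      _ = η / 2 := by simp
  calc _ ≤ η / 2 + η / 2 := by rw [h1]; exact add_le_add hBc h2
    _ = η := ENNReal.add_halves η

end SmallInProb

/-! ### Boundedness in probability -/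

section Tight

variable {Ω : ℕ → Type*} [∀ n, MeasurableSpace (Ω n)] {ν : ∀ n, Measure (Ω n)}

/-- `Z n = O_p(1)`. -/
def BoundedInProb (ν : ∀ n, Measure (Ω n)) (Z : ∀ n, Ω n → ℝ) : Prop :=
  ∀ η : ℝ≥0∞, 0 < η → ∃ K : ℝ, ∀ᶠ n in atTop, ν n {ω | ¬ |Z n ω| < K} ≤ η

theorem BoundedInProb.mono_whp {Z W : ∀ n, Ω n → ℝ} (h : BoundedInProb ν W)
    (hZW : Whp ν fun n ω => |Z n ω| ≤ |W n ω|) : BoundedInProb ν Z := by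
  intro η hη
  have h2 : 0 < η / 2 := ENNReal.half_pos hη.ne'
  obtain ⟨K, hK⟩ := h _ h2
  refine ⟨K, ?_⟩
  filter_upwards [hK, ENNReal.tendsto_nhds_zero.1 hZW _ h2] with n hn hn'
  calc ν n {ω | ¬ |Z n ω| < K} ≤ ν n ({ω | ¬ |W n ω| < K} ∪ {ω | ¬ |Z n ω| ≤ |W n ω|}) := by
        refine measure_mono fun ω hω => ?_
        simp only [Set.mem_ofPred_eq, Set.mem_union] at hω ⊢
        by_contra! hcon
        exact hω (hcon.2.trans_lt hcon.1)
    _ ≤ η / 2 + η / 2 := (measure_union_le _ _).trans (add_le_add hn hn')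
    _ = η := ENNReal.add_halves η

theorem BoundedInProb.add {Z W : ∀ n, Ω n → ℝ} (h : BoundedInProb ν Z)
    (h' : BoundedInProb ν W) : BoundedInProb ν fun n ω => Z n ω + W n ω := by
  intro η hη
  have h2 : 0 < η / 2 := ENNReal.half_pos hη.ne'
  obtain ⟨K, hK⟩ := h _ h2
  obtain ⟨K', hK'⟩ := h' _ h2
  refine ⟨K + K', ?_⟩
  filter_upwards [hK, hK'] with n hn hn'
  calc ν n {ω | ¬ |Z n ω + W n ω| < K + K'}
      ≤ ν n ({ω | ¬ |Z n ω| < K} ∪ {ω | ¬ |W n ω| < K'}) := by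
        refine measure_mono fun ω hω => ?_
        simp only [Set.mem_ofPred_eq, Set.mem_union] at hω ⊢
        by_contra! hcon
        exact hω ((abs_add_le _ _).trans_lt (add_lt_add hcon.1 hcon.2))
    _ ≤ η / 2 + η / 2 := (measure_union_le _ _).trans (add_le_add hn hn')
    _ = η := ENNReal.add_halves η

theorem BoundedInProb.sum {ι : Type*} (s : Finset ι) {Z : ι → ∀ n, Ω n → ℝ}
    (h : ∀ i ∈ s, BoundedInProb ν (Z i)) : BoundedInProb ν fun n ω => ∑ i ∈ s, Z i n ω := by
  classical
  induction s using Finset.induction_on with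
  | empty => exact fun η hη => ⟨1, by simp⟩
  | insert i s hi ih =>
    have := (h i (Finset.mem_insert_self i s)).add
      (ih fun j hj => h j (Finset.mem_insert_of_mem hj))
    simpa only [Finset.sum_insert hi] using this

theorem BoundedInProb.abs {Z : ∀ n, Ω n → ℝ} (h : BoundedInProb ν Z) :
    BoundedInProb ν fun n ω => |Z n ω| :=
  h.mono_whp (whp_of_ae (by simp))

theorem SmallInProb.boundedInProb {Z : ∀ n, Ω n → ℝ} (h : SmallInProb ν fun n ω => ‖Z n ω‖ₑ) :
    BoundedInProb ν Z := fun η hη =>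
  ⟨1, ENNReal.tendsto_nhds_zero.1 (h.whp_abs_lt one_pos) η hη⟩

theorem BoundedInProb.comp {Ω' : ℕ → Type*} [∀ n, MeasurableSpace (Ω' n)]
    {ν' : ∀ n, Measure (Ω' n)} {f : ∀ n, Ω n → Ω' n} (hf : ∀ n, AEMeasurable (f n) (ν n))
    (hmap : ∀ n, (ν n).map (f n) = ν' n) {Z : ∀ n, Ω' n → ℝ} (h : BoundedInProb ν' Z) :
    BoundedInProb ν fun n ω => Z n (f n ω) := by
  intro η hη
  obtain ⟨K, hK⟩ := h η hη
  refine ⟨K, hK.mono fun n hn => ?_⟩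
  have := Measure.le_map_apply (hf n) {ω | ¬ |Z n ω| < K}
  rw [hmap n] at this
  exact this.trans hn

theorem boundedInProb_of_lintegral_sq {Z : ∀ n, Ω n → ℝ} (hZ : ∀ n, AEMeasurable (Z n) (ν n))
    {C : ℝ≥0∞} (hC : C ≠ ∞) (h : ∀ᶠ n in atTop, ∫⁻ ω, ‖Z n ω‖ₑ ^ 2 ∂ν n ≤ C) :
    BoundedInProb ν Z := by
  intro η hη
  obtain ⟨K, hK0, hK⟩ : ∃ K : ℝ, 0 < K ∧ C / ENNReal.ofReal (K ^ 2) ≤ η := by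
    have h1 : Tendsto (fun K : ℝ => C / ENNReal.ofReal (K ^ 2)) atTop (𝓝 0) := by
      rw [← ENNReal.div_top (a := C) ]
      refine ENNReal.Tendsto.div tendsto_const_nhds (Or.inr (by simp)) ?_ (Or.inr hC)
      exact ENNReal.tendsto_ofReal_atTop.comp (tendsto_pow_atTop two_ne_zero)
    exact ((eventually_gt_atTop 0).and (ENNReal.tendsto_nhds_zero.1 h1 η hη)).exists
  refine ⟨K, ?_⟩
  filter_upwards [h] with n hn
  have hK2 : ENNReal.ofReal (K ^ 2) ≠ 0 := (ENNReal.ofReal_pos.2 (by positivity)).ne'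
  refine le_trans ?_ ((ENNReal.div_le_div_right hn _).trans hK)
  refine le_trans (measure_mono fun ω hω => ?_) (meas_ge_le_lintegral_div
    (((hZ n).enorm).pow_const 2) hK2 ENNReal.ofReal_ne_top)
  simp only [Set.mem_ofPred_eq, not_lt] at hω ⊢
  rw [Real.enorm_eq_ofReal_abs, ← ENNReal.ofReal_pow (abs_nonneg _)]
  exact ENNReal.ofReal_le_ofReal (pow_le_pow_left₀ hK0.le hω 2)

/-- If `Z` is bounded in probability and `|R| ≤ ε |Z|` with probability tending to one for every
`ε > 0`, then `R = o_p(1)`. -/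
theorem BoundedInProb.smallInProb {Z R : ∀ n, Ω n → ℝ} (h : BoundedInProb ν Z)
    (hR : ∀ ε : ℝ, 0 < ε → Whp ν fun n ω => |R n ω| ≤ ε * |Z n ω|) :
    SmallInProb ν fun n ω => ‖R n ω‖ₑ := by
  refine smallInProb_of_whp_abs_lt fun ε hε => ENNReal.tendsto_nhds_zero.2 fun η hη => ?_
  have h2 : 0 < η / 2 := ENNReal.half_pos hη.ne'
  obtain ⟨K, hK⟩ := h _ h2
  have hK1 : 0 < |K| + 1 := by positivity
  have hR' := ENNReal.tendsto_nhds_zero.1 (hR (ε / (|K| + 1)) (by positivity)) _ h2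
  filter_upwards [hK, hR'] with n hn hn'
  calc ν n {ω | ¬ |R n ω| < ε}
      ≤ ν n ({ω | ¬ |Z n ω| < K} ∪ {ω | ¬ |R n ω| ≤ ε / (|K| + 1) * |Z n ω|}) := by
        refine measure_mono fun ω hω => ?_
        simp only [Set.mem_ofPred_eq, Set.mem_union] at hω ⊢
        by_contra! hcon
        refine hω (hcon.2.trans_lt ?_)
        have hZ : |Z n ω| < |K| + 1 := hcon.1.trans (by linarith [le_abs_self K])
        calc ε / (|K| + 1) * |Z n ω| < ε / (|K| + 1) * (|K| + 1) := by gcongr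
          _ = ε := by field_simp
    _ ≤ η / 2 + η / 2 := (measure_union_le _ _).trans (add_le_add hn hn')
    _ = η := ENNReal.add_halves η

end Tight

/-! ### Averages of independent, identically distributed variables -/

section Average

variable {E : Type*} [MeasurableSpace E] {P : Measure E} [IsProbabilityMeasure P]

theorem lintegral_enorm_average_le {N : ℕ} {W : E → ℝ} (hW : Measurable W) :
    ∫⁻ z, ‖(1 / (N : ℝ)) * ∑ i, W (z i)‖ₑ ∂(Measure.pi fun _ : Fin N => P) ≤
      ∫⁻ x, ‖W x‖ₑ ∂P := by
  rcases Nat.eq_zero_or_pos N with rfl | hN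
  · simp
  have hN' : (N : ℝ≥0∞) ≠ 0 := by exact_mod_cast hN.ne'
  have h1 : ‖(1 / (N : ℝ))‖ₑ = (N : ℝ≥0∞)⁻¹ := by
    rw [one_div, enorm_inv (by exact_mod_cast hN.ne')]
    simp
  have hev : ∀ i : Fin N, ∫⁻ z, ‖W (z i)‖ₑ ∂(Measure.pi fun _ : Fin N => P) =
      ∫⁻ x, ‖W x‖ₑ ∂P := fun i =>
    (measurePreserving_eval (fun _ : Fin N => P) i).lintegral_comp hW.enorm
  calc ∫⁻ z, ‖(1 / (N : ℝ)) * ∑ i, W (z i)‖ₑ ∂(Measure.pi fun _ : Fin N => P)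
      ≤ ∫⁻ z, (N : ℝ≥0∞)⁻¹ * ∑ i, ‖W (z i)‖ₑ ∂(Measure.pi fun _ : Fin N => P) := by
        refine lintegral_mono fun z => ?_
        rw [enorm_mul, h1]
        gcongr
        exact enorm_sum_le _ _
    _ = (N : ℝ≥0∞)⁻¹ * ∑ i : Fin N, ∫⁻ x, ‖W x‖ₑ ∂P := by
        rw [lintegral_const_mul _ (by fun_prop), lintegral_finsetSum _ (by fun_prop)]
        simp_rw [hev]
    _ = ∫⁻ x, ‖W x‖ₑ ∂P := by
        rw [Finset.sum_const, Finset.card_univ, Fintype.card_fin, nsmul_eq_mul, ← mul_assoc,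
          ENNReal.inv_mul_cancel hN' (ENNReal.natCast_ne_top N), one_mul]

theorem lintegral_sq_average_sub_integral_le {N : ℕ} (hN : N ≠ 0) {W : E → ℝ}
    (hW : Measurable W) :
    ∫⁻ z, ‖(1 / (N : ℝ)) * ∑ i, W (z i) - ∫ x, W x ∂P‖ₑ ^ 2
        ∂(Measure.pi fun _ : Fin N => P) ≤
      (N : ℝ≥0∞)⁻¹ * ∫⁻ x, ‖W x‖ₑ ^ 2 ∂P := by
  by_cases htop : ∫⁻ x, ‖W x‖ₑ ^ 2 ∂P = ∞
  · rw [htop, ENNReal.mul_top (by simp)]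
    exact le_top
  have hmem : MemLp W 2 P := by
    refine ⟨hW.aestronglyMeasurable, ?_⟩
    rw [eLpNorm_lt_top_iff_lintegral_rpow_enorm_lt_top two_ne_zero ENNReal.ofNat_ne_top]
    simpa using lt_top_iff_ne_top.2 htop
  set Q : Measure (Fin N → E) := Measure.pi fun _ : Fin N => P
  have hmp : ∀ i : Fin N, MeasurePreserving (Function.eval i) Q P := fun i =>
    measurePreserving_eval (fun _ : Fin N => P) i
  have hmemi : ∀ i : Fin N, MemLp (fun z : Fin N → E => W (z i)) 2 Q := fun i =>
    hmem.comp_measurePreserving (hmp i)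
  have hint : ∀ i : Fin N, ∫ z, W (z i) ∂Q = ∫ x, W x ∂P := fun i => by
    rw [← (hmp i).map_eq, integral_map (hmp i).measurable.aemeasurable hW.aestronglyMeasurable]
  have hvar : ∀ i : Fin N, Var[fun z : Fin N → E => W (z i); Q] = Var[W; P] := fun i => by
    rw [← (hmp i).map_eq, variance_map hW.aemeasurable (hmp i).measurable.aemeasurable]
    rfl
  have hN0 : (N : ℝ) ≠ 0 := by exact_mod_cast hN
  set A : (Fin N → E) → ℝ := fun z => (1 / (N : ℝ)) * ∑ i, W (z i)
  have hAmem : MemLp A 2 Q := (memLp_finsetSum _ fun i _ => hmemi i).const_mul _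
  have hAint : ∫ z, A z ∂Q = ∫ x, W x ∂P := by
    simp only [A]
    rw [integral_const_mul, integral_finsetSum _ fun i _ => (hmemi i).integrable one_le_two]
    simp_rw [hint]
    rw [Finset.sum_const, Finset.card_univ, Fintype.card_fin, nsmul_eq_mul]
    field_simp
  have hAvar : Var[A; Q] = (1 / (N : ℝ)) * Var[W; P] := by
    have hindep : iIndepFun (fun (i : Fin N) (z : Fin N → E) => W (z i)) Q :=
      iIndepFun_pi fun _ => hW.aemeasurable
    have hsum := IndepFun.variance_sum (μ := Q) (s := Finset.univ)
      (X := fun (i : Fin N) (z : Fin N → E) => W (z i)) (fun i _ => hmemi i)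
      fun i _ j _ hij => hindep.indepFun hij
    have hA : A = fun z => (1 / (N : ℝ)) * (∑ i, fun z : Fin N → E => W (z i)) z := by
      ext z; simp [A]
    rw [hA, variance_const_mul, hsum]
    simp_rw [hvar]
    rw [Finset.sum_const, Finset.card_univ, Fintype.card_fin, nsmul_eq_mul]
    field_simp
  have hle : Var[W; P] ≤ ∫ x, W x ^ 2 ∂P := variance_le_expectation_sq hW.aestronglyMeasurable
  have hEV : ∫⁻ z, ‖A z - ∫ x, W x ∂P‖ₑ ^ 2 ∂Q = evariance A Q := by
    rw [← hAint]; rfl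
  have hW2 : ∫⁻ x, ‖W x‖ₑ ^ 2 ∂P = ENNReal.ofReal (∫ x, W x ^ 2 ∂P) := by
    rw [ofReal_integral_eq_lintegral_ofReal hmem.integrable_sq
      (Eventually.of_forall fun _ => sq_nonneg _)]
    refine lintegral_congr fun x => ?_
    rw [Real.enorm_eq_ofReal_abs, ← ENNReal.ofReal_pow (abs_nonneg _), sq_abs]
  rw [hEV, ← hAmem.ofReal_variance_eq, hAvar, hW2, ENNReal.ofReal_mul (by positivity)]
  gcongr
  rw [one_div, ENNReal.ofReal_inv_of_pos (by positivity), ENNReal.ofReal_natCast]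

theorem measurable_average {N : ℕ} {W : E → ℝ} (hW : Measurable W) :
    Measurable fun z : Fin N → E => (1 / (N : ℝ)) * ∑ i, W (z i) := by
  fun_prop

/-- Weak law of large numbers for triangular arrays of bounded variables. -/
theorem whp_average_sub_integral_lt {N : ℕ → ℕ} (hN : Tendsto N atTop atTop) {W : E → ℝ}
    (hW : Measurable W) {C : ℝ} (hC : ∀ᵐ x ∂P, |W x| ≤ C) {ε : ℝ} (hε : 0 < ε) :
    Whp (fun n => Measure.pi fun _ : Fin (N n) => P)
      fun n z => |(1 / (N n : ℝ)) * ∑ i, W (z i) - ∫ x, W x ∂P| < ε := by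
  have hC2 : ∫⁻ x, ‖W x‖ₑ ^ 2 ∂P ≤ ENNReal.ofReal C ^ 2 := by
    calc ∫⁻ x, ‖W x‖ₑ ^ 2 ∂P ≤ ∫⁻ _, ENNReal.ofReal C ^ 2 ∂P := by
          refine lintegral_mono_ae (hC.mono fun x hx => ?_)
          rw [Real.enorm_eq_ofReal_abs]
          gcongr
      _ = ENNReal.ofReal C ^ 2 := by simp
  have hlim : Tendsto (fun n => (N n : ℝ≥0∞)⁻¹ * ENNReal.ofReal C ^ 2) atTop (𝓝 0) := by
    have h1 : Tendsto (fun n => (N n : ℝ≥0∞)⁻¹) atTop (𝓝 0) :=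
      ENNReal.tendsto_inv_nat_nhds_zero.comp hN
    simpa using ENNReal.Tendsto.mul_const h1 (Or.inr (ENNReal.pow_ne_top ENNReal.ofReal_ne_top))
  have key : SmallInProb (fun n => Measure.pi fun _ : Fin (N n) => P)
      fun n z => ‖(1 / (N n : ℝ)) * ∑ i, W (z i) - ∫ x, W x ∂P‖ₑ ^ 2 := by
    refine smallInProb_of_lintegral (fun n => Measurable.aemeasurable (by fun_prop)) ?_
    refine tendsto_of_tendsto_of_tendsto_of_le_of_le' tendsto_const_nhds hlim
      (Eventually.of_forall fun _ => zero_le) ?_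
    filter_upwards [hN.eventually_ne_atTop 0] with n hn
    exact (lintegral_sq_average_sub_integral_le hn hW).trans (by gcongr)
  exact (SmallInProb.of_pow_two key).whp_abs_lt hε

end Average

/-! ### Convergence in distribution -/

section Distribution

theorem TendstoInDistribution.comp_map {Ω Ω₁ : ℕ → Type*} [∀ n, MeasurableSpace (Ω n)]
    [∀ n, MeasurableSpace (Ω₁ n)] {Ω' : Type*} [MeasurableSpace Ω'] {ν : ∀ n, Measure (Ω n)}
    {ν₁ : ∀ n, Measure (Ω₁ n)} {μ' : Measure Ω'} [∀ n, IsProbabilityMeasure (ν n)]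
    [∀ n, IsProbabilityMeasure (ν₁ n)] [IsProbabilityMeasure μ'] {X : ∀ n, Ω n → ℝ} {Z : Ω' → ℝ}
    (h : TendstoInDistribution X atTop Z ν μ') {Y : ∀ n, Ω₁ n → ℝ}
    (hY : ∀ n, AEMeasurable (Y n) (ν₁ n)) (hXY : ∀ n, (ν₁ n).map (Y n) = (ν n).map (X n)) :
    TendstoInDistribution Y atTop Z ν₁ μ' where
  forall_aemeasurable := hY
  aemeasurable_limit := h.aemeasurable_limit
  tendsto := by
    refine h.tendsto.congr fun n => ?_
    exact Subtype.ext (hXY n).symm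

variable {E : Type*} [MeasurableSpace E] {P : Measure E} [IsProbabilityMeasure P]

theorem charFun_map_sum_pi {ι : Type*} [Fintype ι] {E : Type*} [MeasurableSpace E]
    (P : Measure E) [IsProbabilityMeasure P] {ξ : E → ℝ} (hξ : Measurable ξ) (t : ℝ) :
    charFun ((Measure.pi fun _ : ι => P).map fun z => ∑ i, ξ (z i)) t =
      charFun (P.map ξ) t ^ Fintype.card ι := by
  rw [charFun_apply_real, charFun_apply_real, integral_map (Measurable.aemeasurable (by fun_prop)) (by fun_prop),
    integral_map hξ.aemeasurable (by fun_prop)]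
  have h := integral_fintype_prod_eq_prod (𝕜 := ℂ) (μ := fun _ : ι => P)
    (fun _ x => Complex.exp (t * ξ x * Complex.I))
  rw [Finset.prod_const, Finset.card_univ] at h
  rw [← h]
  refine integral_congr_ae (Eventually.of_forall fun z => ?_)
  simp only
  rw [← Complex.exp_sum, Complex.ofReal_sum, Finset.mul_sum, Finset.sum_mul]

/-- Central limit theorem for the sum of two independent folds of `N n` centred variables. -/
theorem tendstoInDistribution_two_folds {N : ℕ → ℕ} (hN : Tendsto N atTop atTop) {ξ : E → ℝ}
    (hξ : Measurable ξ) (hmem : MemLp ξ 2 P) (hmean : ∫ x, ξ x ∂P = 0) :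
    TendstoInDistribution
      (fun n (z : Bool → Fin (N n) → E) => (√(2 * (N n : ℝ)))⁻¹ * ∑ l, ∑ i, ξ (z l i)) atTop
      (id : ℝ → ℝ) (fun n => Measure.pi fun _ : Bool => Measure.pi fun _ : Fin (N n) => P)
      (gaussianReal 0 (∫ x, ξ x ^ 2 ∂P).toNNReal) := by
  set P' : Measure (ℕ → E) := Measure.infinitePi fun _ => P
  have hmp : ∀ k : ℕ, MeasurePreserving (Function.eval k) P' P := fun k =>
    measurePreserving_eval_infinitePi (fun _ : ℕ => P) k
  have hindep : iIndepFun (fun (k : ℕ) (ω : ℕ → E) => ξ (ω k)) P' :=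
    iIndepFun_infinitePi (P := fun _ : ℕ => P) (X := fun _ => ξ) fun _ => hξ
  have hmap : ∀ k : ℕ, P'.map (fun ω : ℕ → E => ξ (ω k)) = P.map ξ := fun k => by
    rw [← (hmp k).map_eq, Measure.map_map hξ (hmp k).measurable]
    rfl
  have hident : ∀ k : ℕ, IdentDistrib (fun ω : ℕ → E => ξ (ω k)) (fun ω => ξ (ω 0)) P' P' :=
    fun k => ⟨Measurable.aemeasurable (by fun_prop), Measurable.aemeasurable (by fun_prop), by rw [hmap, hmap]⟩
  have hint : ∫ ω, ξ (ω 0) ∂P' = 0 := by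
    rw [← hmean, ← (hmp 0).map_eq,
      integral_map (hmp 0).measurable.aemeasurable hξ.aestronglyMeasurable]
  have hvar : Var[fun ω : ℕ → E => ξ (ω 0); P'] = ∫ x, ξ x ^ 2 ∂P := by
    have h1 : Var[ξ; P] = ∫ x, ξ x ^ 2 ∂P := by
      rw [variance_of_integral_eq_zero hξ.aemeasurable hmean]
    rw [← h1]
    conv_rhs => rw [← (hmp 0).map_eq]
    rw [variance_map hξ.aemeasurable (hmp 0).measurable.aemeasurable]
    rfl
  have hclt := tendstoInDistribution_inv_sqrt_mul_sum_sub (P := P') (Y := (id : ℝ → ℝ))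
    (P' := gaussianReal 0 (∫ x, ξ x ^ 2 ∂P).toNNReal) (X := fun k ω => ξ (ω k))
    ⟨aemeasurable_id, by rw [hvar, Measure.map_id]⟩
    (hmem.comp_measurePreserving (hmp 0)) hindep hident
  rw [hint] at hclt
  have hsub : TendstoInDistribution
      (fun n (ω : ℕ → E) => (√((2 * N n : ℕ) : ℝ))⁻¹ *
        (∑ k ∈ Finset.range (2 * N n), ξ (ω k) - (2 * N n : ℕ) * 0)) atTop
      (id : ℝ → ℝ) (fun _ => P') (gaussianReal 0 (∫ x, ξ x ^ 2 ∂P).toNNReal) :=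
    ⟨fun n => hclt.forall_aemeasurable (2 * N n), aemeasurable_id,
      hclt.tendsto.comp (hN.const_mul_atTop' two_pos)⟩
  refine TendstoInDistribution.comp_map hsub (fun n => Measurable.aemeasurable (by fun_prop)) fun n => ?_
  have hm1 : IsProbabilityMeasure (((Measure.pi fun _ : Bool => Measure.pi fun _ : Fin (N n) => P)).map
      fun z : Bool → Fin (N n) → E => (√(2 * (N n : ℝ)))⁻¹ * ∑ l, ∑ i, ξ (z l i)) :=
    Measure.isProbabilityMeasure_map (Measurable.aemeasurable (by fun_prop))
  have hm2 : IsProbabilityMeasure (P'.map fun ω : ℕ → E => (√((2 * N n : ℕ) : ℝ))⁻¹ *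
        (∑ k ∈ Finset.range (2 * N n), ξ (ω k) - (2 * N n : ℕ) * 0)) :=
    Measure.isProbabilityMeasure_map (Measurable.aemeasurable (by fun_prop))
  refine Measure.ext_of_charFun (funext fun t => ?_)
  simp only [mul_zero, sub_zero]
  rw [charFun_inv_sqrt_mul_sum hindep hident, hmap]
  have h1 : ((Measure.pi fun _ : Bool => Measure.pi fun _ : Fin (N n) => P).map
      fun z : Bool → Fin (N n) → E => (√(2 * (N n : ℝ)))⁻¹ * ∑ l, ∑ i, ξ (z l i)) =
      ((Measure.pi fun _ : Bool => Measure.pi fun _ : Fin (N n) => P).map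
        fun z : Bool → Fin (N n) → E => ∑ l, ∑ i, ξ (z l i)).map
        fun y => (√(2 * (N n : ℝ)))⁻¹ * y := by
    rw [Measure.map_map (by fun_prop) (by fun_prop)]
    rfl
  rw [h1, charFun_map_mul,
    charFun_map_sum_pi (Measure.pi fun _ : Fin (N n) => P) (ξ := fun y => ∑ i, ξ (y i))
      (by fun_prop), charFun_map_sum_pi P hξ, Fintype.card_bool, Fintype.card_fin, ← pow_mul,
    mul_comm (N n) 2]
  push_cast
  rfl

end Distribution

/-! ### Measurable selection of extremal and mean value points -/

section Selection

variable {Ω : Type*} [MeasurableSpace Ω]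

/-- The first maximizer over the unit interval of a random continuous function is measurable. -/
theorem exists_measurable_argmax {ψ : Ω → ℝ → ℝ}
    (hm : ∀ t ∈ Set.Icc (0 : ℝ) 1, Measurable fun ω => ψ ω t)
    (hc : ∀ ω, ContinuousOn (ψ ω) (Set.Icc 0 1)) :
    ∃ τ : Ω → ℝ, Measurable τ ∧
      ∀ ω, τ ω ∈ Set.Icc (0 : ℝ) 1 ∧ ∀ t ∈ Set.Icc (0 : ℝ) 1, ψ ω t ≤ ψ ω (τ ω) := by
  set A : Ω → Set ℝ := fun ω =>
    {t | t ∈ Set.Icc (0 : ℝ) 1 ∧ ∀ s ∈ Set.Icc (0 : ℝ) 1, ψ ω s ≤ ψ ω t} with hA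
  have hne : ∀ ω, (A ω).Nonempty := fun ω => by
    obtain ⟨t, ht, hmax⟩ := isCompact_Icc.exists_isMaxOn (Set.nonempty_Icc.2 zero_le_one) (hc ω)
    exact ⟨t, ht, fun s hs => hmax hs⟩
  have hcpt : ∀ ω, IsCompact (A ω) := fun ω => by
    have hEq : A ω = Set.Icc (0 : ℝ) 1 ∩
        ⋂ s ∈ Set.Icc (0 : ℝ) 1, (Set.Icc (0 : ℝ) 1 ∩ ψ ω ⁻¹' Set.Ici (ψ ω s)) := by
      ext t
      simp only [hA, Set.mem_ofPred_eq, Set.mem_inter_iff, Set.mem_iInter, Set.mem_preimage,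
        Set.mem_Ici]
      exact ⟨fun h => ⟨h.1, fun s hs => ⟨h.1, h.2 s hs⟩⟩, fun h => ⟨h.1, fun s hs => (h.2 s hs).2⟩⟩
    rw [hEq]
    exact isCompact_Icc.inter_right (isClosed_biInter fun s _ =>
      (hc ω).preimage_isClosed_of_isClosed isClosed_Icc isClosed_Ici)
  have hmem : ∀ ω, sInf (A ω) ∈ A ω := fun ω => (hcpt ω).sInf_mem (hne ω)
  refine ⟨fun ω => sInf (A ω), measurable_of_Iic fun c => ?_, fun ω => hmem ω⟩
  by_cases hc0 : c < 0
  · convert MeasurableSet.empty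
    ext ω
    simp only [Set.mem_preimage, Set.mem_Iic, Set.mem_empty_iff_false, iff_false, not_le]
    exact hc0.trans_le (hmem ω).1.1
  push Not at hc0
  set c' := min c 1
  have hc'0 : 0 ≤ c' := le_min hc0 zero_le_one
  have hc'1 : c' ≤ 1 := min_le_right _ _
  have hsub : Set.Icc 0 c' ⊆ Set.Icc (0 : ℝ) 1 := Set.Icc_subset_Icc_right hc'1
  obtain ⟨D, hDc, hDd⟩ := TopologicalSpace.exists_countable_dense (Set.Icc (0 : ℝ) 1)
  obtain ⟨D', hDc', hDd'⟩ := TopologicalSpace.exists_countable_dense (Set.Icc (0 : ℝ) c')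
  have hEq : (fun ω => sInf (A ω)) ⁻¹' Set.Iic c =
      ⋂ q ∈ D, ⋂ n : ℕ, ⋃ r ∈ D', {ω | ψ ω q - 1 / ((n : ℝ) + 1) < ψ ω r} := by
    ext ω
    simp only [Set.mem_preimage, Set.mem_Iic, Set.mem_iInter, Set.mem_iUnion, Set.mem_ofPred_eq]
    constructor
    · intro hle q hq n
      have hτ : sInf (A ω) ∈ Set.Icc 0 c' := ⟨(hmem ω).1.1, le_min hle (hmem ω).1.2⟩
      have hcont : Continuous fun r : Set.Icc (0 : ℝ) c' => ψ ω r :=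
        continuousOn_iff_continuous_domRestrict.1 ((hc ω).mono hsub)
      have hopen : IsOpen {r : Set.Icc (0 : ℝ) c' | ψ ω q - 1 / ((n : ℝ) + 1) < ψ ω r} :=
        isOpen_lt continuous_const hcont
      obtain ⟨r, hr, hrD⟩ := hDd'.inter_open_nonempty _ hopen ⟨⟨_, hτ⟩, by
        have h1 := (hmem ω).2 q q.2
        have h2 : 0 < 1 / ((n : ℝ) + 1) := by positivity
        simp only [Set.mem_ofPred_eq]
        linarith⟩
      exact ⟨r, hrD, hr⟩
    · intro h
      obtain ⟨t, ht, hmax⟩ := isCompact_Icc.exists_isMaxOn (Set.nonempty_Icc.2 hc'0)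
        ((hc ω).mono hsub)
      have hq : ∀ q ∈ D, ψ ω q ≤ ψ ω t := fun q hq => by
        refine le_of_forall_pos_lt_add fun ε hε => ?_
        obtain ⟨n, hn⟩ := exists_nat_one_div_lt hε
        obtain ⟨r, -, hr⟩ := h q hq n
        have h3 : ψ ω r ≤ ψ ω t := hmax r.2
        linarith
      have hcl : IsClosed {q : Set.Icc (0 : ℝ) 1 | ψ ω q ≤ ψ ω t} :=
        isClosed_le (continuousOn_iff_continuous_domRestrict.1 (hc ω)) continuous_const
      have hall : ∀ s ∈ Set.Icc (0 : ℝ) 1, ψ ω s ≤ ψ ω t := fun s hs => by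
        have : closure D ⊆ {q : Set.Icc (0 : ℝ) 1 | ψ ω q ≤ ψ ω t} :=
          closure_minimal hq hcl
        exact this (hDd ⟨s, hs⟩)
      have htA : t ∈ A ω := ⟨hsub ht, hall⟩
      exact (csInf_le (hcpt ω).bddBelow htA).trans (ht.2.trans (min_le_left _ _))
  rw [hEq]
  refine MeasurableSet.biInter hDc fun q _ => MeasurableSet.iInter fun n =>
    MeasurableSet.biUnion hDc' fun r _ => ?_
  exact measurableSet_lt ((hm q q.2).sub_const _) (hm r (hsub r.2))

/-- A mean value point of a random differentiable function may be chosen measurably. -/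
theorem exists_measurable_mean_value {φ φ' : Ω → ℝ → ℝ}
    (hm : ∀ t ∈ Set.Icc (0 : ℝ) 1, Measurable fun ω => φ ω t)
    (hd : ∀ ω, ∀ t ∈ Set.Icc (0 : ℝ) 1, HasDerivAt (φ ω) (φ' ω t) t) :
    ∃ τ : Ω → ℝ, Measurable τ ∧
      ∀ ω, τ ω ∈ Set.Icc (0 : ℝ) 1 ∧ φ' ω (τ ω) = φ ω 1 - φ ω 0 := by
  classical
  set ψ : Ω → ℝ → ℝ := fun ω t => φ ω t - φ ω 0 - t * (φ ω 1 - φ ω 0) with hψ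
  have h0 : (0 : ℝ) ∈ Set.Icc (0 : ℝ) 1 := by simp
  have h1 : (1 : ℝ) ∈ Set.Icc (0 : ℝ) 1 := by simp
  have hψm : ∀ t ∈ Set.Icc (0 : ℝ) 1, Measurable fun ω => ψ ω t := fun t ht =>
    ((hm t ht).sub (hm 0 h0)).sub (((hm 1 h1).sub (hm 0 h0)).const_mul t)
  have hψd : ∀ ω, ∀ t ∈ Set.Icc (0 : ℝ) 1,
      HasDerivAt (ψ ω) (φ' ω t - (φ ω 1 - φ ω 0)) t := fun ω t ht => by
    have := ((hd ω t ht).sub_const (φ ω 0)).sub ((hasDerivAt_id t).mul_const (φ ω 1 - φ ω 0))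
    rw [one_mul] at this
    exact this
  have hψc : ∀ ω, ContinuousOn (ψ ω) (Set.Icc 0 1) := fun ω t ht =>
    (hψd ω t ht).continuousAt.continuousWithinAt
  have hψ0 : ∀ ω, ψ ω 0 = 0 := fun ω => by simp [hψ]
  have hψ1 : ∀ ω, ψ ω 1 = 0 := fun ω => by simp [hψ]
  obtain ⟨τ₁, hτ₁m, hτ₁⟩ := exists_measurable_argmax hψm hψc
  obtain ⟨τ₂, hτ₂m, hτ₂⟩ := exists_measurable_argmax (ψ := fun ω t => -ψ ω t)
    (fun t ht => (hψm t ht).neg) (fun ω => (hψc ω).neg)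
  refine ⟨fun ω => if τ₁ ω ∈ Set.Ioo (0 : ℝ) 1 then τ₁ ω else
    if τ₂ ω ∈ Set.Ioo (0 : ℝ) 1 then τ₂ ω else 1 / 2, ?_, fun ω => ?_⟩
  · exact Measurable.ite (hτ₁m measurableSet_Ioo) hτ₁m
      (Measurable.ite (hτ₂m measurableSet_Ioo) hτ₂m measurable_const)
  have hnhds : ∀ t ∈ Set.Ioo (0 : ℝ) 1, ∀ᶠ s in 𝓝 t, s ∈ Set.Icc (0 : ℝ) 1 := fun t ht =>
    Icc_mem_nhds ht.1 ht.2
  by_cases hi₁ : τ₁ ω ∈ Set.Ioo (0 : ℝ) 1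
  · simp only [hi₁, if_true]
    refine ⟨(hτ₁ ω).1, ?_⟩
    have hmax : IsLocalMax (ψ ω) (τ₁ ω) := (hnhds _ hi₁).mono fun s hs => (hτ₁ ω).2 s hs
    have := hmax.hasDerivAt_eq_zero (hψd ω _ (hτ₁ ω).1)
    linarith
  by_cases hi₂ : τ₂ ω ∈ Set.Ioo (0 : ℝ) 1
  · simp only [hi₁, hi₂, if_true, if_false]
    refine ⟨(hτ₂ ω).1, ?_⟩
    have hmin : IsLocalMin (ψ ω) (τ₂ ω) := (hnhds _ hi₂).mono fun s hs =>
      neg_le_neg_iff.1 ((hτ₂ ω).2 s hs)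
    have := hmin.hasDerivAt_eq_zero (hψd ω _ (hτ₂ ω).1)
    linarith
  · simp only [hi₁, hi₂, if_false]
    have hend : ∀ t ∈ Set.Icc (0 : ℝ) 1, t ∉ Set.Ioo (0 : ℝ) 1 → ψ ω t = 0 := fun t ht hn => by
      rcases eq_or_lt_of_le ht.1 with h | h
      · rw [← h, hψ0]
      · rcases eq_or_lt_of_le ht.2 with h' | h'
        · rw [h', hψ1]
        · exact absurd ⟨h, h'⟩ hn
    have hzero : ∀ t ∈ Set.Icc (0 : ℝ) 1, ψ ω t = 0 := fun t ht => by
      have ha := (hτ₁ ω).2 t ht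
      have hb := (hτ₂ ω).2 t ht
      rw [hend _ (hτ₁ ω).1 hi₁] at ha
      simp only [hend _ (hτ₂ ω).1 hi₂] at hb
      linarith
    have hhalf : (1 / 2 : ℝ) ∈ Set.Ioo (0 : ℝ) 1 := by norm_num
    have hmax : IsLocalMax (ψ ω) (1 / 2) := (hnhds _ hhalf).mono fun s hs => by
      rw [hzero s hs, hzero _ (Set.Ioo_subset_Icc_self hhalf)]
    have := hmax.hasDerivAt_eq_zero (hψd ω _ (Set.Ioo_subset_Icc_self hhalf))
    exact ⟨Set.Ioo_subset_Icc_self hhalf, by linarith⟩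

end Selection

/-! ### A uniform law of large numbers -/

section UniformLaw

variable {E : Type*} [MeasurableSpace E] {P : Measure E} [IsProbabilityMeasure P]

/-- A measurable modulus of continuity at a point, of small mean. -/
theorem exists_modulus {T : Type*} [MetricSpace T] [CompactSpace T] {Φ : T → E → ℝ}
    (hm : ∀ β, Measurable (Φ β)) (hc : ∀ z, Continuous fun β => Φ β z) {C : ℝ}
    (hC : ∀ᵐ z ∂P, ∀ β, |Φ β z| ≤ C) {ε : ℝ} (hε : 0 < ε) (β' : T) :
    ∃ η : ℝ, 0 < η ∧ ∃ w : E → ℝ, Measurable w ∧ (∀ᵐ z ∂P, |w z| ≤ 2 * C) ∧ ∫ z, w z ∂P < ε ∧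
      ∀ β, dist β β' < η → ∀ z, |Φ β z - Φ β' z| ≤ w z := by
  obtain ⟨D, hDc, hDd⟩ := TopologicalSpace.exists_countable_dense T
  set W : ℝ → E → ℝ≥0∞ := fun η z =>
    ⨆ d ∈ D, ⨆ _ : dist d β' < η, ‖Φ d z - Φ β' z‖ₑ with hW
  have hWm : ∀ η, Measurable (W η) := fun η =>
    Measurable.biSup D hDc fun d _ => Measurable.iSup_Prop _ ((hm d).sub (hm β')).enorm
  have hdom : ∀ η z β, dist β β' < η → ‖Φ β z - Φ β' z‖ₑ ≤ W η z := by
    intro η z β hβ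
    have hcl : IsClosed {b : T | ‖Φ b z - Φ β' z‖ₑ ≤ W η z} :=
      isClosed_le ((hc z).sub continuous_const).enorm continuous_const
    have hsub : Metric.ball β' η ∩ D ⊆ {b : T | ‖Φ b z - Φ β' z‖ₑ ≤ W η z} := fun b hb => by
      change _ ≤ ⨆ d ∈ D, ⨆ _ : dist d β' < η, ‖Φ d z - Φ β' z‖ₑ
      exact le_iSup₂_of_le b hb.2 (le_iSup_of_le (f := fun _ : dist b β' < η => _) hb.1 le_rfl)
    exact closure_minimal hsub hcl (hDd.open_subset_closure_inter Metric.isOpen_ball hβ)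
  have hle : ∀ η z (K : ℝ≥0∞), (∀ β, dist β β' < η → ‖Φ β z - Φ β' z‖ₑ ≤ K) → W η z ≤ K :=
    fun η z K hK => iSup₂_le fun d _ => iSup_le fun hd => hK d hd
  have hbd : ∀ η z (K : ℝ), (∀ β, |Φ β z| ≤ K) → W η z ≤ ENNReal.ofReal (2 * K) :=
    fun η z K hK => hle η z _ fun β _ => by
      rw [Real.enorm_eq_ofReal_abs]
      refine ENNReal.ofReal_le_ofReal ((abs_sub _ _).trans ?_)
      linarith [hK β, hK β']
  have hfin : ∀ η z, W η z ≠ ∞ := fun η z => by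
    obtain ⟨K, hK⟩ := (isCompact_univ (X := T)).exists_bound_of_continuousOn (hc z).continuousOn
    exact ((hbd η z K fun β => hK β (Set.mem_univ β)).trans_lt ENNReal.ofReal_lt_top).ne
  have hlim : ∀ z, Tendsto (fun n : ℕ => W (1 / ((n : ℝ) + 1)) z) atTop (𝓝 0) := fun z => by
    refine ENNReal.tendsto_nhds_zero.2 fun κ hκ => ?_
    have hcont : Continuous fun β => ‖Φ β z - Φ β' z‖ₑ := ((hc z).sub continuous_const).enorm
    have h1 : ∀ᶠ β in 𝓝 β', ‖Φ β z - Φ β' z‖ₑ < κ := by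
      refine hcont.continuousAt.eventually_lt continuousAt_const ?_
      simpa using hκ
    obtain ⟨r, hr, hball⟩ := Metric.eventually_nhds_iff.1 h1
    have h2 : ∀ᶠ n : ℕ in atTop, 1 / ((n : ℝ) + 1) < r :=
      tendsto_one_div_add_atTop_nhds_zero_nat.eventually_lt_const hr
    filter_upwards [h2] with n hn
    exact hle _ _ _ fun β hβ => (hball (hβ.trans hn)).le
  have hint : Tendsto (fun n : ℕ => ∫⁻ z, W (1 / ((n : ℝ) + 1)) z ∂P) atTop (𝓝 0) := by
    have := tendsto_lintegral_of_dominated_convergence (μ := P)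
      (F := fun (n : ℕ) z => W (1 / ((n : ℝ) + 1)) z) (f := fun _ => 0)
      (fun _ => ENNReal.ofReal (2 * C)) (fun n => hWm _)
      (fun n => hC.mono fun z hz => hbd _ z C hz) (by simp [ENNReal.mul_eq_top])
      (Eventually.of_forall hlim)
    simpa using this
  obtain ⟨n, hn⟩ := (hint.eventually_lt_const (ENNReal.ofReal_pos.2 hε)).exists
  refine ⟨1 / ((n : ℝ) + 1), by positivity, fun z => (W (1 / ((n : ℝ) + 1)) z).toReal,
    (hWm _).ennreal_toReal, ?_, ?_, fun β hβ z => ?_⟩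
  · filter_upwards [hC] with z hz
    rw [abs_of_nonneg ENNReal.toReal_nonneg]
    have hC0 : 0 ≤ C := (abs_nonneg _).trans (hz β')
    exact ENNReal.toReal_le_of_le_ofReal (by positivity) (hbd _ z C hz)
  · rw [integral_toReal (hWm _).aemeasurable
      (Eventually.of_forall fun z => lt_top_iff_ne_top.2 (hfin _ z))]
    exact (ENNReal.lt_ofReal_iff_toReal_lt (lt_top_of_lt hn).ne).1 hn
  · have := hdom _ z β hβ
    rw [Real.enorm_eq_ofReal_abs] at this
    exact (ENNReal.ofReal_le_iff_le_toReal (hfin _ z)).1 this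

theorem abs_average_le {N : ℕ} {a b : Fin N → ℝ} (h : ∀ i, |a i| ≤ b i) :
    |(1 / (N : ℝ)) * ∑ i, a i| ≤ (1 / (N : ℝ)) * ∑ i, b i := by
  rw [abs_mul, abs_of_nonneg (by positivity : (0 : ℝ) ≤ 1 / (N : ℝ))]
  gcongr
  exact (Finset.abs_sum_le_sum_abs _ _).trans (Finset.sum_le_sum fun i _ => h i)

/-- Uniform weak law of large numbers over a compact parameter space. -/
theorem whp_uniform_average {T : Type*} [MetricSpace T] [CompactSpace T] {Φ : T → E → ℝ}
    (hm : ∀ β, Measurable (Φ β)) (hc : ∀ z, Continuous fun β => Φ β z) {C : ℝ}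
    (hC : ∀ᵐ z ∂P, ∀ β, |Φ β z| ≤ C) {N : ℕ → ℕ} (hN : Tendsto N atTop atTop) {ε : ℝ}
    (hε : 0 < ε) :
    Whp (fun n => Measure.pi fun _ : Fin (N n) => P)
      fun n z => ∀ β, |(1 / (N n : ℝ)) * ∑ i, Φ β (z i) - ∫ x, Φ β x ∂P| < ε := by
  have hε4 : 0 < ε / 4 := by positivity
  choose η hη w hwm hwC hwint hw using fun β' => exists_modulus (P := P) hm hc hC hε4 β'
  obtain ⟨t, ht⟩ := (isCompact_univ (X := T)).elim_nhds_subcover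
    (fun β' => Metric.ball β' (η β')) fun β' _ => Metric.ball_mem_nhds β' (hη β')
  have h1 := whp_forall_finset t fun β' _ => whp_average_sub_integral_lt (P := P) hN (hm β')
    (hC.mono fun z hz => hz β') hε4
  have h2 := whp_forall_finset t fun β' _ => whp_average_sub_integral_lt (P := P) hN (hwm β')
    (hwC β') hε4
  refine (h1.and h2).mono fun n z hz β => ?_
  obtain ⟨β', hβ't, hβ⟩ : ∃ β' ∈ t, dist β β' < η β' := by
    simpa using ht.2 (Set.mem_univ β)
  have e1 := hz.1 β' hβ't
  have e2 := hz.2 β' hβ't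
  have e3 := hwint β'
  have hiΦ : ∀ b, Integrable (Φ b) P := fun b =>
    Integrable.of_bound (hm b).aestronglyMeasurable C (hC.mono fun z hz => hz b)
  have hiw : Integrable (w β') P :=
    Integrable.of_bound (hwm β').aestronglyMeasurable (2 * C) (hwC β')
  have e4 : |∫ x, Φ β x ∂P - ∫ x, Φ β' x ∂P| ≤ ∫ x, w β' x ∂P := by
    rw [← integral_sub (hiΦ β) (hiΦ β')]
    exact (abs_integral_le_integral_abs).trans
      (integral_mono ((hiΦ β).sub (hiΦ β')).abs hiw fun x => hw β' β hβ x)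
  have e5 : |(1 / (N n : ℝ)) * ∑ i, Φ β (z i) - (1 / (N n : ℝ)) * ∑ i, Φ β' (z i)| ≤
      (1 / (N n : ℝ)) * ∑ i, w β' (z i) := by
    rw [← mul_sub, ← Finset.sum_sub_distrib]
    exact abs_average_le fun i => hw β' β hβ (z i)
  rw [abs_lt] at e1 e2 ⊢
  rw [abs_le] at e4 e5
  constructor <;> linarith [e1.1, e1.2, e2.1, e2.2, e4.1, e4.2, e5.1, e5.2]

end UniformLaw

/-! ### The covariate shift population as a kernel model -/

namespace CovariateShift

variable {X : Type*} [MeasurableSpace X] {lamX : Measure X} {lamY : Measure ℝ}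

section Basic

variable (S : CovariateShift lamX lamY)

/-- The problem in which the train and the test population are exchanged. -/
def swap : CovariateShift lamX lamY :=
  { S with
    p := S.q, q := S.p
    measurable_p := S.measurable_q
    measurable_q := S.measurable_p
    lintegral_p := S.lintegral_q
    lintegral_q := S.lintegral_p }

theorem measurable_uncurry_w : Measurable (Function.uncurry fun x y => (S.w y x : ℝ≥0∞)) :=
  (S.measurable_w.comp measurable_swap).coe_nnreal_ennreal

theorem measurable_w_right (x : X) : Measurable fun y => S.w y x :=
  S.measurable_w.comp measurable_prodMk_right

theorem measurable_ratio : Measurable S.ratio :=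
  S.measurable_q.coe_nnreal_real.div S.measurable_p.coe_nnreal_real

theorem ratio_nonneg (x : X) : 0 ≤ S.ratio x := by unfold ratio; positivity

variable [SigmaFinite lamY]

/-- The conditional law of the outcome given the covariate. -/
def outcomeKernel : Kernel X ℝ :=
  (Kernel.const X lamY).withDensity fun x y => (S.w y x : ℝ≥0∞)

theorem outcomeKernel_apply (x : X) :
    S.outcomeKernel x = lamY.withDensity fun y => (S.w y x : ℝ≥0∞) := by
  rw [outcomeKernel, Kernel.withDensity_apply _ S.measurable_uncurry_w, Kernel.const_apply]

instance : IsMarkovKernel S.outcomeKernel :=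
  ⟨fun x => ⟨by
    rw [S.outcomeKernel_apply, withDensity_apply _ MeasurableSet.univ, Measure.restrict_univ,
      S.lintegral_w]⟩⟩

instance : IsProbabilityMeasure S.trainCov :=
  ⟨by rw [trainCov, withDensity_apply _ MeasurableSet.univ, Measure.restrict_univ, S.lintegral_p]⟩

instance : IsProbabilityMeasure S.testCov :=
  inferInstanceAs (IsProbabilityMeasure S.swap.trainCov)

theorem trainLaw_eq_compProd : S.trainLaw = S.trainCov ⊗ₘ S.outcomeKernel := by
  refine Measure.ext_of_lintegral _ fun F hF => ?_
  have hd : Measurable fun z : X × ℝ => ((S.w z.2 z.1 * S.p z.1 : ℝ≥0) : ℝ≥0∞) :=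
    ((S.measurable_w.comp measurable_swap).mul
      (S.measurable_p.comp measurable_fst)).coe_nnreal_ennreal
  have hi : Measurable fun x => ∫⁻ y, F (x, y) ∂S.outcomeKernel x :=
    Measurable.lintegral_kernel_prod_right hF
  rw [trainLaw, lintegral_withDensity_eq_lintegral_mul _ hd hF, lintegral_prod _
    (hd.mul hF).aemeasurable, Measure.lintegral_compProd hF, trainCov,
    lintegral_withDensity_eq_lintegral_mul _ S.measurable_p.coe_nnreal_ennreal hi]
  refine lintegral_congr fun x => ?_
  have hwx : Measurable fun y => (S.w y x : ℝ≥0∞) := (S.measurable_w_right x).coe_nnreal_ennreal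
  have hFx : Measurable fun y => F (x, y) := hF.comp measurable_prodMk_left
  rw [Pi.mul_apply, S.outcomeKernel_apply, lintegral_withDensity_eq_lintegral_mul _ hwx hFx,
    ← lintegral_const_mul _ (hwx.mul hFx)]
  refine lintegral_congr fun y => ?_
  simp only [Pi.mul_apply, ENNReal.coe_mul]
  ring

instance : IsProbabilityMeasure S.trainLaw := by
  rw [S.trainLaw_eq_compProd]; infer_instance

theorem measurePreserving_fst : MeasurePreserving Prod.fst S.trainLaw S.trainCov :=
  ⟨measurable_fst, by
    have := Measure.fst_compProd S.trainCov S.outcomeKernel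
    rwa [← S.trainLaw_eq_compProd] at this⟩

theorem integrable_comp_fst {u : X → ℝ} (hu : Integrable u S.trainCov) :
    Integrable (fun z : X × ℝ => u z.1) S.trainLaw :=
  S.measurePreserving_fst.integrable_comp_of_integrable hu

theorem integral_comp_fst {u : X → ℝ} (hu : Measurable u) :
    ∫ z, u z.1 ∂S.trainLaw = ∫ x, u x ∂S.trainCov := by
  rw [← S.measurePreserving_fst.map_eq,
    integral_map measurable_fst.aemeasurable hu.aestronglyMeasurable]

theorem f0_eq (x : X) : S.f0 x = ∫ y, y ∂S.outcomeKernel x := by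
  rw [S.outcomeKernel_apply, integral_withDensity_eq_integral_smul (S.measurable_w_right x), f0]
  refine integral_congr_ae (Eventually.of_forall fun y => ?_)
  simp [NNReal.smul_def, mul_comm]

theorem sigmaSq_eq (x : X) : S.sigmaSq x = ∫ y, (y - S.f0 x) ^ 2 ∂S.outcomeKernel x := by
  rw [S.outcomeKernel_apply, integral_withDensity_eq_integral_smul (S.measurable_w_right x),
    sigmaSq]
  refine integral_congr_ae (Eventually.of_forall fun y => ?_)
  simp [NNReal.smul_def, mul_comm]

theorem measurable_f0 : Measurable S.f0 := by
  have : StronglyMeasurable fun x => ∫ y, y ∂S.outcomeKernel x :=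
    StronglyMeasurable.integral_kernel stronglyMeasurable_id
  exact (funext S.f0_eq : S.f0 = _) ▸ this.measurable

variable {S}

/-- The regression residual is orthogonal to functions of the covariate. -/
theorem integral_mul_residual {C : ℝ} (hY : ∀ᵐ z ∂S.trainLaw, |z.2| ≤ C) {B : ℝ}
    (hf : ∀ x, |S.f0 x| ≤ B) {u : X → ℝ} (hu : Integrable u S.trainCov) :
    Integrable (fun z : X × ℝ => u z.1 * (z.2 - S.f0 z.1)) S.trainLaw ∧
      ∫ z, u z.1 * (z.2 - S.f0 z.1) ∂S.trainLaw = 0 := by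
  have hu1 : Integrable (fun z : X × ℝ => u z.1) S.trainLaw :=
    S.integrable_comp_fst hu
  have hm : Measurable fun z : X × ℝ => z.2 - S.f0 z.1 :=
    measurable_snd.sub (S.measurable_f0.comp measurable_fst)
  have hint : Integrable (fun z : X × ℝ => u z.1 * (z.2 - S.f0 z.1)) S.trainLaw := by
    refine hu1.mul_bdd (c := C + B) hm.aestronglyMeasurable ?_
    filter_upwards [hY] with z hz
    rw [Real.norm_eq_abs]
    exact (abs_sub _ _).trans (add_le_add hz (hf z.1))
  refine ⟨hint, ?_⟩
  rw [S.trainLaw_eq_compProd] at hint hY ⊢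
  rw [Measure.integral_compProd hint]
  refine integral_eq_zero_of_ae ?_
  filter_upwards [Measure.ae_ae_of_ae_compProd hY] with x hx
  have hy : Integrable (fun y : ℝ => y) (S.outcomeKernel x) :=
    Integrable.of_bound measurable_id.aestronglyMeasurable C hx
  simp only [Pi.zero_apply]
  rw [integral_const_mul, integral_sub hy (integrable_const _), ← S.f0_eq]
  simp

theorem integral_sq_mul_residual_sq {C : ℝ} (hY : ∀ᵐ z ∂S.trainLaw, |z.2| ≤ C) {B : ℝ}
    (hf : ∀ x, |S.f0 x| ≤ B) {u : X → ℝ} (hu : Measurable u) {D : ℝ} (hD : ∀ x, |u x| ≤ D) :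
    ∫ z, (u z.1 * (z.2 - S.f0 z.1)) ^ 2 ∂S.trainLaw = ∫ x, u x ^ 2 * S.sigmaSq x ∂S.trainCov := by
  have hm : Measurable fun z : X × ℝ => (u z.1 * (z.2 - S.f0 z.1)) ^ 2 :=
    ((hu.comp measurable_fst).mul
      (measurable_snd.sub (S.measurable_f0.comp measurable_fst))).pow_const 2
  have hint : Integrable (fun z : X × ℝ => (u z.1 * (z.2 - S.f0 z.1)) ^ 2) S.trainLaw := by
    refine Integrable.of_bound hm.aestronglyMeasurable ((D * (C + B)) ^ 2) ?_
    filter_upwards [hY] with z hz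
    rw [Real.norm_eq_abs, abs_pow, abs_mul]
    have hD0 : 0 ≤ D := (abs_nonneg _).trans (hD z.1)
    gcongr
    · exact hD z.1
    · exact (abs_sub _ _).trans (add_le_add hz (hf z.1))
  rw [S.trainLaw_eq_compProd] at hint ⊢
  rw [Measure.integral_compProd hint]
  refine integral_congr_ae (Eventually.of_forall fun x => ?_)
  simp only [mul_pow]
  rw [integral_const_mul, ← S.sigmaSq_eq]

end Basic

section Overlap

variable {S : CovariateShift lamX lamY}

theorem Overlap.ratio_mul_p (h : S.Overlap) (x : X) : S.ratio x * S.p x = S.q x := by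
  by_cases hp : S.p x = 0
  · simp [hp, h.1 x hp]
  · have : (S.p x : ℝ) ≠ 0 := by exact_mod_cast hp
    rw [ratio, div_mul_cancel₀ _ this]

theorem Overlap.testCov_eq (h : S.Overlap) :
    S.testCov = S.trainCov.withDensity fun x => ENNReal.ofReal (S.ratio x) := by
  rw [trainCov, ← withDensity_mul _ S.measurable_p.coe_nnreal_ennreal
    S.measurable_ratio.ennreal_ofReal, testCov]
  congr 1
  ext x
  rw [Pi.mul_apply, mul_comm, ← ENNReal.ofReal_coe_nnreal, ← ENNReal.ofReal_coe_nnreal,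
    ← ENNReal.ofReal_mul (S.ratio_nonneg x), h.ratio_mul_p]

theorem Overlap.testCov_absolutelyContinuous (h : S.Overlap) : S.testCov ≪ S.trainCov := by
  rw [h.testCov_eq]
  exact withDensity_absolutelyContinuous _ _

theorem Overlap.integral_testCov (h : S.Overlap) (u : X → ℝ) :
    ∫ x, u x ∂S.testCov = ∫ x, S.ratio x * u x ∂S.trainCov := by
  rw [h.testCov_eq, integral_withDensity_eq_integral_toReal_smul
    S.measurable_ratio.ennreal_ofReal (Eventually.of_forall fun _ => ENNReal.ofReal_lt_top)]
  refine integral_congr_ae (Eventually.of_forall fun x => ?_)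
  simp [ENNReal.toReal_ofReal (S.ratio_nonneg x)]

theorem Overlap.lintegral_testCov_le (h : S.Overlap) {Cr : ℝ} (hCr : ∀ x, S.ratio x ≤ Cr)
    (F : X → ℝ≥0∞) (hF : Measurable F) :
    ∫⁻ x, F x ∂S.testCov ≤ ENNReal.ofReal Cr * ∫⁻ x, F x ∂S.trainCov := by
  rw [h.testCov_eq, lintegral_withDensity_eq_lintegral_mul _ S.measurable_ratio.ennreal_ofReal hF,
    ← lintegral_const_mul _ hF]
  refine lintegral_mono fun x => ?_
  rw [Pi.mul_apply]
  gcongr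
  exact hCr x

end Overlap

end CovariateShift

/-! ### Identification -/

section Identification

variable {X : Type*} [MeasurableSpace X] {lamX : Measure X} {lamY : Measure ℝ}
  [SigmaFinite lamY] {S : CovariateShift lamX lamY} {k : ℕ}

theorem risk_eq_add {g : Param k → X → ℝ} {β βs : Param k} (hβ : Measurable (g β))
    {B C : ℝ} (hB : ∀ x, |g β x| ≤ B) (hBs : ∀ x, |g βs x| ≤ B) (hs : ∀ x, S.f0 x = g βs x)
    (hY : ∀ᵐ z ∂S.trainLaw, |z.2| ≤ C) :
    risk S.trainLaw g β = risk S.trainLaw g βs + ∫ x, (g β x - S.f0 x) ^ 2 ∂S.trainCov := by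
  have hf : ∀ x, |S.f0 x| ≤ B := fun x => by rw [hs]; exact hBs x
  have hf0 := S.measurable_f0
  have hd : Measurable fun x => g β x - S.f0 x := hβ.sub hf0
  have hdB : ∀ x, |g β x - S.f0 x| ≤ 2 * B := fun x =>
    (abs_sub _ _).trans (by linarith [hB x, hf x])
  have hdi : Integrable (fun x => g β x - S.f0 x) S.trainCov :=
    Integrable.of_bound hd.aestronglyMeasurable (2 * B) (Eventually.of_forall hdB)
  have hdi2 : Integrable (fun x => (g β x - S.f0 x) ^ 2) S.trainCov := by
    refine Integrable.of_bound (hd.pow_const 2).aestronglyMeasurable ((2 * B) ^ 2)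
      (Eventually.of_forall fun x => ?_)
    rw [Real.norm_eq_abs, abs_pow]
    gcongr
    exact hdB x
  obtain ⟨hri, hr0⟩ := CovariateShift.integral_mul_residual hY hf hdi
  have hsq : Integrable (fun z : X × ℝ => (z.2 - S.f0 z.1) ^ 2) S.trainLaw := by
    refine Integrable.of_bound
      ((measurable_snd.sub (hf0.comp measurable_fst)).pow_const 2).aestronglyMeasurable
      ((C + B) ^ 2) ?_
    filter_upwards [hY] with z hz
    rw [Real.norm_eq_abs, abs_pow]
    gcongr
    exact (abs_sub _ _).trans (add_le_add hz (hf z.1))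
  have hdi2' : Integrable (fun z : X × ℝ => (g β z.1 - S.f0 z.1) ^ 2) S.trainLaw :=
    S.integrable_comp_fst (u := fun x => (g β x - S.f0 x) ^ 2) hdi2
  have hfst : ∫ x, (g β x - S.f0 x) ^ 2 ∂S.trainCov =
      ∫ z, (g β z.1 - S.f0 z.1) ^ 2 ∂S.trainLaw :=
    (S.integral_comp_fst (u := fun x => (g β x - S.f0 x) ^ 2) (hd.pow_const 2)).symm
  have hrisk : risk S.trainLaw g βs = ∫ z, (z.2 - S.f0 z.1) ^ 2 ∂S.trainLaw := by
    simp only [risk, hs]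
  rw [hrisk, hfst, ← integral_add hsq hdi2']
  have h2 : ∫ z, -2 * ((g β z.1 - S.f0 z.1) * (z.2 - S.f0 z.1)) ∂S.trainLaw = 0 := by
    rw [integral_const_mul, hr0, mul_zero]
  have h3 : risk S.trainLaw g β = ∫ z, ((z.2 - S.f0 z.1) ^ 2 + (g β z.1 - S.f0 z.1) ^ 2) +
      -2 * ((g β z.1 - S.f0 z.1) * (z.2 - S.f0 z.1)) ∂S.trainLaw :=
    integral_congr_ae (Eventually.of_forall fun z => by simp only; ring)
  have h4 : Integrable (fun z : X × ℝ => (z.2 - S.f0 z.1) ^ 2 + (g β z.1 - S.f0 z.1) ^ 2)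
      S.trainLaw := hsq.add hdi2'
  rw [h3, integral_add h4 (hri.const_mul _), h2, add_zero]

/-- Under correct specification, the train and the test minimizers coincide, they represent the
regression function, and the parameter is identified in the test population. -/
theorem identification {Θ : Set (Param k)} {g : Param k → X → ℝ}
    (hm : ∀ β ∈ Θ, Measurable (g β)) {B C : ℝ} (hB : ∀ β ∈ Θ, ∀ x, |g β x| ≤ B)
    (hspec : ∃ β ∈ Θ, ∀ x, S.f0 x = g β x) (hov : S.Overlap)
    (hY : ∀ᵐ z ∂S.trainLaw, |z.2| ≤ C) (hYt : ∀ᵐ z ∂S.testLaw, |z.2| ≤ C)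
    {β₀ βt₀ : Param k} (h_train : IsArgmin Θ (risk S.trainLaw g) β₀)
    (h_unique : ∀ β, IsArgmin Θ (risk S.testLaw g) β → β = βt₀) :
    β₀ = βt₀ ∧ (∀ x, S.f0 x = g β₀ x) ∧
      ∀ β ∈ Θ, ∫ x, (g β x - S.f0 x) ^ 2 ∂S.testCov = 0 → β = β₀ := by
  obtain ⟨βs, hsΘ, hs⟩ := hspec
  have htrain : ∀ β ∈ Θ, risk S.trainLaw g β =
      risk S.trainLaw g βs + ∫ x, (g β x - S.f0 x) ^ 2 ∂S.trainCov := fun β hβ =>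
    risk_eq_add (hm β hβ) (hB β hβ) (hB βs hsΘ) hs hY
  have htest : ∀ β ∈ Θ, risk S.testLaw g β =
      risk S.testLaw g βs + ∫ x, (g β x - S.f0 x) ^ 2 ∂S.testCov := fun β hβ =>
    risk_eq_add (S := S.swap) (hm β hβ) (hB β hβ) (hB βs hsΘ) hs hYt
  have hmin : ∀ β ∈ Θ, ∫ x, (g β x - S.f0 x) ^ 2 ∂S.testCov = 0 → β = βt₀ := fun β hβ h0 => by
    refine h_unique β ⟨hβ, fun b hb => ?_⟩
    simp only [Set.mem_ofPred_eq]
    rw [htest β hβ, h0, add_zero, htest b hb]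
    exact le_add_of_nonneg_right (integral_nonneg fun x => sq_nonneg _)
  have hsb : βs = βt₀ := hmin βs hsΘ (by simp [hs])
  have h0 : ∫ x, (g β₀ x - S.f0 x) ^ 2 ∂S.trainCov = 0 := by
    refine le_antisymm ?_ (integral_nonneg fun x => sq_nonneg _)
    have h1 : risk S.trainLaw g β₀ ≤ risk S.trainLaw g βs := h_train.2 hsΘ
    rw [htrain β₀ h_train.1] at h1
    linarith
  have hi : Integrable (fun x => (g β₀ x - S.f0 x) ^ 2) S.trainCov := by
    refine Integrable.of_bound
      (((hm β₀ h_train.1).sub S.measurable_f0).pow_const 2).aestronglyMeasurable ((2 * B) ^ 2)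
      (Eventually.of_forall fun x => ?_)
    rw [Real.norm_eq_abs, abs_pow]
    gcongr
    refine (abs_sub _ _).trans ?_
    rw [hs]
    linarith [hB β₀ h_train.1 x, hB βs hsΘ x]
  have hae := (integral_eq_zero_iff_of_nonneg (fun x => sq_nonneg _) hi).1 h0
  have hβ : β₀ = βt₀ := hmin β₀ h_train.1
    (integral_eq_zero_of_ae (hov.testCov_absolutelyContinuous hae))
  refine ⟨hβ, fun x => by rw [hs, hsb, hβ], fun β hβΘ h => by rw [hmin β hβΘ h, hβ]⟩

end Identification

/-! ### Regularity of the model -/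

section Regularity

variable {X : Type*} [MeasurableSpace X] {k : ℕ}

theorem measurable_fderiv_apply {F : Param k → X → ℝ} {U : Set (Param k)} (hU : IsOpen U)
    (hm : ∀ b ∈ U, Measurable (F b)) {β : Param k} (hβ : β ∈ U)
    (hd : ∀ x, DifferentiableAt ℝ (fun b => F b x) β) (v : Param k) :
    Measurable fun x => fderiv ℝ (fun b => F b x) β v := by
  have hlim : Tendsto (fun n : ℕ => β + ((n : ℝ))⁻¹ • v) atTop (𝓝 β) := by
    have h1 : Tendsto (fun n : ℕ => β + ((n : ℝ))⁻¹ • v) atTop (𝓝 (β + (0 : ℝ) • v)) :=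
      tendsto_const_nhds.add (tendsto_inv_atTop_nhds_zero_nat.smul_const v)
    simpa using h1
  obtain ⟨n₀, hn₀⟩ := eventually_atTop.1 (hlim.eventually (hU.mem_nhds hβ))
  refine measurable_of_tendsto_metrizable (f := fun (n : ℕ) x =>
    ((n + n₀ : ℕ) : ℝ) * (F (β + (((n + n₀ : ℕ) : ℝ))⁻¹ • v) x - F β x)) (fun n => ?_) ?_
  · exact ((hm _ (hn₀ _ (Nat.le_add_left _ _))).sub (hm β hβ)).const_mul _
  · refine tendsto_pi_nhds.2 fun x => ?_
    have hc : Tendsto (fun n : ℕ => ‖(n : ℝ)‖) atTop atTop := by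
      simpa using tendsto_natCast_atTop_atTop (R := ℝ)
    exact ((hd x).hasFDerivAt.lim v hc).comp (tendsto_add_atTop_nat n₀)

theorem measurable_comp_of_continuousOn {F : Param k → X → ℝ} {U : Set (Param k)}
    (hm : ∀ b ∈ U, Measurable (F b)) (hc : ∀ x, ContinuousOn (fun b => F b x) U)
    {Ω : Type*} [MeasurableSpace Ω] {b : Ω → Param k} (hb : Measurable b) (hbU : ∀ ω, b ω ∈ U)
    {ξ : Ω → X} (hξ : Measurable ξ) : Measurable fun ω => F (b ω) (ξ ω) := by
  have h1 : Measurable (Function.uncurry fun (c : U) x => F c x) :=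
    measurable_uncurry_of_continuous_of_measurable
      (fun x => continuousOn_iff_continuous_domRestrict.1 (hc x)) fun c => hm c c.2
  have h2 : Measurable fun ω => ((⟨b ω, hbU ω⟩ : U), ξ ω) := (hb.subtype_mk).prodMk hξ
  exact h1.comp h2

theorem fderiv_apply_eq_sum {f : Param k → ℝ} {β : Param k} (v : Param k) :
    fderiv ℝ f β v = ∑ b, fderiv ℝ f β (EuclideanSpace.single b 1) * v b := by
  have hv : v = ∑ b, v b • EuclideanSpace.single b (1 : ℝ) := by
    ext i
    simp [Pi.single_apply]
  conv_lhs => rw [hv]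
  rw [map_sum]
  refine Finset.sum_congr rfl fun b _ => ?_
  rw [map_smul, smul_eq_mul, mul_comm]

variable {Θ : Set (Param k)} {g : Param k → X → ℝ}

theorem RegularModel.differentiableAt_gdot (h : RegularModel Θ g) (x : X) (a : Fin k) {β : Param k}
    (hβ : β ∈ interior Θ) : DifferentiableAt ℝ (fun c => gdot g c x a) β :=
  (h.twice_differentiable x β hβ).clm_apply (differentiableAt_const _)

theorem RegularModel.measurable_gdot (h : RegularModel Θ g) {β : Param k} (hβ : β ∈ interior Θ) (a : Fin k) :
    Measurable fun x => gdot g β x a :=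
  measurable_fderiv_apply isOpen_interior (fun b hb => h.measurable b (interior_subset hb)) hβ
    (fun x => h.differentiable x β hβ) _

theorem RegularModel.measurable_gddot (h : RegularModel Θ g) {β : Param k} (hβ : β ∈ interior Θ) (a b : Fin k) :
    Measurable fun x => gddot g β x a b :=
  measurable_fderiv_apply (F := fun c x => gdot g c x a) isOpen_interior
    (fun _ hc => h.measurable_gdot hc a) hβ
    (fun x => h.differentiableAt_gdot x a hβ) _

theorem RegularModel.continuousOn_gdot (h : RegularModel Θ g) (x : X) (a : Fin k) :
    ContinuousOn (fun c => gdot g c x a) (interior Θ) := fun _ hβ =>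
  (h.differentiableAt_gdot x a hβ).continuousAt.continuousWithinAt

end Regularity

/-! ### Differentiating the doubly robust risk and its score -/

section Score

variable {X : Type*} [MeasurableSpace X] {k N M : ℕ} {Θ : Set (Param k)} {g : Param k → X → ℝ}

theorem measurable_crossFit {e : Bool → NuisanceEstimator X N M} (he : MeasurableEstimator e)
    {Ω : Type*} [MeasurableSpace Ω] {s : Ω → Sample X N M} (hs : Measurable s) (l : Bool)
    {ξ : Ω → X} (hξ : Measurable ξ) : Measurable fun ω => crossFit e (s ω) l (ξ ω) := by
  have h1 : Measurable fun ω => ((s ω).1 (!l), (s ω).2 (!l), ξ ω) :=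
    ((measurable_pi_apply _).comp hs.fst).prodMk
      (((measurable_pi_apply _).comp hs.snd).prodMk hξ)
  exact (he l).comp h1

theorem RegularModel.measurable_score (h : RegularModel Θ g)
    {fhat rhat : Bool → NuisanceEstimator X N M} (hf : MeasurableEstimator fhat)
    (hr : MeasurableEstimator rhat) {Ω : Type*} [MeasurableSpace Ω] {s : Ω → Sample X N M}
    (hs : Measurable s) {b : Ω → Param k} (hb : Measurable b) (hbU : ∀ ω, b ω ∈ interior Θ)
    (a : Fin k) : Measurable fun ω => score g fhat rhat (s ω) (b ω) a := by
  have hp : ∀ l i, Measurable fun ω => (s ω).1 l i := fun l i =>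
    (measurable_pi_apply i).comp ((measurable_pi_apply l).comp hs.fst)
  have hq : ∀ l j, Measurable fun ω => (s ω).2 l j := fun l j =>
    (measurable_pi_apply j).comp ((measurable_pi_apply l).comp hs.snd)
  have hgd : ∀ {ξ : Ω → X}, Measurable ξ → Measurable fun ω => gdot g (b ω) (ξ ω) a := fun hξ =>
    measurable_comp_of_continuousOn (F := fun c x => gdot g c x a)
      (fun c hc => h.measurable_gdot hc a) (fun x => h.continuousOn_gdot x a) hb hbU hξ
  have hg : ∀ {ξ : Ω → X}, Measurable ξ → Measurable fun ω => g (b ω) (ξ ω) := fun hξ =>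
    measurable_comp_of_continuousOn h.measurable h.continuousOn hb
      (fun ω => interior_subset (hbU ω)) hξ
  unfold score
  refine Finset.measurable_fun_sum _ fun l _ => Measurable.add ?_ ?_
  · refine (Finset.measurable_fun_sum _ fun i _ => ?_).const_mul _
    exact ((hgd (hp l i).fst).mul ((hp l i).snd.sub (measurable_crossFit hf hs l (hp l i).fst))).mul
      (measurable_crossFit hr hs l (hp l i).fst)
  · refine (Finset.measurable_fun_sum _ fun j _ => ?_).const_mul _
    exact (hgd (hq l j)).mul ((measurable_crossFit hf hs l (hq l j)).sub (hg (hq l j)))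

variable (fhat rhat : Bool → NuisanceEstimator X N M) (s : Sample X N M)

theorem RegularModel.hasFDerivAt_score (h : RegularModel Θ g) {β : Param k}
    (hβ : β ∈ interior Θ) (a : Fin k) :
    HasFDerivAt (fun c => score g fhat rhat s c a)
      (∑ l : Bool, ((1 / (N : ℝ)) • ∑ i, ((s.1 l i).2 - crossFit fhat s l (s.1 l i).1) •
          crossFit rhat s l (s.1 l i).1 • fderiv ℝ (fun c => gdot g c (s.1 l i).1 a) β +
        (1 / (M : ℝ)) • ∑ j, ((crossFit fhat s l (s.2 l j) - g β (s.2 l j)) •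
            fderiv ℝ (fun c => gdot g c (s.2 l j) a) β -
          gdot g β (s.2 l j) a • fderiv ℝ (fun c => g c (s.2 l j)) β))) β := by
  unfold score
  refine HasFDerivAt.fun_sum fun l _ => HasFDerivAt.add ?_ ?_
  · refine (HasFDerivAt.fun_sum fun i _ => ?_).const_mul _
    have h1 := (((h.differentiableAt_gdot (s.1 l i).1 a hβ).hasFDerivAt.mul_const
      ((s.1 l i).2 - crossFit fhat s l (s.1 l i).1)).mul_const (crossFit rhat s l (s.1 l i).1))
    refine h1.congr_fderiv ?_
    rw [smul_comm]
  · refine (HasFDerivAt.fun_sum fun j _ => ?_).const_mul _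
    have h1 := (h.differentiableAt_gdot (s.2 l j) a hβ).hasFDerivAt.mul
      ((h.differentiable (s.2 l j) β hβ).hasFDerivAt.const_sub (crossFit fhat s l (s.2 l j)))
    refine h1.congr_fderiv ?_
    rw [smul_neg, add_comm, ← sub_eq_add_neg]

theorem RegularModel.scoreJacobian_eq (h : RegularModel Θ g) {β : Param k}
    (hβ : β ∈ interior Θ) (a b : Fin k) :
    scoreJacobian g fhat rhat s β a b =
      ∑ l : Bool, ((1 / (N : ℝ)) * ∑ i, gddot g β (s.1 l i).1 a b *
          (((s.1 l i).2 - crossFit fhat s l (s.1 l i).1) * crossFit rhat s l (s.1 l i).1) +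
        (1 / (M : ℝ)) * ∑ j, (gddot g β (s.2 l j) a b *
            (crossFit fhat s l (s.2 l j) - g β (s.2 l j)) -
          gdot g β (s.2 l j) a * gdot g β (s.2 l j) b)) := by
  rw [scoreJacobian, (h.hasFDerivAt_score fhat rhat s hβ a).fderiv]
  simp only [sum_apply, add_apply,
    smul_apply, sub_apply, smul_eq_mul, gddot, gdot]
  refine Finset.sum_congr rfl fun l _ => ?_
  congr 2
  · exact Finset.sum_congr rfl fun i _ => by ring
  · exact Finset.sum_congr rfl fun i _ => by ring

theorem RegularModel.hasFDerivAt_drRisk (h : RegularModel Θ g) {β : Param k}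
    (hβ : β ∈ interior Θ) (l : Bool) :
    HasFDerivAt (fun c => drRisk g fhat rhat s l c)
      ((1 / (N : ℝ)) • ∑ i, (-2 * ((s.1 l i).2 - crossFit fhat s l (s.1 l i).1) *
          crossFit rhat s l (s.1 l i).1) • fderiv ℝ (fun c => g c (s.1 l i).1) β +
        (1 / (M : ℝ)) • ∑ j, (-2 * (crossFit fhat s l (s.2 l j) - g β (s.2 l j))) •
          fderiv ℝ (fun c => g c (s.2 l j)) β) β := by
  unfold drRisk
  refine HasFDerivAt.add ?_ ?_
  · refine (HasFDerivAt.fun_sum fun i _ => ?_).const_mul _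
    have h1 := (h.differentiable (s.1 l i).1 β hβ).hasFDerivAt
    have h2 := ((h1.const_mul (-2 * ((s.1 l i).2 - crossFit fhat s l (s.1 l i).1))).const_add
      ((s.1 l i).2 ^ 2 - crossFit fhat s l (s.1 l i).1 ^ 2)).mul_const
        (crossFit rhat s l (s.1 l i).1)
    refine (h2.congr_fderiv ?_).congr_of_eventuallyEq (Eventually.of_forall fun c => ?_)
    · rw [smul_smul, mul_comm]
    · simp only
      ring
  · refine (HasFDerivAt.fun_sum fun j _ => ?_).const_mul _
    have h1 := ((h.differentiable (s.2 l j) β hβ).hasFDerivAt.const_sub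
      (crossFit fhat s l (s.2 l j))).pow 2
    refine h1.congr_fderiv ?_
    ext v
    simp

theorem RegularModel.score_eq_zero_of_isArgmin (h : RegularModel Θ g) {β : Param k}
    (hβ : β ∈ interior Θ)
    (hmin : IsArgmin Θ (fun c => ∑ l : Bool, drRisk g fhat rhat s l c) β) (a : Fin k) :
    score g fhat rhat s β a = 0 := by
  have hd : HasFDerivAt (fun c => ∑ l : Bool, drRisk g fhat rhat s l c) _ β :=
    HasFDerivAt.fun_sum fun l _ => h.hasFDerivAt_drRisk fhat rhat s hβ l
  have hloc : IsLocalMin (fun c => ∑ l : Bool, drRisk g fhat rhat s l c) β :=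
    hmin.2.isLocalMin (mem_interior_iff_mem_nhds.1 hβ)
  have h0 := DFunLike.congr_fun (hloc.hasFDerivAt_eq_zero hd) (EuclideanSpace.single a (1 : ℝ))
  simp only [sum_apply, add_apply,
    smul_apply, smul_eq_mul, zero_apply] at h0
  have h1 : -2 * score g fhat rhat s β a = 0 := by
    rw [← h0, score, Finset.mul_sum]
    refine Finset.sum_congr rfl fun l _ => ?_
    rw [mul_add, mul_left_comm (-2 : ℝ), mul_left_comm (-2 : ℝ), Finset.mul_sum (a := -2),
      Finset.mul_sum (a := -2)]
    congr 1
    · exact congrArg _ (Finset.sum_congr rfl fun i _ => by simp only [gdot]; ring)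
    · exact congrArg _ (Finset.sum_congr rfl fun i _ => by simp only [gdot]; ring)
  linarith

end Score

/-! ### The remainder terms of the nuisance estimates -/

section Remainder

variable {X : Type*} [MeasurableSpace X] {lamX : Measure X} {lamY : Measure ℝ}
  {k N M : ℕ} {g : Param k → X → ℝ}

/-- The regression residual weighted by the density ratio. -/
def CovariateShift.noise (S : CovariateShift lamX lamY) (z : X × ℝ) : ℝ :=
  (z.2 - S.f0 z.1) * S.ratio z.1

/-- The contribution of the errors of the nuisance estimates to a weighted average over one fold
with train points `z` and test covariates `t`. -/
def remainder (S : CovariateShift lamX lamY) (f r u : X → ℝ) (z : Fin N → X × ℝ)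
    (t : Fin M → X) : ℝ :=
  (1 / (N : ℝ)) * ∑ i, u (z i).1 * (((z i).2 - f (z i).1) * r (z i).1 - S.noise (z i)) +
    (1 / (M : ℝ)) * ∑ j, u (t j) * (f (t j) - S.f0 (t j))

variable (S : CovariateShift lamX lamY) (fhat rhat : Bool → NuisanceEstimator X N M)
  (s : Sample X N M)

theorem drRisk_sub_drRisk {β₀ : Param k} (hs : ∀ x, S.f0 x = g β₀ x) (β : Param k) (l : Bool) :
    drRisk g fhat rhat s l β - drRisk g fhat rhat s l β₀ =
      -2 * ((1 / (N : ℝ)) * ∑ i, (g β (s.1 l i).1 - S.f0 (s.1 l i).1) * S.noise (s.1 l i)) +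
      (1 / (M : ℝ)) * ∑ j, (g β (s.2 l j) - S.f0 (s.2 l j)) ^ 2 -
      2 * remainder S (crossFit fhat s l) (crossFit rhat s l) (fun x => g β x - S.f0 x)
        (s.1 l) (s.2 l) := by
  simp only [drRisk, remainder, ← hs]
  have e1 : ∀ A B A' B' C D E F : ℝ, A - A' = -2 * C - 2 * E → B - B' = D - 2 * F →
      A + B - (A' + B') = -2 * C + D - 2 * (E + F) := by intros; linarith
  refine e1 _ _ _ _ _ _ _ _ ?_ ?_
  · simp only [mul_left_comm (_ : ℝ) (1 / (N : ℝ)), Finset.mul_sum]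
    rw [← Finset.sum_sub_distrib, ← Finset.sum_sub_distrib]
    exact Finset.sum_congr rfl fun i _ => by ring
  · simp only [mul_left_comm (_ : ℝ) (1 / (M : ℝ)), Finset.mul_sum]
    rw [← Finset.sum_sub_distrib, ← Finset.sum_sub_distrib]
    exact Finset.sum_congr rfl fun i _ => by ring

theorem score_eq {β₀ : Param k} (hs : ∀ x, S.f0 x = g β₀ x) (a : Fin k) :
    score g fhat rhat s β₀ a = ∑ l : Bool,
      ((1 / (N : ℝ)) * ∑ i, gdot g β₀ (s.1 l i).1 a * S.noise (s.1 l i) +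
        remainder S (crossFit fhat s l) (crossFit rhat s l) (fun x => gdot g β₀ x a)
          (s.1 l) (s.2 l)) := by
  simp only [score, remainder, ← hs]
  refine Finset.sum_congr rfl fun l _ => ?_
  rw [← add_assoc, ← mul_add, ← Finset.sum_add_distrib]
  congr 2
  exact Finset.sum_congr rfl fun i _ => by ring

theorem RegularModel.scoreJacobian_eq_remainder {Θ : Set (Param k)} (h : RegularModel Θ g)
    {β₀ : Param k} (hβ : β₀ ∈ interior Θ) (hs : ∀ x, S.f0 x = g β₀ x) (a b : Fin k) :
    scoreJacobian g fhat rhat s β₀ a b = ∑ l : Bool,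
      ((1 / (N : ℝ)) * ∑ i, gddot g β₀ (s.1 l i).1 a b * S.noise (s.1 l i) -
        (1 / (M : ℝ)) * ∑ j, gdot g β₀ (s.2 l j) a * gdot g β₀ (s.2 l j) b +
        remainder S (crossFit fhat s l) (crossFit rhat s l) (fun x => gddot g β₀ x a b)
          (s.1 l) (s.2 l)) := by
  rw [h.scoreJacobian_eq fhat rhat s hβ]
  refine Finset.sum_congr rfl fun l _ => ?_
  simp only [remainder, ← hs]
  have e1 : ∀ A B C D E F : ℝ, A = C + E → B = F - D → A + B = C - D + (E + F) := by
    intros; linarith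
  refine e1 _ _ _ _ _ _ ?_ ?_
  · rw [← mul_add, ← Finset.sum_add_distrib]
    congr 1
    exact Finset.sum_congr rfl fun i _ => by ring
  · rw [← mul_sub, ← Finset.sum_sub_distrib]

end Remainder

theorem SmallInProb.mono_whp {Ω : ℕ → Type*} [∀ n, MeasurableSpace (Ω n)]
    {ν : ∀ n, Measure (Ω n)} {Z W : ∀ n, Ω n → ℝ≥0∞} (h : SmallInProb ν W)
    (hZW : Whp ν fun n ω => Z n ω ≤ W n ω) : SmallInProb ν Z := fun ε hε =>
  ((h ε hε).and hZW).mono fun _ _ hω => hω.2.trans_lt hω.1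

theorem Whp.prod_snd {Ω Ω' : ℕ → Type*} [∀ n, MeasurableSpace (Ω n)]
    [∀ n, MeasurableSpace (Ω' n)] {ν : ∀ n, Measure (Ω n)} {ν' : ∀ n, Measure (Ω' n)}
    [∀ n, IsProbabilityMeasure (ν n)] [∀ n, SFinite (ν' n)] {P : ∀ n, Ω' n → Prop}
    (h : Whp ν' P) : Whp (fun n => (ν n).prod (ν' n)) fun n p => P n p.2 :=
  Whp.comp (fun _ => measurable_snd.aemeasurable)
    (fun n => (measurePreserving_snd (μ := ν n) (ν := ν' n)).map_eq) h

/-! ### Averages of functions that depend on an independent data set -/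

section Conditional

variable {E : Type*} [MeasurableSpace E] {P : Measure E} [IsProbabilityMeasure P]
  {Ω' : ℕ → Type*} [∀ n, MeasurableSpace (Ω' n)] {ν' : ∀ n, Measure (Ω' n)}
  [∀ n, IsProbabilityMeasure (ν' n)] {N : ℕ → ℕ} {W : ∀ n, Ω' n → E → ℝ}

theorem measurable_average_uncurry {Ω : Type*} [MeasurableSpace Ω] {N : ℕ} {W : Ω → E → ℝ}
    (hW : Measurable fun p : Ω × E => W p.1 p.2) :
    Measurable fun p : (Fin N → E) × Ω => (1 / (N : ℝ)) * ∑ i, W p.2 (p.1 i) := by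
  refine (Finset.measurable_fun_sum _ fun i _ => ?_).const_mul _
  exact hW.comp (measurable_snd.prodMk ((measurable_pi_apply i).comp measurable_fst))

theorem smallInProb_average (hW : ∀ n, Measurable fun p : Ω' n × E => W n p.1 p.2)
    {c : ∀ n, Ω' n → ℝ≥0∞} (hc : SmallInProb ν' c)
    (hWc : ∀ n o, ∫⁻ x, ‖W n o x‖ₑ ∂P ≤ c n o) :
    SmallInProb (fun n => (Measure.pi fun _ : Fin (N n) => P).prod (ν' n))
      fun n p => ‖(1 / (N n : ℝ)) * ∑ i, W n p.2 (p.1 i)‖ₑ := by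
  refine smallInProb_of_conditional (fun n => (measurable_average_uncurry (hW n)).enorm) hc
    (Eventually.of_forall fun n o => ?_)
  exact (lintegral_enorm_average_le ((hW n).comp measurable_prodMk_left)).trans (hWc n o)

theorem smallInProb_centred_average (hN : Tendsto N atTop atTop)
    (hW : ∀ n, Measurable fun p : Ω' n × E => W n p.1 p.2)
    {c : ∀ n, Ω' n → ℝ≥0∞} (hc : SmallInProb ν' c)
    (hWc : ∀ᶠ n in atTop, ∀ o, (N n : ℝ≥0∞)⁻¹ * ∫⁻ x, ‖W n o x‖ₑ ^ 2 ∂P ≤ c n o) :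
    SmallInProb (fun n => (Measure.pi fun _ : Fin (N n) => P).prod (ν' n))
      fun n p => ‖(1 / (N n : ℝ)) * ∑ i, W n p.2 (p.1 i) - ∫ x, W n p.2 x ∂P‖ₑ := by
  refine SmallInProb.of_pow_two (smallInProb_of_conditional (fun n => ?_) hc ?_)
  · have h1 : Measurable fun o : Ω' n => ∫ x, W n o x ∂P :=
      (StronglyMeasurable.integral_prod_right (f := W n) (hW n).stronglyMeasurable).measurable
    exact (((measurable_average_uncurry (hW n)).sub (h1.comp measurable_snd)).enorm).pow_const 2
  · filter_upwards [hWc, hN.eventually_ne_atTop 0] with n hn hN0 o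
    exact (lintegral_sq_average_sub_integral_le hN0 ((hW n).comp measurable_prodMk_left)).trans
      (hn o)

end Conditional

section Norms

variable {E : Type*} [MeasurableSpace E] {P : Measure E}

theorem lintegral_enorm_sq_eq (φ : E → ℝ) : ∫⁻ x, ‖φ x‖ₑ ^ 2 ∂P = eLpNorm φ 2 P ^ 2 := by
  have := eLpNorm_nnreal_pow_eq_lintegral (f := φ) (μ := P) (p := 2) two_ne_zero
  simpa using this.symm

theorem lintegral_enorm_le_eLpNorm_two [IsProbabilityMeasure P] {φ : E → ℝ} (hφ : Measurable φ) :
    ∫⁻ x, ‖φ x‖ₑ ∂P ≤ eLpNorm φ 2 P := by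
  rw [← eLpNorm_one_eq_lintegral_enorm]
  exact eLpNorm_le_eLpNorm_of_exponent_le one_le_two hφ.aestronglyMeasurable

theorem lintegral_enorm_mul_le {φ ψ : E → ℝ} (hφ : Measurable φ) (hψ : Measurable ψ) :
    ∫⁻ x, ‖φ x‖ₑ * ‖ψ x‖ₑ ∂P ≤ eLpNorm φ 2 P * eLpNorm ψ 2 P := by
  have := ENNReal.lintegral_mul_le_Lp_mul_Lq P Real.HolderConjugate.two_two
    hφ.enorm.aemeasurable hψ.enorm.aemeasurable
  rw [eLpNorm_eq_lintegral_rpow_enorm_toReal two_ne_zero ENNReal.ofNat_ne_top,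
    eLpNorm_eq_lintegral_rpow_enorm_toReal two_ne_zero ENNReal.ofNat_ne_top]
  simpa using this

theorem measurable_eLpNorm_two {Ω : Type*} [MeasurableSpace Ω] [SFinite P] {φ : Ω → E → ℝ}
    (hφ : Measurable fun p : Ω × E => φ p.1 p.2) : Measurable fun o => eLpNorm (φ o) 2 P := by
  simp_rw [eLpNorm_eq_lintegral_rpow_enorm_toReal two_ne_zero ENNReal.ofNat_ne_top]
  exact (Measurable.lintegral_prod_right' (hφ.enorm.pow_const _)).pow_const _

theorem inv_mul_ofReal_sqrt_sq {N M : ℕ} (hM : M ≠ 0) {ρ : ℝ} (hρ : 0 < ρ)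
    (h : (M : ℝ) = ρ * N) (D : ℝ) :
    (M : ℝ≥0∞)⁻¹ * ENNReal.ofReal (√(2 * (N : ℝ)) * |D|) ^ 2 = ENNReal.ofReal (2 * D ^ 2 / ρ) := by
  have hM0 : (0 : ℝ) < M := by exact_mod_cast Nat.pos_of_ne_zero hM
  rw [← ENNReal.ofReal_natCast, ← ENNReal.ofReal_inv_of_pos hM0,
    ← ENNReal.ofReal_pow (by positivity), ← ENNReal.ofReal_mul (by positivity), mul_pow,
    Real.sq_sqrt (by positivity), sq_abs]
  congr 1
  rw [h] at hM0 ⊢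
  have : (N : ℝ) ≠ 0 := fun h0 => by simp [h0] at hM0
  field_simp

theorem enorm_abs_real (x : ℝ) : ‖|x|‖ₑ = ‖x‖ₑ := by
  rw [Real.enorm_eq_ofReal_abs, Real.enorm_eq_ofReal_abs, abs_abs]

theorem enorm_le_ofReal {x y : ℝ} (h : |x| ≤ y) : ‖x‖ₑ ≤ ENNReal.ofReal y := by
  rw [Real.enorm_eq_ofReal_abs]
  exact ENNReal.ofReal_le_ofReal h

end Norms

/-! ### The remainder terms are negligible -/

section Remainder

variable {X : Type*} [MeasurableSpace X] {lamX : Measure X} {lamY : Measure ℝ}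
  {S : CovariateShift lamX lamY}

/-- The average absolute errors that dominate `remainder`. -/
def absRemainder {N M : ℕ} (S : CovariateShift lamX lamY) (f r : X → ℝ) (z : Fin N → X × ℝ)
    (t : Fin M → X) : ℝ :=
  (1 / (N : ℝ)) * ∑ i, |((z i).2 - f (z i).1) * r (z i).1 - S.noise (z i)| +
    (1 / (M : ℝ)) * ∑ j, |f (t j) - S.f0 (t j)|

theorem abs_remainder_le {N M : ℕ} (S : CovariateShift lamX lamY) (f r : X → ℝ) {u : X → ℝ}
    {B : ℝ} (hu : ∀ x, |u x| ≤ B) (z : Fin N → X × ℝ) (t : Fin M → X) :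
    |remainder S f r u z t| ≤ B * absRemainder S f r z t := by
  have h1 : ∀ i, |u (z i).1 * (((z i).2 - f (z i).1) * r (z i).1 - S.noise (z i))| ≤
      B * |((z i).2 - f (z i).1) * r (z i).1 - S.noise (z i)| := fun i => by
    rw [abs_mul]; gcongr; exact hu _
  have h2 : ∀ j, |u (t j) * (f (t j) - S.f0 (t j))| ≤ B * |f (t j) - S.f0 (t j)| := fun j => by
    rw [abs_mul]; gcongr; exact hu _
  have e1 := abs_average_le h1
  have e2 := abs_average_le h2
  rw [← Finset.mul_sum, mul_left_comm] at e1 e2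
  rw [absRemainder, mul_add]
  exact (abs_add_le _ _).trans (add_le_add e1 e2)

theorem CovariateShift.noise_error (S : CovariateShift lamX lamY) (f r : X → ℝ) (z : X × ℝ) :
    (z.2 - f z.1) * r z.1 - S.noise z =
      (z.2 - S.f0 z.1) * (r z.1 - S.ratio z.1) -
        (f z.1 - S.f0 z.1) * (r z.1 - S.ratio z.1) - (f z.1 - S.f0 z.1) * S.ratio z.1 := by
  rw [CovariateShift.noise]; ring

theorem mul_remainder_eq {N M : ℕ} (S : CovariateShift lamX lamY) (c I : ℝ) (f r u : X → ℝ)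
    (z : Fin N → X × ℝ) (t : Fin M → X) :
    c * remainder S f r u z t =
      ((1 / (N : ℝ)) * ∑ i, c * (u (z i).1 * ((r (z i).1 - S.ratio (z i).1) *
          ((z i).2 - S.f0 (z i).1)))) -
      ((1 / (N : ℝ)) * ∑ i, c * (u (z i).1 * ((r (z i).1 - S.ratio (z i).1) *
          (f (z i).1 - S.f0 (z i).1)))) -
      ((1 / (N : ℝ)) * ∑ i, c * (u (z i).1 * (f (z i).1 - S.f0 (z i).1)) *
          S.ratio (z i).1 - I) +
      ((1 / (M : ℝ)) * ∑ j, c * (u (t j) * (f (t j) - S.f0 (t j))) - I) := by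
  have e : ∀ A B C D : ℝ, A - B - (C - I) + (D - I) = (A - B - C) + D := by intros; ring
  rw [e, ← mul_sub, ← mul_sub, ← Finset.sum_sub_distrib, ← Finset.sum_sub_distrib, remainder,
    mul_add, mul_left_comm, mul_left_comm _ (1 / (M : ℝ)), Finset.mul_sum _ _ c, Finset.mul_sum _ _ c]
  congr 2
  refine Finset.sum_congr rfl fun i _ => ?_
  rw [S.noise_error]
  ring

variable [SigmaFinite lamY]

/-- The law of the data of one fold. -/
def foldLaw (S : CovariateShift lamX lamY) (N M : ℕ) : Measure ((Fin N → X × ℝ) × (Fin M → X)) :=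
  (Measure.pi fun _ => S.trainLaw).prod (Measure.pi fun _ => S.testCov)

instance (N M : ℕ) : IsProbabilityMeasure (foldLaw S N M) := by
  unfold foldLaw; infer_instance

variable {Ω' : ℕ → Type*} [∀ n, MeasurableSpace (Ω' n)] {ν' : ∀ n, Measure (Ω' n)}
  [∀ n, IsProbabilityMeasure (ν' n)] {N M : ℕ → ℕ}

theorem SmallInProb.train_part {Z : ∀ n, (Fin (N n) → X × ℝ) × Ω' n → ℝ≥0∞}
    (h : SmallInProb (fun n => (Measure.pi fun _ : Fin (N n) => S.trainLaw).prod (ν' n)) Z) :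
    SmallInProb (fun n => (foldLaw S (N n) (M n)).prod (ν' n))
      fun n p => Z n (p.1.1, p.2) := by
  have hmp : ∀ n, MeasurePreserving
      (fun p : ((Fin (N n) → X × ℝ) × (Fin (M n) → X)) × Ω' n => (p.1.1, p.2))
      ((foldLaw S (N n) (M n)).prod (ν' n))
      ((Measure.pi fun _ : Fin (N n) => S.trainLaw).prod (ν' n)) := fun n =>
    (measurePreserving_fst (μ := Measure.pi fun _ : Fin (N n) => S.trainLaw)
      (ν := Measure.pi fun _ : Fin (M n) => S.testCov)).prod (MeasurePreserving.id (ν' n))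
  exact h.comp (fun n => (hmp n).measurable.aemeasurable) fun n => (hmp n).map_eq

theorem SmallInProb.test_part {Z : ∀ n, (Fin (M n) → X) × Ω' n → ℝ≥0∞}
    (h : SmallInProb (fun n => (Measure.pi fun _ : Fin (M n) => S.testCov).prod (ν' n)) Z) :
    SmallInProb (fun n => (foldLaw S (N n) (M n)).prod (ν' n))
      fun n p => Z n (p.1.2, p.2) := by
  have hmp : ∀ n, MeasurePreserving
      (fun p : ((Fin (N n) → X × ℝ) × (Fin (M n) → X)) × Ω' n => (p.1.2, p.2))
      ((foldLaw S (N n) (M n)).prod (ν' n))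
      ((Measure.pi fun _ : Fin (M n) => S.testCov).prod (ν' n)) := fun n =>
    (measurePreserving_snd (μ := Measure.pi fun _ : Fin (N n) => S.trainLaw)
      (ν := Measure.pi fun _ : Fin (M n) => S.testCov)).prod (MeasurePreserving.id (ν' n))
  exact h.comp (fun n => (hmp n).measurable.aemeasurable) fun n => (hmp n).map_eq

variable {fo ro : ∀ n, Ω' n → X → ℝ} {B C Cr : ℝ}

theorem lintegral_trainLaw_le {G : X × ℝ → ℝ≥0∞} {F : X → ℝ≥0∞} (hF : Measurable F)
    (h : ∀ᵐ z ∂S.trainLaw, G z ≤ F z.1) : ∫⁻ z, G z ∂S.trainLaw ≤ ∫⁻ x, F x ∂S.trainCov := by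
  rw [← S.measurePreserving_fst.lintegral_comp hF]
  exact lintegral_mono_ae h

theorem lintegral_noise_error_le (hY : ∀ᵐ z ∂S.trainLaw, |z.2| ≤ C) (hf : ∀ x, |S.f0 x| ≤ B)
    (hCr : ∀ x, S.ratio x ≤ Cr) {f r : X → ℝ} (hfm : Measurable f) (hrm : Measurable r) :
    ∫⁻ z, ‖|(z.2 - f z.1) * r z.1 - S.noise z|‖ₑ ∂S.trainLaw ≤
      ENNReal.ofReal (C + B) * eLpNorm (fun x => r x - S.ratio x) 2 S.trainCov +
      eLpNorm (fun x => r x - S.ratio x) 2 S.trainCov *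
        eLpNorm (fun x => f x - S.f0 x) 2 S.trainCov +
      ENNReal.ofReal Cr * eLpNorm (fun x => f x - S.f0 x) 2 S.trainCov := by
  have hr' : Measurable fun x => r x - S.ratio x := hrm.sub S.measurable_ratio
  have hf' : Measurable fun x => f x - S.f0 x := hfm.sub S.measurable_f0
  refine (lintegral_trainLaw_le (F := fun x => ENNReal.ofReal (C + B) * ‖r x - S.ratio x‖ₑ +
    ‖r x - S.ratio x‖ₑ * ‖f x - S.f0 x‖ₑ + ENNReal.ofReal Cr * ‖f x - S.f0 x‖ₑ)
    (by fun_prop) ?_).trans ?_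
  · filter_upwards [hY] with z hz
    rw [enorm_abs_real, S.noise_error]
    refine enorm_sub_le.trans (add_le_add (enorm_sub_le.trans (add_le_add ?_ ?_)) ?_)
    · rw [enorm_mul]
      gcongr
      rw [Real.enorm_eq_ofReal_abs]
      exact ENNReal.ofReal_le_ofReal ((abs_sub _ _).trans (add_le_add hz (hf z.1)))
    · rw [enorm_mul, mul_comm]
    · rw [enorm_mul, mul_comm]
      gcongr
      rw [Real.enorm_eq_ofReal_abs, abs_of_nonneg (S.ratio_nonneg _)]
      exact ENNReal.ofReal_le_ofReal (hCr z.1)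
  · rw [lintegral_add_right _ (by fun_prop), lintegral_add_right _ (by fun_prop),
      lintegral_const_mul _ (by fun_prop), lintegral_const_mul _ (by fun_prop)]
    gcongr
    · exact lintegral_enorm_le_eLpNorm_two hr'
    · exact lintegral_enorm_mul_le hr' hf'
    · exact lintegral_enorm_le_eLpNorm_two hf'

theorem smallInProb_absRemainder (hov : S.Overlap) (hY : ∀ᵐ z ∂S.trainLaw, |z.2| ≤ C)
    (hf : ∀ x, |S.f0 x| ≤ B) (hCr : ∀ x, S.ratio x ≤ Cr)
    (hfm : ∀ n, Measurable fun p : Ω' n × X => fo n p.1 p.2)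
    (hrm : ∀ n, Measurable fun p : Ω' n × X => ro n p.1 p.2)
    (ha : SmallInProb ν' fun n o => eLpNorm (fun x => ro n o x - S.ratio x) 2 S.trainCov)
    (hb : SmallInProb ν' fun n o => eLpNorm (fun x => fo n o x - S.f0 x) 2 S.trainCov) :
    SmallInProb (fun n => (foldLaw S (N n) (M n)).prod (ν' n))
      fun n p => ‖absRemainder S (fo n p.2) (ro n p.2) p.1.1 p.1.2‖ₑ := by
  have h1 : SmallInProb (fun n => (Measure.pi fun _ : Fin (N n) => S.trainLaw).prod (ν' n))
      fun n p => ‖(1 / (N n : ℝ)) * ∑ i, |((p.1 i).2 - fo n p.2 (p.1 i).1) * ro n p.2 (p.1 i).1 -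
        S.noise (p.1 i)|‖ₑ := by
    refine smallInProb_average
      (W := fun n o z => |(z.2 - fo n o z.1) * ro n o z.1 - S.noise z|) (fun n => ?_)
      (((ha.const_mul (c := ENNReal.ofReal (C + B)) ENNReal.ofReal_ne_top).add (ha.mul hb)).add
        (hb.const_mul (c := ENNReal.ofReal Cr) ENNReal.ofReal_ne_top)) fun n o => ?_
    · have e1 : Measurable fun p : Ω' n × X × ℝ => fo n p.1 p.2.1 :=
        (hfm n).comp (measurable_fst.prodMk measurable_snd.fst)
      have e2 : Measurable fun p : Ω' n × X × ℝ => ro n p.1 p.2.1 :=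
        (hrm n).comp (measurable_fst.prodMk measurable_snd.fst)
      have e3 : Measurable fun p : Ω' n × X × ℝ => S.noise p.2 :=
        (measurable_snd.snd.sub (S.measurable_f0.comp measurable_snd.fst)).mul
          (S.measurable_ratio.comp measurable_snd.fst)
      exact (((measurable_snd.snd.sub e1).mul e2).sub e3).abs
    · exact lintegral_noise_error_le hY hf hCr ((hfm n).comp measurable_prodMk_left)
        ((hrm n).comp measurable_prodMk_left)
  have h2 : SmallInProb (fun n => (Measure.pi fun _ : Fin (M n) => S.testCov).prod (ν' n))
      fun n p => ‖(1 / (M n : ℝ)) * ∑ j, |fo n p.2 (p.1 j) - S.f0 (p.1 j)|‖ₑ := by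
    refine smallInProb_average (W := fun n o x => |fo n o x - S.f0 x|) (fun n => ?_)
      (hb.const_mul (c := ENNReal.ofReal Cr) ENNReal.ofReal_ne_top) fun n o => ?_
    · exact ((hfm n).sub (S.measurable_f0.comp measurable_snd)).abs
    · have hm : Measurable fun x => fo n o x - S.f0 x :=
        ((hfm n).comp measurable_prodMk_left).sub S.measurable_f0
      simp only [enorm_abs_real]
      refine (hov.lintegral_testCov_le hCr _ hm.enorm).trans ?_
      gcongr
      exact lintegral_enorm_le_eLpNorm_two hm
  exact (h1.train_part.add h2.test_part).mono fun n p => enorm_add_le _ _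

theorem integral_ratio_mul_trainLaw (hov : S.Overlap) {φ : X → ℝ} (hφ : Measurable φ) :
    ∫ z, φ z.1 * S.ratio z.1 ∂S.trainLaw = ∫ x, φ x ∂S.testCov := by
  rw [S.integral_comp_fst (u := fun x => φ x * S.ratio x) (hφ.mul S.measurable_ratio),
    hov.integral_testCov]
  simp only [mul_comm]

theorem smallInProb_centred_train_average {φ : ∀ n, Ω' n → X → ℝ}
    (hφ : ∀ n, Measurable fun p : Ω' n × X => φ n p.1 p.2)
    (hs : SmallInProb ν' fun n o => eLpNorm (φ n o) 2 S.trainCov)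
    (hN : Tendsto N atTop atTop) {W : ∀ n, Ω' n → X × ℝ → ℝ}
    (hW : ∀ n, Measurable fun p : Ω' n × X × ℝ => W n p.1 p.2) {D : ℝ≥0∞} (hD : D ≠ ∞)
    (hWφ : ∀ n o, ∀ᵐ z ∂S.trainLaw,
      ‖W n o z‖ₑ ≤ ENNReal.ofReal (√(2 * (N n : ℝ))) * (D * ‖φ n o z.1‖ₑ)) :
    SmallInProb (fun n => (foldLaw S (N n) (M n)).prod (ν' n))
      fun n p => ‖(1 / (N n : ℝ)) * ∑ i, W n p.2 (p.1.1 i) - ∫ z, W n p.2 z ∂S.trainLaw‖ₑ := by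
  refine SmallInProb.train_part (smallInProb_centred_average hN hW
    ((hs.pow_two).const_mul (c := ENNReal.ofReal 2 * D ^ 2)
      (ENNReal.mul_ne_top ENNReal.ofReal_ne_top (ENNReal.pow_ne_top hD))) ?_)
  filter_upwards [hN.eventually_ne_atTop 0] with n hn o
  have hinv : (N n : ℝ≥0∞)⁻¹ * ENNReal.ofReal (√(2 * (N n : ℝ))) ^ 2 = ENNReal.ofReal 2 := by
    simpa using inv_mul_ofReal_sqrt_sq (N := N n) hn one_pos (one_mul _).symm 1
  have hm : Measurable fun x => ‖φ n o x‖ₑ ^ 2 :=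
    ((hφ n).comp measurable_prodMk_left).enorm.pow_const 2
  rw [← hinv, mul_assoc, mul_assoc, ← lintegral_enorm_sq_eq, ← mul_assoc (_ ^ 2), ← mul_pow,
    ← lintegral_const_mul _ hm]
  gcongr
  refine lintegral_trainLaw_le (hm.const_mul _) ((hWφ n o).mono fun z hz => ?_)
  rw [← mul_pow, mul_assoc]
  exact pow_le_pow_left' hz 2

theorem smallInProb_train_average {φ ψ : ∀ n, Ω' n → X → ℝ}
    (hφ : ∀ n, Measurable fun p : Ω' n × X => φ n p.1 p.2)
    (hψ : ∀ n, Measurable fun p : Ω' n × X => ψ n p.1 p.2)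
    (hs : SmallInProb ν' fun n o => ENNReal.ofReal (√(2 * (N n : ℝ))) *
      (eLpNorm (φ n o) 2 S.trainCov * eLpNorm (ψ n o) 2 S.trainCov))
    {W : ∀ n, Ω' n → X × ℝ → ℝ}
    (hW : ∀ n, Measurable fun p : Ω' n × X × ℝ => W n p.1 p.2) {D : ℝ≥0∞} (hD : D ≠ ∞)
    (hWφ : ∀ n o z, ‖W n o z‖ₑ ≤
      ENNReal.ofReal (√(2 * (N n : ℝ))) * (D * (‖φ n o z.1‖ₑ * ‖ψ n o z.1‖ₑ))) :
    SmallInProb (fun n => (foldLaw S (N n) (M n)).prod (ν' n))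
      fun n p => ‖(1 / (N n : ℝ)) * ∑ i, W n p.2 (p.1.1 i)‖ₑ := by
  have key := smallInProb_average (P := S.trainLaw) (N := N) hW (hs.const_mul (c := D) hD) ?_
  · exact key.train_part
  · intro n o
    have hmφ : Measurable fun x => φ n o x := (hφ n).comp measurable_prodMk_left
    have hmψ : Measurable fun x => ψ n o x := (hψ n).comp measurable_prodMk_left
    have hm : Measurable fun x => ‖φ n o x‖ₑ * ‖ψ n o x‖ₑ := hmφ.enorm.mul hmψ.enorm
    rw [← mul_assoc]
    refine le_trans ?_ (mul_le_mul_right (lintegral_enorm_mul_le hmφ hmψ) _)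
    rw [← lintegral_const_mul _ hm]
    refine lintegral_trainLaw_le (hm.const_mul _) (Eventually.of_forall fun z => ?_)
    refine (hWφ n o z).trans_eq ?_
    ring

theorem smallInProb_centred_test_average {φ : ∀ n, Ω' n → X → ℝ} (hov : S.Overlap)
    (hCr : ∀ x, S.ratio x ≤ Cr) {ρ : ℝ} (hρ : 0 < ρ) (hNM : ∀ n, (M n : ℝ) = ρ * N n)
    (hφ : ∀ n, Measurable fun p : Ω' n × X => φ n p.1 p.2)
    (hs : SmallInProb ν' fun n o => eLpNorm (φ n o) 2 S.trainCov)
    (hM : Tendsto M atTop atTop) {W : ∀ n, Ω' n → X → ℝ}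
    (hW : ∀ n, Measurable fun p : Ω' n × X => W n p.1 p.2) {D : ℝ≥0∞} (hD : D ≠ ∞)
    (hWφ : ∀ n o x, ‖W n o x‖ₑ ≤ ENNReal.ofReal (√(2 * (N n : ℝ))) * (D * ‖φ n o x‖ₑ)) :
    SmallInProb (fun n => (foldLaw S (N n) (M n)).prod (ν' n))
      fun n p => ‖(1 / (M n : ℝ)) * ∑ j, W n p.2 (p.1.2 j) - ∫ x, W n p.2 x ∂S.testCov‖ₑ := by
  refine SmallInProb.test_part (smallInProb_centred_average hM hW
    ((hs.pow_two).const_mul (c := ENNReal.ofReal (2 / ρ) * (ENNReal.ofReal Cr * D ^ 2))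
      (ENNReal.mul_ne_top ENNReal.ofReal_ne_top
        (ENNReal.mul_ne_top ENNReal.ofReal_ne_top (ENNReal.pow_ne_top hD)))) ?_)
  filter_upwards [hM.eventually_ne_atTop 0] with n hn o
  have hinv : (M n : ℝ≥0∞)⁻¹ * ENNReal.ofReal (√(2 * (N n : ℝ))) ^ 2 =
      ENNReal.ofReal (2 / ρ) := by
    simpa using inv_mul_ofReal_sqrt_sq hn hρ (hNM n) 1
  have hm : Measurable fun x => ‖φ n o x‖ₑ ^ 2 :=
    ((hφ n).comp measurable_prodMk_left).enorm.pow_const 2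
  have hmW : Measurable fun x => ‖W n o x‖ₑ ^ 2 :=
    ((hW n).comp measurable_prodMk_left).enorm.pow_const 2
  rw [← hinv, mul_assoc, mul_assoc]
  gcongr
  refine (hov.lintegral_testCov_le hCr _ hmW).trans ?_
  rw [mul_assoc, mul_left_comm]
  gcongr
  rw [← lintegral_enorm_sq_eq, ← mul_assoc, ← mul_pow, ← lintegral_const_mul _ hm]
  refine lintegral_mono fun x => ?_
  rw [← mul_pow, mul_assoc]
  exact pow_le_pow_left' (hWφ n o x) 2

/-- The remainder terms are negligible at the parametric rate. -/
theorem smallInProb_sqrt_mul_remainder (hov : S.Overlap) (hY : ∀ᵐ z ∂S.trainLaw, |z.2| ≤ C)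
    (hf : ∀ x, |S.f0 x| ≤ B) (hCr : ∀ x, S.ratio x ≤ Cr) {ρ : ℝ} (hρ : 0 < ρ)
    (hN : Tendsto N atTop atTop) (hM : Tendsto M atTop atTop)
    (hNM : ∀ n, (M n : ℝ) = ρ * N n)
    (hfm : ∀ n, Measurable fun p : Ω' n × X => fo n p.1 p.2)
    (hrm : ∀ n, Measurable fun p : Ω' n × X => ro n p.1 p.2)
    (ha : SmallInProb ν' fun n o => eLpNorm (fun x => ro n o x - S.ratio x) 2 S.trainCov)
    (hb : SmallInProb ν' fun n o => eLpNorm (fun x => fo n o x - S.f0 x) 2 S.trainCov)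
    (hab : SmallInProb ν' fun n o => ENNReal.ofReal (√(2 * (N n : ℝ))) *
      (eLpNorm (fun x => ro n o x - S.ratio x) 2 S.trainCov *
        eLpNorm (fun x => fo n o x - S.f0 x) 2 S.trainCov))
    {u : X → ℝ} (hu : Measurable u) {U : ℝ} (hU : ∀ x, |u x| ≤ U) :
    SmallInProb (fun n => (foldLaw S (N n) (M n)).prod (ν' n))
      fun n p => ‖√(2 * (N n : ℝ)) * remainder S (fo n p.2) (ro n p.2) u p.1.1 p.1.2‖ₑ := by
  have mf0 : ∀ n, Measurable fun p : Ω' n × X => fo n p.1 p.2 - S.f0 p.2 := fun n =>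
    (hfm n).sub (S.measurable_f0.comp measurable_snd)
  have mr0 : ∀ n, Measurable fun p : Ω' n × X => ro n p.1 p.2 - S.ratio p.2 := fun n =>
    (hrm n).sub (S.measurable_ratio.comp measurable_snd)
  have hfo : ∀ n o, Measurable fun x => fo n o x - S.f0 x := fun n o =>
    (mf0 n).comp measurable_prodMk_left
  have hro : ∀ n o, Measurable fun x => ro n o x - S.ratio x := fun n o =>
    (mr0 n).comp measurable_prodMk_left
  have mp : ∀ n, Measurable fun p : Ω' n × X × ℝ => (p.1, p.2.1) := fun n =>
    measurable_fst.prodMk measurable_snd.fst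
  have mf : ∀ n, Measurable fun p : Ω' n × X × ℝ => fo n p.1 p.2.1 - S.f0 p.2.1 := fun n =>
    (mf0 n).comp (mp n)
  have mr : ∀ n, Measurable fun p : Ω' n × X × ℝ => ro n p.1 p.2.1 - S.ratio p.2.1 := fun n =>
    (mr0 n).comp (mp n)
  have my : ∀ n, Measurable fun p : Ω' n × X × ℝ => p.2.2 - S.f0 p.2.1 := fun n =>
    measurable_snd.snd.sub (S.measurable_f0.comp measurable_snd.fst)
  have mu : ∀ n, Measurable fun p : Ω' n × X × ℝ => u p.2.1 := fun n =>
    hu.comp measurable_snd.fst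
  have mq : ∀ n, Measurable fun p : Ω' n × X × ℝ => S.ratio p.2.1 := fun n =>
    S.measurable_ratio.comp measurable_snd.fst
  have hsq : ∀ n, ‖√(2 * (N n : ℝ))‖ₑ = ENNReal.ofReal (√(2 * (N n : ℝ))) := fun n => by
    rw [Real.enorm_eq_ofReal_abs, abs_of_nonneg (Real.sqrt_nonneg _)]
  have hue : ∀ x, ‖u x‖ₑ ≤ ENNReal.ofReal U := fun x => enorm_le_ofReal (hU x)
  have hqe : ∀ x, ‖S.ratio x‖ₑ ≤ ENNReal.ofReal Cr := fun x =>
    enorm_le_ofReal (by rw [abs_of_nonneg (S.ratio_nonneg _)]; exact hCr x)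
  have hye : ∀ᵐ z ∂S.trainLaw, ‖z.2 - S.f0 z.1‖ₑ ≤ ENNReal.ofReal (C + B) :=
    hY.mono fun z hz => enorm_le_ofReal ((abs_sub _ _).trans (add_le_add hz (hf z.1)))
  have hfin : ∀ x y : ℝ, ENNReal.ofReal x * ENNReal.ofReal y ≠ ∞ := fun x y =>
    ENNReal.mul_ne_top ENNReal.ofReal_ne_top ENNReal.ofReal_ne_top
  have h1 := smallInProb_centred_train_average (M := M) mr0 ha hN
    (W := fun n o z => √(2 * (N n : ℝ)) * (u z.1 *
      ((ro n o z.1 - S.ratio z.1) * (z.2 - S.f0 z.1))))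
    (fun n => ((mu n).mul ((mr n).mul (my n))).const_mul _) (hfin U (C + B))
    (fun n o => hye.mono fun z hz => by
      rw [enorm_mul, enorm_mul, enorm_mul, hsq, mul_assoc (ENNReal.ofReal U),
        mul_comm (ENNReal.ofReal (C + B))]
      gcongr
      exact hue _)
  have h2 := smallInProb_train_average (M := M) mr0 mf0 hab
    (W := fun n o z => √(2 * (N n : ℝ)) *
      (u z.1 * ((ro n o z.1 - S.ratio z.1) * (fo n o z.1 - S.f0 z.1))))
    (fun n => ((mu n).mul ((mr n).mul (mf n))).const_mul _)
    (D := ENNReal.ofReal U) ENNReal.ofReal_ne_top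
    (fun n o z => by
      rw [enorm_mul, enorm_mul, enorm_mul, hsq]
      gcongr
      exact hue _)
  have h3 := smallInProb_centred_train_average (M := M) mf0 hb hN
    (W := fun n o z => √(2 * (N n : ℝ)) * (u z.1 * (fo n o z.1 - S.f0 z.1)) * S.ratio z.1)
    (fun n => (((mu n).mul (mf n)).const_mul _).mul (mq n)) (hfin U Cr)
    (fun n o => Eventually.of_forall fun z => by
      rw [enorm_mul, enorm_mul, enorm_mul, hsq, mul_assoc, mul_assoc (ENNReal.ofReal U),
        mul_comm (ENNReal.ofReal Cr), mul_assoc]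
      gcongr
      · exact hue _
      · exact hqe _)
  have h4 := smallInProb_centred_test_average hov hCr hρ hNM mf0 hb hM
    (W := fun n o x => √(2 * (N n : ℝ)) * (u x * (fo n o x - S.f0 x)))
    (fun n => ((hu.comp measurable_snd).mul (mf0 n)).const_mul _)
    (D := ENNReal.ofReal U) ENNReal.ofReal_ne_top
    (fun n o x => by
      rw [enorm_mul, enorm_mul, hsq]
      gcongr
      exact hue _)
  have hafin := (ha ∞ (by simp)).prod_snd (ν := fun n => foldLaw S (N n) (M n))
  refine (((h1.add h2).add h3).add h4).mono_whp (hafin.mono fun n p hp => ?_)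
  have hmem : MemLp (fun x => ro n p.2 x - S.ratio x) 2 S.trainCov :=
    ⟨(hro n p.2).aestronglyMeasurable, hp⟩
  have hint : Integrable (fun x => √(2 * (N n : ℝ)) * (u x * (ro n p.2 x - S.ratio x)))
      S.trainCov :=
    ((hmem.integrable one_le_two).bdd_mul (c := U) hu.aestronglyMeasurable
      (Eventually.of_forall hU)).const_mul _
  have hz1 : ∫ z, √(2 * (N n : ℝ)) * (u z.1 *
      ((ro n p.2 z.1 - S.ratio z.1) * (z.2 - S.f0 z.1))) ∂S.trainLaw = 0 := by
    rw [← (CovariateShift.integral_mul_residual hY hf hint).2]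
    exact integral_congr_ae (Eventually.of_forall fun z => by simp only; ring)
  have hz3 : ∫ z, √(2 * (N n : ℝ)) * (u z.1 * (fo n p.2 z.1 - S.f0 z.1)) * S.ratio z.1
      ∂S.trainLaw = ∫ x, √(2 * (N n : ℝ)) * (u x * (fo n p.2 x - S.f0 x)) ∂S.testCov :=
    integral_ratio_mul_trainLaw hov (φ := fun x => √(2 * (N n : ℝ)) * (u x * (fo n p.2 x - S.f0 x)))
      ((hu.mul (hfo n p.2)).const_mul _)
  rw [hz1, hz3, sub_zero, mul_remainder_eq S _
    (∫ x, √(2 * (N n : ℝ)) * (u x * (fo n p.2 x - S.f0 x)) ∂S.testCov)]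
  exact (enorm_add_le _ _).trans (add_le_add (enorm_sub_le.trans
    (add_le_add enorm_sub_le le_rfl)) le_rfl)

end Remainder

/-! ### Splitting the sample into a fold and the opposite fold -/

section Split

theorem measurePreserving_bool_pi {α : Type*} [MeasurableSpace α] (ν : Measure α)
    [IsProbabilityMeasure ν] (l : Bool) :
    MeasurePreserving (fun f : Bool → α => (f l, f !l)) (Measure.pi fun _ : Bool => ν)
      (ν.prod ν) := by
  refine ⟨by fun_prop, (Measure.prod_eq fun s t hs ht => ?_).symm⟩
  rw [Measure.map_apply (by fun_prop) (hs.prod ht)]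
  have : (fun f : Bool → α => (f l, f !l)) ⁻¹' s ×ˢ t =
      Set.univ.pi fun b => if b = l then s else t := by
    ext f
    cases l <;> simp [and_comm]
  rw [this, Measure.pi_pi]
  cases l <;> simp [mul_comm]

theorem measurePreserving_prod_prod_comm {α β γ δ : Type*} [MeasurableSpace α]
    [MeasurableSpace β] [MeasurableSpace γ] [MeasurableSpace δ] (a : Measure α) (b : Measure β)
    (c : Measure γ) (d : Measure δ) [SFinite a] [SFinite b] [SFinite c] [SFinite d] :
    MeasurePreserving (fun p : (α × β) × (γ × δ) => ((p.1.1, p.2.1), (p.1.2, p.2.2)))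
      ((a.prod b).prod (c.prod d)) ((a.prod c).prod (b.prod d)) := by
  have h1 : MeasurePreserving (fun p : (α × β) × (γ × δ) => (p.1.1, (p.1.2, p.2)))
      ((a.prod b).prod (c.prod d)) (a.prod (b.prod (c.prod d))) :=
    measurePreserving_prodAssoc a b (c.prod d)
  have h2 : MeasurePreserving (fun p : β × (γ × δ) => (p.2.1, (p.1, p.2.2)))
      (b.prod (c.prod d)) (c.prod (b.prod d)) := by
    have e1 : MeasurePreserving (fun p : β × (γ × δ) => ((p.1, p.2.1), p.2.2))
        (b.prod (c.prod d)) ((b.prod c).prod d) :=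
      (measurePreserving_prodAssoc b c d).symm
    have e2 : MeasurePreserving (fun p : (β × γ) × δ => ((p.1.2, p.1.1), p.2))
        ((b.prod c).prod d) ((c.prod b).prod d) :=
      (Measure.measurePreserving_swap (μ := b) (ν := c)).prod (MeasurePreserving.id d)
    exact (measurePreserving_prodAssoc c b d).comp (e2.comp e1)
  have h3 : MeasurePreserving (fun p : α × (β × (γ × δ)) => (p.1, (p.2.2.1, (p.2.1, p.2.2.2))))
      (a.prod (b.prod (c.prod d))) (a.prod (c.prod (b.prod d))) :=
    (MeasurePreserving.id a).prod h2
  have h4 : MeasurePreserving (fun p : α × (γ × (β × δ)) => ((p.1, p.2.1), p.2.2))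
      (a.prod (c.prod (b.prod d))) ((a.prod c).prod (b.prod d)) :=
    (measurePreserving_prodAssoc a c (b.prod d)).symm
  exact h4.comp (h3.comp h1)

variable {X : Type*} [MeasurableSpace X] {lamX : Measure X} {lamY : Measure ℝ}
  [SigmaFinite lamY] {S : CovariateShift lamX lamY}

theorem measurePreserving_splitFold (N M : ℕ) (l : Bool) :
    MeasurePreserving (fun s : Sample X N M => ((s.1 l, s.2 l), (s.1 !l, s.2 !l)))
      (sampleLaw S.trainLaw S.testCov N M) ((foldLaw S N M).prod (foldLaw S N M)) := by
  have h1 := (measurePreserving_bool_pi (Measure.pi fun _ : Fin N => S.trainLaw) l).prod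
    (measurePreserving_bool_pi (Measure.pi fun _ : Fin M => S.testCov) l)
  exact (measurePreserving_prod_prod_comm _ _ _ _).comp h1

theorem measurePreserving_fold (N M : ℕ) (l : Bool) :
    MeasurePreserving (fun s : Sample X N M => (s.1 l, s.2 l))
      (sampleLaw S.trainLaw S.testCov N M) (foldLaw S N M) :=
  (measurePreserving_fst (μ := foldLaw S N M) (ν := foldLaw S N M)).comp
    (measurePreserving_splitFold N M l)

theorem measurePreserving_train (N M : ℕ) (l : Bool) :
    MeasurePreserving (fun s : Sample X N M => s.1 l)
      (sampleLaw S.trainLaw S.testCov N M) (Measure.pi fun _ : Fin N => S.trainLaw) :=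
  (measurePreserving_fst (μ := Measure.pi fun _ : Fin N => S.trainLaw)
    (ν := Measure.pi fun _ : Fin M => S.testCov)).comp (measurePreserving_fold N M l)

theorem measurePreserving_test (N M : ℕ) (l : Bool) :
    MeasurePreserving (fun s : Sample X N M => s.2 l)
      (sampleLaw S.trainLaw S.testCov N M) (Measure.pi fun _ : Fin M => S.testCov) :=
  (measurePreserving_snd (μ := Measure.pi fun _ : Fin N => S.trainLaw)
    (ν := Measure.pi fun _ : Fin M => S.testCov)).comp (measurePreserving_fold N M l)

variable {N M : ℕ → ℕ}

theorem SmallInProb.split_fold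
    {Z : ∀ n, ((Fin (N n) → X × ℝ) × (Fin (M n) → X)) × ((Fin (N n) → X × ℝ) × (Fin (M n) → X)) →
      ℝ≥0∞}
    (h : SmallInProb (fun n => (foldLaw S (N n) (M n)).prod (foldLaw S (N n) (M n))) Z)
    (l : Bool) :
    SmallInProb (fun n => sampleLaw S.trainLaw S.testCov (N n) (M n))
      fun n s => Z n ((s.1 l, s.2 l), (s.1 !l, s.2 !l)) :=
  SmallInProb.comp
    (fun n => (measurePreserving_splitFold (S := S) (N n) (M n) l).measurable.aemeasurable)
    (fun n => (measurePreserving_splitFold (S := S) (N n) (M n) l).map_eq) h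

theorem Whp.train_fold {P : ∀ n, (Fin (N n) → X × ℝ) → Prop}
    (h : Whp (fun n => Measure.pi fun _ : Fin (N n) => S.trainLaw) P) (l : Bool) :
    Whp (fun n => sampleLaw S.trainLaw S.testCov (N n) (M n)) fun n s => P n (s.1 l) :=
  Whp.comp
    (fun n => (measurePreserving_train (S := S) (N n) (M n) l).measurable.aemeasurable)
    (fun n => (measurePreserving_train (S := S) (N n) (M n) l).map_eq) h

theorem BoundedInProb.train_fold {Z : ∀ n, (Fin (N n) → X × ℝ) → ℝ}
    (h : BoundedInProb (fun n => Measure.pi fun _ : Fin (N n) => S.trainLaw) Z) (l : Bool) :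
    BoundedInProb (fun n => sampleLaw S.trainLaw S.testCov (N n) (M n)) fun n s => Z n (s.1 l) :=
  BoundedInProb.comp
    (fun n => (measurePreserving_train (S := S) (N n) (M n) l).measurable.aemeasurable)
    (fun n => (measurePreserving_train (S := S) (N n) (M n) l).map_eq) h

theorem Whp.test_fold {P : ∀ n, (Fin (M n) → X) → Prop}
    (h : Whp (fun n => Measure.pi fun _ : Fin (M n) => S.testCov) P) (l : Bool) :
    Whp (fun n => sampleLaw S.trainLaw S.testCov (N n) (M n)) fun n s => P n (s.2 l) :=
  Whp.comp
    (fun n => (measurePreserving_test (S := S) (N n) (M n) l).measurable.aemeasurable)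
    (fun n => (measurePreserving_test (S := S) (N n) (M n) l).map_eq) h

end Split

/-! ### Negligible nuisance errors -/

section Negligible

variable {X : Type*} [MeasurableSpace X] {lamX : Measure X} {lamY : Measure ℝ}

/-- The errors of the nuisance estimates contribute negligibly to bounded weighted averages. -/
structure NegligibleNuisance (S : CovariateShift lamX lamY) (N M : ℕ → ℕ)
    (fhat rhat : ∀ n, Bool → NuisanceEstimator X (N n) (M n)) : Prop where
  consistent : ∀ l, SmallInProb (fun n => sampleLaw S.trainLaw S.testCov (N n) (M n))
    fun n s => ‖absRemainder S (crossFit (fhat n) s l) (crossFit (rhat n) s l)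
      (s.1 l) (s.2 l)‖ₑ
  sqrt_rate : ∀ l (u : X → ℝ) (U : ℝ), Measurable u → (∀ x, |u x| ≤ U) →
    SmallInProb (fun n => sampleLaw S.trainLaw S.testCov (N n) (M n))
      fun n s => ‖√(2 * (N n : ℝ)) * remainder S (crossFit (fhat n) s l) (crossFit (rhat n) s l)
        u (s.1 l) (s.2 l)‖ₑ

variable [SigmaFinite lamY] {S : CovariateShift lamX lamY} {N M : ℕ → ℕ} {B C Cr : ℝ}

theorem sqrt_two_mul_le {N M : ℕ} {ρ : ℝ} (hρ : 0 < ρ) (h : (M : ℝ) = ρ * N) :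
    √(2 * (N : ℝ)) ≤ (√(min 1 ρ))⁻¹ * √(min (2 * N : ℝ) (2 * M : ℝ)) := by
  have hm : 0 < min 1 ρ := lt_min one_pos hρ
  have h1 : min (2 * N : ℝ) (2 * M : ℝ) = min 1 ρ * (2 * N) := by
    rw [min_mul_of_nonneg _ _ (by positivity), h, one_mul]
    congr 1
    ring
  rw [h1, Real.sqrt_mul hm.le, ← mul_assoc, inv_mul_cancel₀ (Real.sqrt_pos.2 hm).ne', one_mul]

theorem NuisanceRates.negligible {𝓞 : Type*} [MeasurableSpace 𝓞] {μ : Measure 𝓞}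
    {sample : ∀ n, 𝓞 → Sample X (N n) (M n)}
    {fhat rhat : ∀ n, Bool → NuisanceEstimator X (N n) (M n)}
    (h : NuisanceRates S μ N M sample fhat rhat)
    (h_sample : ∀ n, HasLaw (sample n) (sampleLaw S.trainLaw S.testCov (N n) (M n)) μ)
    (h_fhat : ∀ n, MeasurableEstimator (fhat n)) (h_rhat : ∀ n, MeasurableEstimator (rhat n))
    (hov : S.Overlap) (hY : ∀ᵐ z ∂S.trainLaw, |z.2| ≤ C)
    (hf : ∀ x, |S.f0 x| ≤ B) (hCr : ∀ x, S.ratio x ≤ Cr) {ρ : ℝ} (hρ : 0 < ρ)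
    (hN : Tendsto N atTop atTop) (hM : Tendsto M atTop atTop)
    (hNM : ∀ n, (M n : ℝ) = ρ * N n) : NegligibleNuisance S N M fhat rhat := by
  have hfm : ∀ l n, Measurable fun p : ((Fin (N n) → X × ℝ) × (Fin (M n) → X)) × X =>
      fhat n l p.1.1 p.1.2 p.2 := fun l n =>
    (h_fhat n l).comp (measurable_fst.fst.prodMk (measurable_fst.snd.prodMk measurable_snd))
  have hrm : ∀ l n, Measurable fun p : ((Fin (N n) → X × ℝ) × (Fin (M n) → X)) × X =>
      rhat n l p.1.1 p.1.2 p.2 := fun l n =>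
    (h_rhat n l).comp (measurable_fst.fst.prodMk (measurable_fst.snd.prodMk measurable_snd))
  have hother : ∀ n l, AEMeasurable (fun ω => ((sample n ω).1 !l, (sample n ω).2 !l)) μ ∧
      μ.map (fun ω => ((sample n ω).1 !l, (sample n ω).2 !l)) = foldLaw S (N n) (M n) := by
    intro n l
    have hmp := measurePreserving_fold (S := S) (N n) (M n) (!l)
    refine ⟨hmp.measurable.comp_aemeasurable (h_sample n).aemeasurable, ?_⟩
    rw [← hmp.map_eq, ← (h_sample n).map_eq,
      AEMeasurable.map_map_of_aemeasurable hmp.measurable.aemeasurable (h_sample n).aemeasurable]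
    rfl
  have mma : ∀ l n, Measurable fun o : (Fin (N n) → X × ℝ) × (Fin (M n) → X) =>
      eLpNorm (fun x => rhat n l o.1 o.2 x - S.ratio x) 2 S.trainCov := fun l n =>
    measurable_eLpNorm_two ((hrm l n).sub (S.measurable_ratio.comp measurable_snd))
  have mmb : ∀ l n, Measurable fun o : (Fin (N n) → X × ℝ) × (Fin (M n) → X) =>
      eLpNorm (fun x => fhat n l o.1 o.2 x - S.f0 x) 2 S.trainCov := fun l n =>
    measurable_eLpNorm_two ((hfm l n).sub (S.measurable_f0.comp measurable_snd))
  have ha : ∀ l, SmallInProb (fun n => foldLaw S (N n) (M n)) fun n o =>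
      eLpNorm (fun x => rhat n l o.1 o.2 x - S.ratio x) 2 S.trainCov := fun l =>
    SmallInProb.of_comp (fun n => (hother n l).1) (fun n => (hother n l).2) (mma l)
      (h.ratio_consistent l).smallInProb
  have hb : ∀ l, SmallInProb (fun n => foldLaw S (N n) (M n)) fun n o =>
      eLpNorm (fun x => fhat n l o.1 o.2 x - S.f0 x) 2 S.trainCov := fun l =>
    SmallInProb.of_comp (fun n => (hother n l).1) (fun n => (hother n l).2) (mmb l)
      (h.regression_consistent l).smallInProb
  have hab : ∀ l, SmallInProb (fun n => foldLaw S (N n) (M n)) fun n o =>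
      ENNReal.ofReal (√(2 * (N n : ℝ))) *
        (eLpNorm (fun x => rhat n l o.1 o.2 x - S.ratio x) 2 S.trainCov *
          eLpNorm (fun x => fhat n l o.1 o.2 x - S.f0 x) 2 S.trainCov) := fun l => by
    refine SmallInProb.of_comp (fun n => (hother n l).1) (fun n => (hother n l).2)
      (fun n => ((mma l n).mul (mmb l n)).const_mul _) ?_
    refine ((h.product_rate l).smallInProb.const_mul
      (c := ENNReal.ofReal (√(min 1 ρ))⁻¹) ENNReal.ofReal_ne_top).mono fun n ω => ?_
    rw [← mul_assoc (ENNReal.ofReal (√(min 1 ρ))⁻¹), ← ENNReal.ofReal_mul (by positivity)]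
    exact mul_le_mul_left (ENNReal.ofReal_le_ofReal (sqrt_two_mul_le hρ (hNM n))) _
  constructor
  · intro l
    have key := smallInProb_absRemainder (N := N) (M := M) hov hY hf hCr
      (Ω' := fun n => (Fin (N n) → X × ℝ) × (Fin (M n) → X))
      (ν' := fun n => foldLaw S (N n) (M n))
      (fo := fun n o => fhat n l o.1 o.2) (ro := fun n o => rhat n l o.1 o.2) (hfm l) (hrm l)
      (ha l) (hb l)
    exact key.split_fold l
  · intro l u U hu hU
    have key := smallInProb_sqrt_mul_remainder (N := N) (M := M) hov hY hf hCr hρ hN hM hNM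
      (Ω' := fun n => (Fin (N n) → X × ℝ) × (Fin (M n) → X))
      (ν' := fun n => foldLaw S (N n) (M n))
      (fo := fun n o => fhat n l o.1 o.2) (ro := fun n o => rhat n l o.1 o.2) (hfm l) (hrm l)
      (ha l) (hb l) (hab l) hu hU
    exact key.split_fold l

end Negligible

/-! ### Consistency -/

section Consistency

variable {X : Type*} [MeasurableSpace X] {lamX : Measure X} {lamY : Measure ℝ}
  {S : CovariateShift lamX lamY} {N M : ℕ → ℕ} {B C Cr : ℝ}

theorem ae_abs_noise_le (hY : ∀ᵐ z ∂S.trainLaw, |z.2| ≤ C) (hf : ∀ x, |S.f0 x| ≤ B)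
    (hCr : ∀ x, S.ratio x ≤ Cr) : ∀ᵐ z ∂S.trainLaw, |S.noise z| ≤ (C + B) * Cr := by
  filter_upwards [hY] with z hz
  rw [CovariateShift.noise, abs_mul, abs_of_nonneg (S.ratio_nonneg _)]
  have h1 : |z.2 - S.f0 z.1| ≤ C + B := (abs_sub _ _).trans (add_le_add hz (hf z.1))
  exact mul_le_mul h1 (hCr _) (S.ratio_nonneg _) ((abs_nonneg _).trans h1)

variable [SigmaFinite lamY]

theorem CovariateShift.measurable_noise (S : CovariateShift lamX lamY) : Measurable S.noise :=
  (measurable_snd.sub (S.measurable_f0.comp measurable_fst)).mul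
    (S.measurable_ratio.comp measurable_fst)

theorem integral_mul_noise (hY : ∀ᵐ z ∂S.trainLaw, |z.2| ≤ C) (hf : ∀ x, |S.f0 x| ≤ B)
    (hCr : ∀ x, S.ratio x ≤ Cr) {u : X → ℝ} (hu : Measurable u) {U : ℝ} (hU : ∀ x, |u x| ≤ U) :
    ∫ z, u z.1 * S.noise z ∂S.trainLaw = 0 := by
  have hint : Integrable (fun x => u x * S.ratio x) S.trainCov := by
    refine Integrable.of_bound (hu.mul S.measurable_ratio).aestronglyMeasurable (U * Cr)
      (Eventually.of_forall fun x => ?_)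
    rw [Real.norm_eq_abs, abs_mul, abs_of_nonneg (S.ratio_nonneg _)]
    exact mul_le_mul (hU x) (hCr x) (S.ratio_nonneg _) ((abs_nonneg _).trans (hU x))
  rw [← (CovariateShift.integral_mul_residual hY hf hint).2]
  exact integral_congr_ae (Eventually.of_forall fun z => by
    simp only [CovariateShift.noise]; ring)

variable {k : ℕ} {Θ : Set (Param k)} {g : Param k → X → ℝ} {β₀ : Param k}

/-- Outside a neighbourhood of the true parameter, the doubly robust risk is larger than at the
true parameter, uniformly and with probability tending to one. -/
theorem whp_drRisk_lt (hΘ : IsCompact Θ) (h : RegularModel Θ g)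
    (hB : ∀ β ∈ Θ, ∀ x, |g β x| ≤ B) (hβ₀ : β₀ ∈ Θ) (hs : ∀ x, S.f0 x = g β₀ x)
    (hid : ∀ β ∈ Θ, ∫ x, (g β x - S.f0 x) ^ 2 ∂S.testCov = 0 → β = β₀)
    (hY : ∀ᵐ z ∂S.trainLaw, |z.2| ≤ C) (hCr : ∀ x, S.ratio x ≤ Cr)
    (hN : Tendsto N atTop atTop) (hM : Tendsto M atTop atTop)
    {fhat rhat : ∀ n, Bool → NuisanceEstimator X (N n) (M n)}
    (hneg : NegligibleNuisance S N M fhat rhat) {δ : ℝ} (hδ : 0 < δ) :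
    Whp (fun n => sampleLaw S.trainLaw S.testCov (N n) (M n)) fun n s =>
      ∀ β ∈ Θ, δ ≤ dist β β₀ → ∑ l : Bool, drRisk g (fhat n) (rhat n) s l β₀ <
        ∑ l : Bool, drRisk g (fhat n) (rhat n) s l β := by
  have hf : ∀ x, |S.f0 x| ≤ B := fun x => by rw [hs]; exact hB β₀ hβ₀ x
  have hdB : ∀ β ∈ Θ, ∀ x, |g β x - S.f0 x| ≤ 2 * B := fun β hβ x =>
    (abs_sub _ _).trans (by linarith [hB β hβ x, hf x])
  have hdm : ∀ β ∈ Θ, Measurable fun x => g β x - S.f0 x := fun β hβ =>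
    (h.measurable β hβ).sub S.measurable_f0
  have hdc : ∀ x, ContinuousOn (fun β => g β x - S.f0 x) Θ := fun x =>
    (h.continuousOn x).sub continuousOn_const
  set m : Param k → ℝ := fun β => ∫ x, (g β x - S.f0 x) ^ 2 ∂S.testCov with hm
  have hsqB : ∀ β ∈ Θ, ∀ x, |(g β x - S.f0 x) ^ 2| ≤ (2 * B) ^ 2 := fun β hβ x => by
    rw [abs_pow]
    gcongr
    exact hdB β hβ x
  have hmc : ContinuousOn m Θ :=
    continuousOn_of_dominated (bound := fun _ => (2 * B) ^ 2)
      (fun β hβ => ((hdm β hβ).pow_const 2).aestronglyMeasurable)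
      (fun β hβ => Eventually.of_forall fun x => hsqB β hβ x) (integrable_const _)
      (Eventually.of_forall fun x => (hdc x).pow 2)
  set K : Set (Param k) := Θ ∩ {β | δ ≤ dist β β₀}
  have hK : IsCompact K :=
    hΘ.inter_right (isClosed_le continuous_const (continuous_id.dist continuous_const))
  obtain ⟨c, hc0, hc⟩ : ∃ c : ℝ, 0 < c ∧ ∀ β ∈ K, c ≤ m β := by
    rcases K.eq_empty_or_nonempty with hE | hne
    · exact ⟨1, one_pos, by simp [hE]⟩
    obtain ⟨b, hb, hmin⟩ := hK.exists_isMinOn hne (hmc.mono Set.inter_subset_left)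
    refine ⟨m b, ?_, fun β hβ => hmin hβ⟩
    refine lt_of_le_of_ne (integral_nonneg fun x => sq_nonneg _) fun h0 => ?_
    have := hid b hb.1 h0.symm
    have h2 : δ ≤ dist b β₀ := hb.2
    rw [this, dist_self] at h2
    exact absurd hδ (not_lt.2 h2)
  have hB0 : 0 ≤ B := (abs_nonneg _).trans (hf (Classical.choice (by
    by_contra hX
    rw [not_nonempty_iff] at hX
    have := (inferInstance : IsProbabilityMeasure S.testCov).measure_univ
    rw [Set.univ_eq_empty_iff.2 hX, measure_empty] at this
    exact zero_ne_one this)))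
  have : CompactSpace Θ := isCompact_iff_compactSpace.1 hΘ
  have hU1 := whp_uniform_average (P := S.trainLaw) (T := Θ)
    (Φ := fun β z => (g β z.1 - S.f0 z.1) * S.noise z)
    (fun β => ((hdm β β.2).comp measurable_fst).mul S.measurable_noise)
    (fun z => (continuousOn_iff_continuous_domRestrict.1 (hdc z.1)).mul continuous_const)
    (C := 2 * B * ((C + B) * Cr)) ((ae_abs_noise_le hY hf hCr).mono fun z hz β => by
      rw [abs_mul]
      exact mul_le_mul (hdB β β.2 z.1) hz (abs_nonneg _) (by positivity)) hN
    (ε := c / 16) (by positivity)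
  have hU2 := whp_uniform_average (P := S.testCov) (T := Θ)
    (Φ := fun β x => (g β x - S.f0 x) ^ 2)
    (fun β => (hdm β β.2).pow_const 2)
    (fun x => (continuousOn_iff_continuous_domRestrict.1 (hdc x)).pow 2)
    (C := (2 * B) ^ 2) (Eventually.of_forall fun x β => hsqB β β.2 x) hM
    (ε := c / 16) (by positivity)
  have hR := fun l => (hneg.consistent l).whp_abs_lt (ε := c / (16 * (2 * B + 1))) (by positivity)
  refine (whp_forall fun l => ((hU1.train_fold l).and (hU2.test_fold l)).and (hR l)).mono
    fun n s hω β hβ hdist => ?_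
  rw [← sub_pos, ← Finset.sum_sub_distrib]
  refine Finset.sum_pos (fun l _ => ?_) Finset.univ_nonempty
  obtain ⟨⟨h1, h2⟩, h3⟩ := hω l
  have h1 := h1 ⟨β, hβ⟩
  have h2 := h2 ⟨β, hβ⟩
  simp only at h1 h2
  rw [integral_mul_noise hY hf hCr (hdm β hβ) (hdB β hβ), sub_zero] at h1
  have h4 := abs_remainder_le S (crossFit (fhat n) s l) (crossFit (rhat n) s l) (hdB β hβ)
    (s.1 l) (s.2 l)
  have h5 : 2 * B * absRemainder S (crossFit (fhat n) s l) (crossFit (rhat n) s l)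
      (s.1 l) (s.2 l) ≤ c / 16 := by
    calc _ ≤ 2 * B * (c / (16 * (2 * B + 1))) := by
          gcongr
          exact (le_abs_self _).trans h3.le
      _ = 2 * B / (2 * B + 1) * (c / 16) := by field_simp
      _ ≤ 1 * (c / 16) := by
          gcongr
          rw [div_le_one (by positivity)]
          linarith
      _ = c / 16 := one_mul _
  have h6 : c ≤ ∫ x, (g β x - S.f0 x) ^ 2 ∂S.testCov := hc β ⟨hβ, hdist⟩
  rw [drRisk_sub_drRisk S (fhat n) (rhat n) s hs β l]
  rw [abs_lt] at h1 h2
  have h7 := (abs_le.1 (h4.trans h5)).2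
  linarith [h1.2, h2.1]

end Consistency

/-! ### The score at the true parameter -/

section Linearization

variable {X : Type*} [MeasurableSpace X] {lamX : Measure X} {lamY : Measure ℝ}
  {S : CovariateShift lamX lamY} {N M : ℕ → ℕ} {B C Cr : ℝ}
  {k : ℕ} {Θ : Set (Param k)} {g : Param k → X → ℝ} {β₀ : Param k}

/-- Linearization of the score at the true parameter. -/
theorem smallInProb_score_sub (h : RegularModel Θ g) (hβ₀ : β₀ ∈ interior Θ)
    (hs : ∀ x, S.f0 x = g β₀ x) (hgd : ∀ x a, |gdot g β₀ x a| ≤ B)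
    {fhat rhat : ∀ n, Bool → NuisanceEstimator X (N n) (M n)}
    (hneg : NegligibleNuisance S N M fhat rhat) (a : Fin k) :
    SmallInProb (fun n => sampleLaw S.trainLaw S.testCov (N n) (M n)) fun n s =>
      ‖√(2 * (N n : ℝ)) * score g (fhat n) (rhat n) s β₀ a -
        √(2 * (N n : ℝ)) * ∑ l : Bool, (1 / (N n : ℝ)) *
          ∑ i, gdot g β₀ (s.1 l i).1 a * S.noise (s.1 l i)‖ₑ := by
  refine (SmallInProb.sum Finset.univ fun l _ => hneg.sqrt_rate l (fun x => gdot g β₀ x a) B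
    (h.measurable_gdot hβ₀ a) fun x => hgd x a).mono fun n s => ?_
  rw [score_eq S (fhat n) (rhat n) s hs, ← mul_sub, ← Finset.sum_sub_distrib, Finset.mul_sum]
  refine (enorm_sum_le _ _).trans (Finset.sum_le_sum fun l _ => ?_)
  rw [add_sub_cancel_left]

variable [SigmaFinite lamY]

/-- The score Jacobian at the true parameter converges to minus twice the Gram matrix. -/
theorem smallInProb_scoreJacobian (h : RegularModel Θ g) (hβ₀ : β₀ ∈ interior Θ)
    (hs : ∀ x, S.f0 x = g β₀ x) (hf : ∀ x, |S.f0 x| ≤ B)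
    (hgd : ∀ x a, |gdot g β₀ x a| ≤ B) (hgdd : ∀ x a b, |gddot g β₀ x a b| ≤ B)
    (hY : ∀ᵐ z ∂S.trainLaw, |z.2| ≤ C) (hCr : ∀ x, S.ratio x ≤ Cr)
    (hN : Tendsto N atTop atTop) (hM : Tendsto M atTop atTop)
    {fhat rhat : ∀ n, Bool → NuisanceEstimator X (N n) (M n)}
    (hneg : NegligibleNuisance S N M fhat rhat) (a b : Fin k) :
    SmallInProb (fun n => sampleLaw S.trainLaw S.testCov (N n) (M n)) fun n s =>
      ‖scoreJacobian g (fhat n) (rhat n) s β₀ a b - -2 * gramMatrix S g β₀ a b‖ₑ := by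
  refine smallInProb_of_whp_abs_lt fun ε hε => ?_
  have hε6 : 0 < ε / 6 := by positivity
  have hB0 : ∀ _ : X, 0 ≤ B := fun x => (abs_nonneg _).trans (hf x)
  have h1 := whp_average_sub_integral_lt (P := S.trainLaw) hN
    (W := fun z => gddot g β₀ z.1 a b * S.noise z)
    (((h.measurable_gddot hβ₀ a b).comp measurable_fst).mul S.measurable_noise)
    (C := B * ((C + B) * Cr)) ((ae_abs_noise_le hY hf hCr).mono fun z hz => by
      rw [abs_mul]
      exact mul_le_mul (hgdd z.1 a b) hz (abs_nonneg _) (hB0 z.1)) hε6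
  rw [integral_mul_noise hY hf hCr (h.measurable_gddot hβ₀ a b) fun x => hgdd x a b] at h1
  have h2 := whp_average_sub_integral_lt (P := S.testCov) hM
    (W := fun x => gdot g β₀ x a * gdot g β₀ x b)
    ((h.measurable_gdot hβ₀ a).mul (h.measurable_gdot hβ₀ b))
    (C := B * B) (Eventually.of_forall fun x => by
      rw [abs_mul]
      exact mul_le_mul (hgd x a) (hgd x b) (abs_nonneg _) (hB0 x)) hε6
  have h3 := fun l => (((hneg.consistent l).const_mul (c := ENNReal.ofReal B)
    ENNReal.ofReal_ne_top).mono (Z := fun n s => ‖B * absRemainder S (crossFit (fhat n) s l)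
      (crossFit (rhat n) s l) (s.1 l) (s.2 l)‖ₑ) fun n s => by
        rw [enorm_mul]
        gcongr
        rcases isEmpty_or_nonempty X with hX | ⟨⟨x⟩⟩
        · have := (inferInstance : IsProbabilityMeasure S.testCov).measure_univ
          rw [Set.univ_eq_empty_iff.2 hX, measure_empty] at this
          exact absurd this zero_ne_one
        · exact enorm_le_ofReal (abs_of_nonneg (hB0 x)).le).whp_abs_lt hε6
  refine (whp_forall fun l => ((h1.train_fold l).and (h2.test_fold l)).and (h3 l)).mono
    fun n s hω => ?_
  have hG : -2 * gramMatrix S g β₀ a b = ∑ l : Bool,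
      (0 - ∫ x, gdot g β₀ x a * gdot g β₀ x b ∂S.testCov) := by
    simp [gramMatrix]
  rw [h.scoreJacobian_eq_remainder S (fhat n) (rhat n) s hβ₀ hs, hG, ← Finset.sum_sub_distrib]
  refine (Finset.abs_sum_le_sum_abs _ _).trans_lt ?_
  have hε2 : ε = ∑ _l : Bool, ε / 2 := by rw [Fintype.sum_bool]; ring
  rw [hε2]
  refine Finset.sum_lt_sum_of_nonempty Finset.univ_nonempty fun l _ => ?_
  obtain ⟨⟨e1, e2⟩, e3⟩ := hω l
  have e4 := abs_remainder_le S (crossFit (fhat n) s l) (crossFit (rhat n) s l)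
    (fun x => hgdd x a b) (s.1 l) (s.2 l)
  have e5 := abs_lt.1 ((e4.trans (le_abs_self _)).trans_lt e3)
  rw [abs_lt] at e1 e2 ⊢
  constructor <;> linarith [e1.1, e1.2, e2.1, e2.2, e5.1, e5.2]

theorem boundedInProb_score (h : RegularModel Θ g) (hβ₀ : β₀ ∈ interior Θ)
    (hs : ∀ x, S.f0 x = g β₀ x) (hf : ∀ x, |S.f0 x| ≤ B) (hgd : ∀ x a, |gdot g β₀ x a| ≤ B)
    (hY : ∀ᵐ z ∂S.trainLaw, |z.2| ≤ C) (hCr : ∀ x, S.ratio x ≤ Cr)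
    (hN : Tendsto N atTop atTop)
    {fhat rhat : ∀ n, Bool → NuisanceEstimator X (N n) (M n)}
    (hneg : NegligibleNuisance S N M fhat rhat) (a : Fin k) :
    BoundedInProb (fun n => sampleLaw S.trainLaw S.testCov (N n) (M n)) fun n s =>
      √(2 * (N n : ℝ)) * score g (fhat n) (rhat n) s β₀ a := by
  have hWm : Measurable fun z : X × ℝ => gdot g β₀ z.1 a * S.noise z :=
    ((h.measurable_gdot hβ₀ a).comp measurable_fst).mul S.measurable_noise
  have hW : ∫⁻ z, ‖gdot g β₀ z.1 a * S.noise z‖ₑ ^ 2 ∂S.trainLaw ≤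
      ENNReal.ofReal (B * ((C + B) * Cr)) ^ 2 := by
    calc _ ≤ ∫⁻ _, ENNReal.ofReal (B * ((C + B) * Cr)) ^ 2 ∂S.trainLaw := by
          refine lintegral_mono_ae ((ae_abs_noise_le hY hf hCr).mono fun z hz => ?_)
          refine pow_le_pow_left' (enorm_le_ofReal ?_) 2
          rw [abs_mul]
          exact mul_le_mul (hgd z.1 a) hz (abs_nonneg _) ((abs_nonneg _).trans (hf z.1))
      _ = _ := by simp
  have hmean := integral_mul_noise hY hf hCr (h.measurable_gdot hβ₀ a) fun x => hgd x a
  have hmain : BoundedInProb (fun n => sampleLaw S.trainLaw S.testCov (N n) (M n)) fun n s =>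
      ∑ l : Bool, √(2 * (N n : ℝ)) * ((1 / (N n : ℝ)) *
        ∑ i, gdot g β₀ (s.1 l i).1 a * S.noise (s.1 l i)) := by
    refine BoundedInProb.sum Finset.univ fun l _ => ?_
    have key : BoundedInProb (fun n => Measure.pi fun _ : Fin (N n) => S.trainLaw) fun n z =>
        √(2 * (N n : ℝ)) * ((1 / (N n : ℝ)) * ∑ i, gdot g β₀ (z i).1 a * S.noise (z i)) := by
      have hm : ∀ n, Measurable fun z : Fin (N n) → X × ℝ =>
          (1 / (N n : ℝ)) * ∑ i, gdot g β₀ (z i).1 a * S.noise (z i) := fun n =>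
        measurable_average hWm
      refine boundedInProb_of_lintegral_sq (fun n => ((hm n).const_mul _).aemeasurable)
        (C := ENNReal.ofReal 2 * ENNReal.ofReal (B * ((C + B) * Cr)) ^ 2)
        (ENNReal.mul_ne_top ENNReal.ofReal_ne_top (ENNReal.pow_ne_top ENNReal.ofReal_ne_top)) ?_
      filter_upwards [hN.eventually_ne_atTop 0] with n hn
      have hinv : (N n : ℝ≥0∞)⁻¹ * ENNReal.ofReal (√(2 * (N n : ℝ))) ^ 2 = ENNReal.ofReal 2 := by
        simpa using inv_mul_ofReal_sqrt_sq (N := N n) hn one_pos (one_mul _).symm 1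
      have hvar := lintegral_sq_average_sub_integral_le (P := S.trainLaw) hn hWm
      rw [hmean] at hvar
      simp only [sub_zero] at hvar
      simp only [enorm_mul (√(2 * (N n : ℝ))), mul_pow]
      rw [lintegral_const_mul _ ((hm n).enorm.pow_const 2), Real.enorm_eq_ofReal_abs,
        abs_of_nonneg (Real.sqrt_nonneg _), ← hinv, mul_comm (N n : ℝ≥0∞)⁻¹, mul_assoc]
      gcongr
      exact hvar.trans (by gcongr)
    exact key.train_fold l
  have := (smallInProb_score_sub h hβ₀ hs hgd hneg a).boundedInProb.add hmain
  refine this.mono_whp (whp_of_ae (Eventually.of_forall fun n => Eventually.of_forall fun s => ?_))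
  refine (congrArg abs ?_).le
  simp only [Fintype.sum_bool]
  ring

end Linearization

/-! ### The asymptotic variance -/

section Variance

variable {X : Type*} [MeasurableSpace X] {lamX : Measure X} {lamY : Measure ℝ}
  {S : CovariateShift lamX lamY} {k : ℕ} {g : Param k → X → ℝ} {β : Param k} {B C Cr : ℝ}

theorem gramMatrix_transpose : (gramMatrix S g β)ᵀ = gramMatrix S g β := by
  ext a b
  simp only [Matrix.transpose_apply, gramMatrix, mul_comm]

theorem asympVar_eq (x : X) :
    asympVar S g β x = ((gramMatrix S g β)⁻¹ *ᵥ gdot g β x) ⬝ᵥ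
      (noiseMatrix S g β *ᵥ ((gramMatrix S g β)⁻¹ *ᵥ gdot g β x)) := by
  have h : gdot g β x ᵥ* (gramMatrix S g β)⁻¹ = (gramMatrix S g β)⁻¹ *ᵥ gdot g β x := by
    rw [← Matrix.mulVec_transpose, Matrix.transpose_nonsing_inv, gramMatrix_transpose]
  rw [asympVar, asympCov, ← Matrix.mulVec_mulVec, ← Matrix.mulVec_mulVec, Matrix.dotProduct_mulVec,
    h]

theorem CovariateShift.Overlap.testCov_le (h : S.Overlap) (hCr : ∀ x, S.ratio x ≤ Cr) :
    S.testCov ≤ ENNReal.ofReal Cr • S.trainCov := by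
  refine Measure.le_iff.2 fun s hs => ?_
  rw [h.testCov_eq, withDensity_apply _ hs, Measure.smul_apply, smul_eq_mul]
  calc ∫⁻ x in s, ENNReal.ofReal (S.ratio x) ∂S.trainCov
      ≤ ∫⁻ _ in s, ENNReal.ofReal Cr ∂S.trainCov :=
        lintegral_mono fun x => ENNReal.ofReal_le_ofReal (hCr x)
    _ = ENNReal.ofReal Cr * S.trainCov s := by simp

variable [SigmaFinite lamY]

theorem CovariateShift.integrable_sigmaSq (hY : ∀ᵐ z ∂S.trainLaw, |z.2| ≤ C)
    (hf : ∀ x, |S.f0 x| ≤ B) : Integrable S.sigmaSq S.trainCov := by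
  have hint : Integrable (fun z : X × ℝ => (z.2 - S.f0 z.1) ^ 2) S.trainLaw := by
    refine Integrable.of_bound ((measurable_snd.sub
      (S.measurable_f0.comp measurable_fst)).pow_const 2).aestronglyMeasurable ((C + B) ^ 2) ?_
    filter_upwards [hY] with z hz
    rw [Real.norm_eq_abs, abs_pow]
    gcongr
    exact (abs_sub _ _).trans (add_le_add hz (hf z.1))
  rw [S.trainLaw_eq_compProd] at hint
  rw [Measure.compProd] at hint
  refine (Integrable.integral_compProd hint).congr (Eventually.of_forall fun x => ?_)
  simp [S.sigmaSq_eq]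

theorem dotProduct_noiseMatrix_mulVec (hov : S.Overlap) (hY : ∀ᵐ z ∂S.trainLaw, |z.2| ≤ C)
    (hf : ∀ x, |S.f0 x| ≤ B) (hCr : ∀ x, S.ratio x ≤ Cr)
    (hgm : ∀ a, Measurable fun x => gdot g β x a) (hgd : ∀ x a, |gdot g β x a| ≤ B)
    (v : Fin k → ℝ) :
    v ⬝ᵥ (noiseMatrix S g β *ᵥ v) =
      ∫ z, ((∑ a, v a * gdot g β z.1 a) * S.noise z) ^ 2 ∂S.trainLaw := by
  have hint : ∀ a b, Integrable
      (fun x => S.sigmaSq x * S.ratio x * (gdot g β x a * gdot g β x b)) S.testCov := by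
    intro a b
    have hσ : Integrable S.sigmaSq S.testCov :=
      (CovariateShift.integrable_sigmaSq hY hf).of_measure_le_smul ENNReal.ofReal_ne_top
        (hov.testCov_le hCr)
    simp only [mul_assoc]
    refine hσ.mul_bdd (c := Cr * (B * B))
      (S.measurable_ratio.mul ((hgm a).mul (hgm b))).aestronglyMeasurable
      (Eventually.of_forall fun x => ?_)
    rw [Real.norm_eq_abs, abs_mul, abs_mul, abs_of_nonneg (S.ratio_nonneg x)]
    exact mul_le_mul (hCr x) (mul_le_mul (hgd x a) (hgd x b) (abs_nonneg _)
      ((abs_nonneg _).trans (hf x))) (by positivity) ((S.ratio_nonneg x).trans (hCr x))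
  have hwm : Measurable fun x => (∑ a, v a * gdot g β x a) * S.ratio x :=
    (Finset.measurable_fun_sum _ fun a _ => (hgm a).const_mul _).mul S.measurable_ratio
  have hwb : ∀ x, |(∑ a, v a * gdot g β x a) * S.ratio x| ≤ (∑ a, |v a| * B) * Cr := fun x => by
    rw [abs_mul, abs_of_nonneg (S.ratio_nonneg x)]
    refine mul_le_mul ((Finset.abs_sum_le_sum_abs _ _).trans (Finset.sum_le_sum fun a _ => ?_))
      (hCr x) (S.ratio_nonneg x) (Finset.sum_nonneg fun a _ => mul_nonneg (abs_nonneg _)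
        ((abs_nonneg _).trans (hf x)))
    rw [abs_mul]
    exact mul_le_mul_of_nonneg_left (hgd x a) (abs_nonneg _)
  have h1 : ∫ z, ((∑ a, v a * gdot g β z.1 a) * S.noise z) ^ 2 ∂S.trainLaw =
      ∫ x, S.sigmaSq x * S.ratio x * (∑ a, v a * gdot g β x a) ^ 2 ∂S.testCov := by
    rw [hov.integral_testCov]
    refine Eq.trans ?_ ((CovariateShift.integral_sq_mul_residual_sq hY hf hwm hwb).trans ?_)
    · refine integral_congr_ae (Eventually.of_forall fun z => ?_)
      simp only [CovariateShift.noise]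
      ring
    · refine integral_congr_ae (Eventually.of_forall fun x => ?_)
      simp only
      ring
  have h2 : ∀ x, S.sigmaSq x * S.ratio x * (∑ a, v a * gdot g β x a) ^ 2 =
      ∑ a, ∑ b, v a * v b * (S.sigmaSq x * S.ratio x * (gdot g β x a * gdot g β x b)) := by
    intro x
    rw [sq, Finset.sum_mul_sum, Finset.mul_sum]
    refine Finset.sum_congr rfl fun a _ => ?_
    rw [Finset.mul_sum]
    exact Finset.sum_congr rfl fun b _ => by ring
  rw [h1]
  simp only [h2]
  rw [integral_finsetSum _ fun a _ => integrable_finsetSum _ fun b _ => (hint a b).const_mul _]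
  refine Finset.sum_congr rfl fun a _ => ?_
  rw [integral_finsetSum _ fun b _ => (hint a b).const_mul _, Matrix.mulVec, dotProduct,
    Finset.mul_sum]
  refine Finset.sum_congr rfl fun b _ => ?_
  rw [integral_const_mul, noiseMatrix]
  ring

end Variance

/-! ### Approximate Newton steps -/

section Newton

variable {k : ℕ} {G Gi J : Matrix (Fin k) (Fin k) ℝ} {T z : Fin k → ℝ} {κ : ℝ}

theorem abs_vecMul_dotProduct_sub_le (hz : ∀ a, z a + ∑ b, J a b * T b = 0)
    (hJ : ∀ a b, |J a b - -2 * G a b| ≤ κ) (v : Fin k → ℝ) :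
    |(v ᵥ* G) ⬝ᵥ T - 1 / 2 * (v ⬝ᵥ z)| ≤ 1 / 2 * κ * (∑ a, |v a|) * ∑ b, |T b| := by
  have h1 : (v ᵥ* G) ⬝ᵥ T - 1 / 2 * (v ⬝ᵥ z) =
      1 / 2 * ∑ a, v a * ∑ b, (J a b - -2 * G a b) * T b := by
    rw [← Matrix.dotProduct_mulVec, dotProduct, dotProduct, Finset.mul_sum, Finset.mul_sum,
      ← Finset.sum_sub_distrib]
    refine Finset.sum_congr rfl fun a _ => ?_
    have h2 : ∑ b, (J a b - -2 * G a b) * T b = ∑ b, J a b * T b + 2 * ∑ b, G a b * T b := by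
      rw [Finset.mul_sum, ← Finset.sum_add_distrib]
      exact Finset.sum_congr rfl fun b _ => by ring
    rw [h2, Matrix.mulVec, dotProduct]
    linear_combination (-1 / 2 * v a) * hz a
  have h3 : ∀ a, |∑ b, (J a b - -2 * G a b) * T b| ≤ κ * ∑ b, |T b| := fun a => by
    rw [Finset.mul_sum]
    refine (Finset.abs_sum_le_sum_abs _ _).trans (Finset.sum_le_sum fun b _ => ?_)
    rw [abs_mul]
    exact mul_le_mul_of_nonneg_right (hJ a b) (abs_nonneg _)
  rw [h1, abs_mul, abs_of_pos (by norm_num : (0 : ℝ) < 1 / 2), mul_assoc, mul_assoc]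
  gcongr
  rw [mul_left_comm, Finset.sum_mul]
  refine (Finset.abs_sum_le_sum_abs _ _).trans (Finset.sum_le_sum fun a _ => ?_)
  rw [abs_mul]
  exact mul_le_mul_of_nonneg_left (h3 a) (abs_nonneg _)

theorem sum_abs_step_le (hGi : Gi * G = 1) (hz : ∀ a, z a + ∑ b, J a b * T b = 0)
    (hJ : ∀ a b, |J a b - -2 * G a b| ≤ κ) (hκ : κ * ∑ a, ∑ b, |Gi a b| ≤ 1) :
    ∑ b, |T b| ≤ (∑ a, ∑ b, |Gi a b|) * ∑ a, |z a| := by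
  have h1 : ∀ c, |T c| ≤ 1 / 2 * ((∑ b, |Gi c b|) * ∑ a, |z a|) +
      1 / 2 * κ * (∑ b, |Gi c b|) * ∑ b, |T b| := by
    intro c
    have h2 := abs_vecMul_dotProduct_sub_le hz hJ (Gi c)
    have h3 : (Gi c ᵥ* G) ⬝ᵥ T = T c := by
      have : Gi c ᵥ* G = (1 : Matrix (Fin k) (Fin k) ℝ) c := by rw [← hGi]; rfl
      rw [this, dotProduct]
      simp [Matrix.one_apply]
    have h4 : |Gi c ⬝ᵥ z| ≤ (∑ b, |Gi c b|) * ∑ a, |z a| := by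
      rw [Finset.sum_mul]
      refine (Finset.abs_sum_le_sum_abs _ _).trans (Finset.sum_le_sum fun b _ => ?_)
      rw [abs_mul]
      exact mul_le_mul_of_nonneg_left
        (Finset.single_le_sum (f := fun a => |z a|) (fun a _ => abs_nonneg _) (Finset.mem_univ b))
        (abs_nonneg _)
    rw [h3] at h2
    have h5 := abs_add_le (T c - 1 / 2 * (Gi c ⬝ᵥ z)) (1 / 2 * (Gi c ⬝ᵥ z))
    rw [sub_add_cancel, abs_mul (1 / 2 : ℝ), abs_of_pos (by norm_num : (0 : ℝ) < 1 / 2)] at h5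
    linarith
  have h6 := Finset.sum_le_sum fun c (_ : c ∈ Finset.univ) => h1 c
  rw [Finset.sum_add_distrib, ← Finset.mul_sum, ← Finset.sum_mul, ← Finset.sum_mul,
    ← Finset.mul_sum] at h6
  have h7 : 1 / 2 * κ * (∑ a, ∑ b, |Gi a b|) * ∑ b, |T b| ≤ 1 / 2 * ∑ b, |T b| := by
    have : 0 ≤ ∑ b, |T b| := Finset.sum_nonneg fun _ _ => abs_nonneg _
    nlinarith
  linarith

theorem norm_le_sum_abs (T : Param k) : ‖T‖ ≤ ∑ b, |T b| := by
  rw [EuclideanSpace.norm_eq]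
  refine Real.sqrt_le_iff.2 ⟨Finset.sum_nonneg fun _ _ => abs_nonneg _, ?_⟩
  exact Finset.sum_sq_le_sq_sum_of_nonneg fun _ _ => norm_nonneg _

end Newton

/-! ### A measurable mean value point of the score -/

section MeanValue

variable {X : Type*} [MeasurableSpace X] {k N M : ℕ} {Θ : Set (Param k)} {g : Param k → X → ℝ}

theorem RegularModel.exists_measurable_mean_value_score (h : RegularModel Θ g) {β₀ : Param k}
    {δ : ℝ} (hδ : Metric.closedBall β₀ δ ⊆ interior Θ)
    {fhat rhat : Bool → NuisanceEstimator X N M} (hf : MeasurableEstimator fhat)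
    (hr : MeasurableEstimator rhat) {Ω : Type*} [MeasurableSpace Ω] {s : Ω → Sample X N M}
    (hs : Measurable s) {b : Ω → Param k} (hb : Measurable b)
    (hbδ : ∀ ω, b ω ∈ Metric.closedBall β₀ δ) (a : Fin k) :
    ∃ c : Ω → Param k, Measurable c ∧ ∀ ω, dist (c ω) β₀ ≤ dist (b ω) β₀ ∧
      score g fhat rhat (s ω) β₀ a +
        ∑ j, scoreJacobian g fhat rhat (s ω) (c ω) a j * (b ω - β₀) j =
      score g fhat rhat (s ω) (b ω) a := by
  have hdist : ∀ t ∈ Set.Icc (0 : ℝ) 1, ∀ ω, dist (β₀ + t • (b ω - β₀)) β₀ ≤ dist (b ω) β₀ := by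
    intro t ht ω
    rw [dist_eq_norm, dist_eq_norm, add_sub_cancel_left, norm_smul, Real.norm_of_nonneg ht.1]
    exact mul_le_of_le_one_left (norm_nonneg _) ht.2
  have hmem : ∀ t ∈ Set.Icc (0 : ℝ) 1, ∀ ω, β₀ + t • (b ω - β₀) ∈ interior Θ := fun t ht ω =>
    hδ ((hdist t ht ω).trans (hbδ ω))
  have hderiv : ∀ ω, ∀ t ∈ Set.Icc (0 : ℝ) 1,
      HasDerivAt (fun t => score g fhat rhat (s ω) (β₀ + t • (b ω - β₀)) a)
        (∑ j, scoreJacobian g fhat rhat (s ω) (β₀ + t • (b ω - β₀)) a j * (b ω - β₀) j) t := by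
    intro ω t ht
    have hline : HasDerivAt (fun t : ℝ => β₀ + t • (b ω - β₀)) (b ω - β₀) t := by
      simpa using ((hasDerivAt_id t).smul_const (b ω - β₀)).const_add β₀
    have hd := (h.hasFDerivAt_score fhat rhat (s ω)
      (hmem t ht ω) a).differentiableAt.hasFDerivAt.comp_hasDerivAt t hline
    rw [fderiv_apply_eq_sum] at hd
    exact hd
  obtain ⟨τ, hτm, hτ⟩ := exists_measurable_mean_value
    (fun t ht => h.measurable_score hf hr hs (((hb.sub_const β₀).const_smul t).const_add β₀)
      (hmem t ht) a) hderiv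
  refine ⟨fun ω => β₀ + τ ω • (b ω - β₀), (hτm.smul (hb.sub_const β₀)).const_add β₀,
    fun ω => ⟨hdist _ (hτ ω).1 ω, ?_⟩⟩
  have := (hτ ω).2
  simp only [one_smul, zero_smul, Pi.zero_apply, add_zero, add_sub_cancel β₀] at this
  rw [this, add_sub_cancel]

end MeanValue

/-! ### Asymptotic linearity of the doubly robust estimator -/

section Transfer

variable {Ω Ω' : ℕ → Type*} [∀ n, MeasurableSpace (Ω n)] [∀ n, MeasurableSpace (Ω' n)]
  {ν : ∀ n, Measure (Ω n)} {ν' : ∀ n, Measure (Ω' n)} {f : ∀ n, Ω n → Ω' n}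

theorem Whp.comp_hasLaw (hf : ∀ n, HasLaw (f n) (ν' n) (ν n)) {P : ∀ n, Ω' n → Prop}
    (h : Whp ν' P) : Whp ν fun n ω => P n (f n ω) :=
  h.comp (fun n => (hf n).aemeasurable) fun n => (hf n).map_eq

theorem SmallInProb.comp_hasLaw (hf : ∀ n, HasLaw (f n) (ν' n) (ν n)) {Z : ∀ n, Ω' n → ℝ≥0∞}
    (h : SmallInProb ν' Z) : SmallInProb ν fun n ω => Z n (f n ω) :=
  h.comp (fun n => (hf n).aemeasurable) fun n => (hf n).map_eq

theorem BoundedInProb.comp_hasLaw (hf : ∀ n, HasLaw (f n) (ν' n) (ν n)) {Z : ∀ n, Ω' n → ℝ}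
    (h : BoundedInProb ν' Z) : BoundedInProb ν fun n ω => Z n (f n ω) :=
  h.comp (fun n => (hf n).aemeasurable) fun n => (hf n).map_eq

theorem tendstoInMeasure_iff_whp {𝓞 : Type*} [MeasurableSpace 𝓞] {μ : Measure 𝓞} {E : Type*}
    [PseudoMetricSpace E] {Y : ℕ → 𝓞 → E} {c : 𝓞 → E} :
    TendstoInMeasure μ Y atTop c ↔
      ∀ ε : ℝ, 0 < ε → Whp (fun _ => μ) fun n ω => dist (Y n ω) (c ω) < ε := by
  rw [tendstoInMeasure_iff_dist]
  simp only [Whp, not_lt]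

theorem sqrt_two_mul_inv_mul (N : ℕ) (s : ℝ) :
    √(2 * (N : ℝ)) * (1 / (N : ℝ) * s) = 2 * ((√(2 * (N : ℝ)))⁻¹ * s) := by
  rcases N.eq_zero_or_pos with rfl | hN
  · simp
  have hN' : (0 : ℝ) < 2 * N := by positivity
  have h := Real.mul_self_sqrt hN'.le
  have h0 : √(2 * (N : ℝ)) ≠ 0 := (Real.sqrt_pos.2 hN').ne'
  have h1 : (N : ℝ) = √(2 * (N : ℝ)) * √(2 * (N : ℝ)) / 2 := by linarith
  generalize √(2 * (N : ℝ)) = q at h0 h1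
  rw [h1]
  field_simp

end Transfer

section Main

variable {𝓞 : Type*} [MeasurableSpace 𝓞] {μ : Measure 𝓞}
  {X : Type*} [MeasurableSpace X] {lamX : Measure X} {lamY : Measure ℝ} [SigmaFinite lamY]
  {S : CovariateShift lamX lamY} {N M : ℕ → ℕ} {B C Cr : ℝ} {k : ℕ} {Θ : Set (Param k)}
  {g : Param k → X → ℝ} {β₀ : Param k} {sample : ∀ n, 𝓞 → Sample X (N n) (M n)}
  {fhat rhat : ∀ n, Bool → NuisanceEstimator X (N n) (M n)}

/-- The limit of the score Jacobian is minus twice the Gram matrix, which is therefore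
invertible. -/
theorem isUnit_gramMatrix_det [IsProbabilityMeasure μ] (h : RegularModel Θ g) (hβ₀ : β₀ ∈ interior Θ)
    (hs : ∀ x, S.f0 x = g β₀ x) (hf : ∀ x, |S.f0 x| ≤ B)
    (hgd : ∀ x a, |gdot g β₀ x a| ≤ B) (hgdd : ∀ x a b, |gddot g β₀ x a b| ≤ B)
    (hY : ∀ᵐ z ∂S.trainLaw, |z.2| ≤ C) (hCr : ∀ x, S.ratio x ≤ Cr)
    (hN : Tendsto N atTop atTop) (hM : Tendsto M atTop atTop)
    (h_sample : ∀ n, HasLaw (sample n) (sampleLaw S.trainLaw S.testCov (N n) (M n)) μ)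
    (hneg : NegligibleNuisance S N M fhat rhat)
    (hJ : JacobianCondition μ Θ β₀ g N M sample fhat rhat) :
    IsUnit (gramMatrix S g β₀).det ∧
      ∀ βs : ℕ → 𝓞 → Param k, (∀ n, Measurable (βs n)) → (∀ n ω, βs n ω ∈ Θ) →
        TendstoInMeasure μ βs atTop (fun _ => β₀) → ∀ a b (ε : ℝ), 0 < ε →
          Whp (fun _ => μ) fun n ω => |scoreJacobian g (fhat n) (rhat n) (sample n ω) (βs n ω) a b -
            -2 * gramMatrix S g β₀ a b| < ε := by
  obtain ⟨D, hD, hlim⟩ := hJ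
  have hDG : ∀ a b, Dᵀ a b = -2 * gramMatrix S g β₀ a b := by
    intro a b
    by_contra hne
    have hε : 0 < |Dᵀ a b - -2 * gramMatrix S g β₀ a b| / 2 :=
      half_pos (abs_pos.2 (sub_ne_zero.2 hne))
    have h1 := tendstoInMeasure_iff_whp.1 (hlim (fun _ _ => β₀) (fun _ => measurable_const)
      (fun _ _ => interior_subset hβ₀) (tendstoInMeasure_iff_whp.2 fun ε hε =>
        whp_of_ae (by simp [hε])) a b) _ hε
    have h2 := ((smallInProb_scoreJacobian h hβ₀ hs hf hgd hgdd hY hCr hN hM hneg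
      a b).comp_hasLaw h_sample).whp_abs_lt hε
    refine not_whp_false ((h1.and h2).mono fun n ω hω => ?_)
    have h3 := dist_triangle_left (Dᵀ a b) (-2 * gramMatrix S g β₀ a b)
      (scoreJacobian g (fhat n) (rhat n) (sample n ω) β₀ a b)
    have h4 := hω.1
    have h5 := hω.2
    rw [Real.dist_eq (Dᵀ a b), Real.dist_eq _ (-2 * gramMatrix S g β₀ a b)] at h3
    linarith
  constructor
  · have hG : Dᵀ = (-2 : ℝ) • gramMatrix S g β₀ := by
      ext a b
      rw [hDG, Matrix.smul_apply, smul_eq_mul]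
    rw [← Matrix.det_transpose, hG, Matrix.det_smul] at hD
    exact isUnit_of_mul_isUnit_right hD
  · intro βs hm hΘ hβs a b ε hε
    refine (tendstoInMeasure_iff_whp.1 (hlim βs hm hΘ hβs a b) ε hε).mono fun n ω hω => ?_
    rwa [← hDG, ← Real.dist_eq]

/-- The doubly robust estimate of the regression function at `x` is asymptotically linear. -/
theorem smallInProb_linearization (h : RegularModel Θ g) (hβ₀ : β₀ ∈ interior Θ)
    (hs : ∀ x, S.f0 x = g β₀ x) (hf : ∀ x, |S.f0 x| ≤ B)
    (hgd : ∀ x a, |gdot g β₀ x a| ≤ B)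
    (hY : ∀ᵐ z ∂S.trainLaw, |z.2| ≤ C) (hCr : ∀ x, S.ratio x ≤ Cr)
    (hN : Tendsto N atTop atTop)
    (h_sample : ∀ n, HasLaw (sample n) (sampleLaw S.trainLaw S.testCov (N n) (M n)) μ)
    (h_fhat : ∀ n, MeasurableEstimator (fhat n)) (h_rhat : ∀ n, MeasurableEstimator (rhat n))
    (hneg : NegligibleNuisance S N M fhat rhat)
    (hG : IsUnit (gramMatrix S g β₀).det)
    (hJ : ∀ βs : ℕ → 𝓞 → Param k, (∀ n, Measurable (βs n)) → (∀ n ω, βs n ω ∈ Θ) →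
        TendstoInMeasure μ βs atTop (fun _ => β₀) → ∀ a b (ε : ℝ), 0 < ε →
          Whp (fun _ => μ) fun n ω => |scoreJacobian g (fhat n) (rhat n) (sample n ω) (βs n ω) a b -
            -2 * gramMatrix S g β₀ a b| < ε)
    {βhat : ℕ → 𝓞 → Param k} (h_βhat : ∀ n, AEMeasurable (βhat n) μ)
    (h_argmin : ∀ n, ∀ᵐ ω ∂μ, IsArgmin Θ
      (fun β => ∑ l : Bool, drRisk g (fhat n) (rhat n) (sample n ω) l β) (βhat n ω))
    (hcons : ∀ ε : ℝ, 0 < ε → Whp (fun _ => μ) fun n ω => dist (βhat n ω) β₀ < ε) (x : X) :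
    SmallInProb (fun _ => μ) fun n ω => ‖√(2 * (N n : ℝ)) * (S.f0 x - g (βhat n ω) x) -
      (√(2 * (N n : ℝ)))⁻¹ * ∑ l : Bool, ∑ i,
        -((∑ a, ((gramMatrix S g β₀)⁻¹ *ᵥ gdot g β₀ x) a *
          gdot g β₀ ((sample n ω).1 l i).1 a) * S.noise ((sample n ω).1 l i))‖ₑ := by
  classical
  set G := gramMatrix S g β₀
  set v : Fin k → ℝ := G⁻¹ *ᵥ gdot g β₀ x with hv
  have hvG : v ᵥ* G = gdot g β₀ x := by
    rw [← Matrix.mulVec_transpose, gramMatrix_transpose, hv, Matrix.mulVec_mulVec,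
      Matrix.mul_nonsing_inv _ hG, Matrix.one_mulVec]
  obtain ⟨δ, hδ0, hδ⟩ := Metric.nhds_basis_closedBall.mem_iff.1
    (isOpen_interior.mem_nhds hβ₀)
  -- measurable versions of the sample and of the estimator
  set s : ∀ n, 𝓞 → Sample X (N n) (M n) := fun n => (h_sample n).aemeasurable.mk (sample n)
  have hsm : ∀ n, Measurable (s n) := fun n => (h_sample n).aemeasurable.measurable_mk
  have hs_ae : ∀ n, ∀ᵐ ω ∂μ, sample n ω = s n ω := fun n => (h_sample n).aemeasurable.ae_eq_mk
  set b : ℕ → 𝓞 → Param k := fun n ω =>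
    if (h_βhat n).mk (βhat n) ω ∈ Metric.closedBall β₀ δ then (h_βhat n).mk (βhat n) ω else β₀
  have hbm : ∀ n, Measurable (b n) := fun n =>
    Measurable.ite ((h_βhat n).measurable_mk Metric.isClosed_closedBall.measurableSet)
      (h_βhat n).measurable_mk measurable_const
  have hbδ : ∀ n ω, b n ω ∈ Metric.closedBall β₀ δ := by
    intro n ω
    simp only [b]
    split_ifs with hω
    · exact hω
    · exact Metric.mem_closedBall_self hδ0.le
  have hb_eq : Whp (fun _ => μ) fun n ω => βhat n ω = b n ω := by
    refine (hcons δ hδ0).mono_ae (Eventually.of_forall fun n => ?_)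
    filter_upwards [(h_βhat n).ae_eq_mk] with ω hω hd
    have : (h_βhat n).mk (βhat n) ω ∈ Metric.closedBall β₀ δ := by
      rw [← hω]
      exact hd.le
    simp only [b, if_pos this]
    exact hω
  have hb_cons : ∀ ε : ℝ, 0 < ε → Whp (fun _ => μ) fun n ω => dist (b n ω) β₀ < ε := fun ε hε =>
    (hb_eq.and (hcons ε hε)).mono fun n ω hω => hω.1 ▸ hω.2
  choose c hcm hc using fun (n : ℕ) (a : Fin k) =>
    h.exists_measurable_mean_value_score hδ (h_fhat n) (h_rhat n) (hsm n) (hbm n) (hbδ n) a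
  have hc_lim : ∀ a, TendstoInMeasure μ (fun n => c n a) atTop (fun _ => β₀) := fun a =>
    tendstoInMeasure_iff_whp.2 fun ε hε => (hb_cons ε hε).mono fun n ω hω =>
      ((hc n a ω).1).trans_lt hω
  have hcJ := fun a => hJ (fun n => c n a) (fun n => hcm n a)
    (fun n ω => interior_subset (hδ (((hc n a ω).1).trans (hbδ n ω)))) (hc_lim a) a
  set z : ∀ n, 𝓞 → Fin k → ℝ := fun n ω a => score g (fhat n) (rhat n) (sample n ω) β₀ a
  set L := ∑ a, ∑ j, |G⁻¹ a j|
  set V := ∑ a, |v a|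
  have hL : 0 ≤ L := Finset.sum_nonneg fun _ _ => Finset.sum_nonneg fun _ _ => abs_nonneg _
  have hV : 0 ≤ V := Finset.sum_nonneg fun _ _ => abs_nonneg _
  have hbdd : BoundedInProb (fun _ => μ) fun n ω => ∑ a, |√(2 * (N n : ℝ)) * z n ω a| :=
    BoundedInProb.sum Finset.univ fun a _ =>
      ((boundedInProb_score h hβ₀ hs hf hgd hY hCr hN hneg a).comp_hasLaw h_sample).abs
  have hmain : SmallInProb (fun _ => μ) fun n ω =>
      ‖√(2 * (N n : ℝ)) * (S.f0 x - g (βhat n ω) x) + √(2 * (N n : ℝ)) * (1 / 2 * (v ⬝ᵥ z n ω))‖ₑ := by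
    refine hbdd.smallInProb fun ε hε => ?_
    set κ : ℝ := min ε 1 / ((1 / 2 * V + 1) * (L + 1))
    have hκ0 : 0 < κ := by positivity
    have hκ : κ * ((1 / 2 * V + 1) * (L + 1)) = min ε 1 := div_mul_cancel₀ _ (by positivity)
    have hκL : κ * L ≤ 1 := by
      refine le_trans ?_ (hκ.le.trans (min_le_right _ _))
      gcongr
      nlinarith
    have hκε : κ * ((1 / 2 * V + 1) * L) ≤ ε := by
      refine le_trans ?_ (hκ.le.trans (min_le_left _ _))
      gcongr
      linarith
    obtain ⟨η, hη, hdiff⟩ := Metric.eventually_nhds_iff.1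
      ((h.differentiable x β₀ hβ₀).hasFDerivAt.isLittleO.def hκ0)
    refine (((hb_cons η hη).and hb_eq).and (whp_forall fun a => whp_forall fun j =>
      hcJ a j κ hκ0)).mono_ae (Eventually.of_forall fun n => ?_)
    filter_upwards [hs_ae n, h_argmin n] with ω hsω hmin hω
    obtain ⟨⟨hω1, hω2⟩, hω3⟩ := hω
    have hb_int : b n ω ∈ interior Θ := hδ (hbδ n ω)
    have hz : ∀ a, z n ω a + ∑ j, scoreJacobian g (fhat n) (rhat n) (sample n ω) (c n a ω) a j *
        (b n ω - β₀) j = 0 := by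
      intro a
      have h1 := (hc n a ω).2
      rw [← hsω] at h1
      rw [h1]
      rw [hω2] at hmin
      exact h.score_eq_zero_of_isArgmin _ _ _ hb_int hmin a
    have hstep := abs_vecMul_dotProduct_sub_le (G := G)
      (J := fun a j => scoreJacobian g (fhat n) (rhat n) (sample n ω) (c n a ω) a j)
      (T := (b n ω - β₀ : Param k)) hz (fun a j => (hω3 a j).le) v
    have hsum := sum_abs_step_le (G := G) (Gi := G⁻¹)
      (J := fun a j => scoreJacobian g (fhat n) (rhat n) (sample n ω) (c n a ω) a j)
      (T := (b n ω - β₀ : Param k)) (Matrix.nonsing_inv_mul _ hG) hz (fun a j => (hω3 a j).le) hκL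
    have hd := hdiff hω1
    rw [fderiv_apply_eq_sum, Real.norm_eq_abs] at hd
    have hd2 := hd.trans (mul_le_mul_of_nonneg_left (norm_le_sum_abs _) hκ0.le)
    rw [hvG] at hstep
    have herr : |(S.f0 x - g (βhat n ω) x) + 1 / 2 * (v ⬝ᵥ z n ω)| ≤ ε * ∑ a, |z n ω a| := by
      have e1 : (S.f0 x - g (βhat n ω) x) + 1 / 2 * (v ⬝ᵥ z n ω) =
          -(g (b n ω) x - g β₀ x - gdot g β₀ x ⬝ᵥ (b n ω - β₀ : Param k)) -
            (gdot g β₀ x ⬝ᵥ (b n ω - β₀ : Param k) - 1 / 2 * (v ⬝ᵥ z n ω)) := by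
        rw [hs x, hω2]
        ring
      rw [e1]
      calc _ ≤ κ * ∑ j, |(b n ω - β₀) j| + 1 / 2 * κ * V * ∑ j, |(b n ω - β₀) j| := by
            refine (abs_sub _ _).trans (add_le_add ?_ hstep)
            rw [abs_neg]
            exact hd2
        _ = κ * (1 / 2 * V + 1) * ∑ j, |(b n ω - β₀) j| := by ring
        _ ≤ κ * (1 / 2 * V + 1) * (L * ∑ a, |z n ω a|) :=
            mul_le_mul_of_nonneg_left hsum (by positivity)
        _ = κ * ((1 / 2 * V + 1) * L) * ∑ a, |z n ω a| := by ring
        _ ≤ ε * ∑ a, |z n ω a| := by gcongr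
    have hq : 0 ≤ √(2 * (N n : ℝ)) := Real.sqrt_nonneg _
    simp only [abs_mul, abs_of_nonneg hq]
    rw [← mul_add, abs_mul, abs_of_nonneg hq, ← Finset.mul_sum, abs_mul, abs_of_nonneg hq,
      abs_of_nonneg (Finset.sum_nonneg fun a _ => abs_nonneg (z n ω a)), mul_left_comm]
    gcongr
  have hlin := SmallInProb.sum Finset.univ fun a (_ : a ∈ Finset.univ) =>
    ((smallInProb_score_sub h hβ₀ hs hgd hneg a).comp_hasLaw h_sample).const_mul
      (c := ‖1 / 2 * v a‖ₑ) enorm_ne_top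
  refine (hmain.add hlin).mono fun n ω => ?_
  simp only [← enorm_mul]
  refine le_trans ?_ ((add_le_add_right (enorm_sum_le _ _) _).trans' (enorm_sub_le))
  refine le_of_eq (congrArg _ ?_)
  set Ξ : Fin k → ℝ := fun a => ∑ l : Bool, ∑ i,
    gdot g β₀ ((sample n ω).1 l i).1 a * S.noise ((sample n ω).1 l i)
  have e1 : ∑ l : Bool, ∑ i, -((∑ a, v a * gdot g β₀ ((sample n ω).1 l i).1 a) *
      S.noise ((sample n ω).1 l i)) = -∑ a, v a * Ξ a := by
    simp only [Ξ, Finset.sum_mul, Finset.mul_sum, Finset.sum_neg_distrib]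
    rw [Finset.sum_comm]
    simp only [Finset.sum_comm (s := (Finset.univ : Finset (Fin (N n)))), mul_assoc]
    rw [Finset.sum_comm]
  have e2 : ∀ a, √(2 * (N n : ℝ)) * ∑ l : Bool, (1 / (N n : ℝ)) * ∑ i,
      gdot g β₀ ((sample n ω).1 l i).1 a * S.noise ((sample n ω).1 l i) =
        2 * ((√(2 * (N n : ℝ)))⁻¹ * Ξ a) := fun a => by
    rw [← Finset.mul_sum, sqrt_two_mul_inv_mul]
  simp only [e2]
  rw [e1]
  simp only [dotProduct, z, Finset.mul_sum, mul_sub, Finset.sum_sub_distrib, mul_neg]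
  have e3 : ∀ a, √(2 * (N n : ℝ)) * (1 / 2 * (v a * score g (fhat n) (rhat n) (sample n ω) β₀ a)) =
      1 / 2 * v a * (√(2 * (N n : ℝ)) * score g (fhat n) (rhat n) (sample n ω) β₀ a) := fun a => by
    ring
  have e4 : ∀ a, 1 / 2 * v a * (2 * ((√(2 * (N n : ℝ)))⁻¹ * Ξ a)) =
      (√(2 * (N n : ℝ)))⁻¹ * (v a * Ξ a) := fun a => by ring
  simp only [e3, e4]
  ring

theorem aemeasurable_model_comp (h : RegularModel Θ g) (hΘ : IsClosed Θ) (hβ₀ : β₀ ∈ Θ)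
    {b : 𝓞 → Param k} (hb : AEMeasurable b μ) (hbΘ : ∀ᵐ ω ∂μ, b ω ∈ Θ) (x : X) :
    AEMeasurable (fun ω => g (b ω) x) μ := by
  classical
  set b' : 𝓞 → Param k := fun ω => if hb.mk b ω ∈ Θ then hb.mk b ω else β₀
  have hb'm : Measurable b' :=
    Measurable.ite (hb.measurable_mk hΘ.measurableSet) hb.measurable_mk measurable_const
  have hb'Θ : ∀ ω, b' ω ∈ Θ := by
    intro ω
    simp only [b']
    split_ifs with hω
    · exact hω
    · exact hβ₀
  refine ⟨fun ω => g (b' ω) x, measurable_comp_of_continuousOn h.measurable h.continuousOn hb'm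
    hb'Θ (measurable_const (a := x)), ?_⟩
  filter_upwards [hb.ae_eq_mk, hbΘ] with ω h1 h2
  rw [h1] at h2
  simp only [b', if_pos h2]
  rw [h1]

/-- The central limit theorem for the linear part of the estimation error. -/
theorem tendstoInDistribution_linear_part [IsProbabilityMeasure μ] (hN : Tendsto N atTop atTop)
    (h_sample : ∀ n, HasLaw (sample n) (sampleLaw S.trainLaw S.testCov (N n) (M n)) μ)
    {ξ : X × ℝ → ℝ} (hξ : Measurable ξ) (hmem : MemLp ξ 2 S.trainLaw)
    (hmean : ∫ z, ξ z ∂S.trainLaw = 0) :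
    TendstoInDistribution
      (fun n ω => (√(2 * (N n : ℝ)))⁻¹ * ∑ l : Bool, ∑ i, ξ ((sample n ω).1 l i)) atTop
      (id : ℝ → ℝ) (fun _ => μ) (gaussianReal 0 (∫ z, ξ z ^ 2 ∂S.trainLaw).toNNReal) := by
  set F : ∀ n, (Bool → Fin (N n) → X × ℝ) → ℝ := fun n z =>
    (√(2 * (N n : ℝ)))⁻¹ * ∑ l : Bool, ∑ i, ξ (z l i)
  have hF : ∀ n, Measurable (F n) := fun n =>
    (Finset.measurable_fun_sum _ fun l _ => Finset.measurable_fun_sum _ fun i _ =>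
      hξ.comp (measurable_pi_iff.1 (measurable_pi_apply l) i)).const_mul _
  have hFs : ∀ n, Measurable fun s : Sample X (N n) (M n) => F n s.1 := fun n =>
    (hF n).comp measurable_fst
  refine TendstoInDistribution.comp_map (tendstoInDistribution_two_folds hN hξ hmem hmean)
    (fun n => (hFs n).comp_aemeasurable (h_sample n).aemeasurable) fun n => ?_
  have h1 : μ.map (fun ω => F n (sample n ω).1) =
      (sampleLaw S.trainLaw S.testCov (N n) (M n)).map fun s => F n s.1 := by
    rw [← (h_sample n).map_eq, AEMeasurable.map_map_of_aemeasurable (hFs n).aemeasurable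
      (h_sample n).aemeasurable]
    rfl
  have h2 : (sampleLaw S.trainLaw S.testCov (N n) (M n)).map Prod.fst =
      Measure.pi fun _ : Bool => Measure.pi fun _ : Fin (N n) => S.trainLaw :=
    measurePreserving_fst.map_eq
  refine h1.trans ?_
  rw [← h2, Measure.map_map (hF n) measurable_fst]
  rfl

end Main

end DRShift

end

theorem corollary1 {d k : ℕ} {𝓞 : Type*} [MeasurableSpace 𝓞]
    (μ : Measure 𝓞) [IsProbabilityMeasure μ]
    -- population: covariate space, dominating measures, densities
    (𝒳 : Set (EuclideanSpace ℝ (Fin d)))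
    (lamX : Measure 𝒳) [SigmaFinite lamX] (lamY : Measure ℝ) [SigmaFinite lamY]
    (S : DRShift.CovariateShift lamX lamY)
    (h_bounded : DRShift.BoundedData S)
    (h_overlap : S.Overlap)
    -- parametric model, correctly specified
    (Θ : Set (DRShift.Param k)) (h_compact : IsCompact Θ)
    (g : DRShift.Param k → 𝒳 → ℝ) (h_regular : DRShift.RegularModel Θ g)
    (h_specified : ∃ β ∈ Θ, ∀ x, S.f0 x = g β x)
    -- risk minimizers of the train and of the test population
    (β₀ βt₀ : DRShift.Param k)
    (h_train_min : DRShift.IsArgmin Θ (DRShift.risk S.trainLaw g) β₀)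
    (h_test_min : DRShift.IsArgmin Θ (DRShift.risk S.testLaw g) βt₀)
    (h_unique : ∀ β, DRShift.IsArgmin Θ (DRShift.risk S.testLaw g) β → β = βt₀)
    (h_interior : β₀ ∈ interior Θ)
    (h_model_bounded : DRShift.BoundedModel Θ g β₀)
    -- at stage n, each fold has N n train points and M n test points
    (ρ : ℝ) (h_rho : 0 < ρ) (N M : ℕ → ℕ) (h_N : Tendsto N atTop atTop)
    (h_sizes : ∀ n, (M n : ℝ) = ρ * (N n : ℝ))
    (sample : ∀ n, 𝓞 → DRShift.Sample 𝒳 (N n) (M n))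
    (h_sample : ∀ n,
      HasLaw (sample n) (DRShift.sampleLaw S.trainLaw S.testCov (N n) (M n)) μ)
    -- nuisance estimators
    (fhat rhat : ∀ n, Bool → DRShift.NuisanceEstimator 𝒳 (N n) (M n))
    (h_fhat : ∀ n, DRShift.MeasurableEstimator (fhat n))
    (h_rhat : ∀ n, DRShift.MeasurableEstimator (rhat n))
    (h_jacobian : DRShift.JacobianCondition μ Θ βt₀ g N M sample fhat rhat)
    (h_rates : DRShift.NuisanceRates S μ N M sample fhat rhat)
    -- the doubly robust estimator
    (βhat : ℕ → 𝓞 → DRShift.Param k) (h_βhat : ∀ n, AEMeasurable (βhat n) μ)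
    (h_argmin : ∀ n, ∀ᵐ ω ∂μ, DRShift.IsArgmin Θ
      (fun β => ∑ l : Bool, DRShift.drRisk g (fhat n) (rhat n) (sample n ω) l β) (βhat n ω)) :
    IsUnit (DRShift.gramMatrix S g β₀).det ∧
    ∀ x : 𝒳, 0 ≤ DRShift.asympVar S g β₀ x ∧
      TendstoInDistribution
        (fun n ω => Real.sqrt (2 * (N n : ℝ)) * (S.f0 x - g (βhat n ω) x)) atTop
        (id : ℝ → ℝ) (fun _ => μ)
        (gaussianReal 0 (Real.toNNReal (DRShift.asympVar S g β₀ x))) := by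
  obtain ⟨C, -, hC, hCt⟩ := h_bounded
  obtain ⟨B, hB, hgd, hgdd⟩ := h_model_bounded
  obtain ⟨Cr, -, hCr'⟩ := h_overlap.2
  have hCr : ∀ x, S.ratio x ≤ Cr := fun x => (hCr' x).le
  have hY : ∀ᵐ z ∂S.trainLaw, |z.2| ≤ C := hC.mono fun z hz => hz.1.le
  have hYt : ∀ᵐ z ∂S.testLaw, |z.2| ≤ C := hCt.mono fun z hz => hz.1.le
  obtain ⟨rfl, hs, hid⟩ := DRShift.identification h_regular.measurable hB h_specified h_overlap hY
    hYt h_train_min h_unique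
  have hβ₀ : β₀ ∈ Θ := interior_subset h_interior
  have hf : ∀ x, |S.f0 x| ≤ B := fun x => by rw [hs]; exact hB β₀ hβ₀ x
  have h_M : Tendsto M atTop atTop := by
    have h1 : Tendsto (fun n => (M n : ℝ)) atTop atTop := by
      simp only [h_sizes]
      exact (tendsto_natCast_atTop_atTop.comp h_N).const_mul_atTop h_rho
    exact tendsto_natCast_atTop_iff.1 h1
  have hneg := h_rates.negligible h_sample h_fhat h_rhat h_overlap hY hf hCr h_rho h_N h_M h_sizes
  obtain ⟨hG, hJ⟩ := DRShift.isUnit_gramMatrix_det h_regular h_interior hs hf hgd hgdd hY hCr h_N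
    h_M h_sample hneg h_jacobian
  have hcons : ∀ ε : ℝ, 0 < ε →
      DRShift.Whp (fun _ => μ) fun n ω => dist (βhat n ω) β₀ < ε := fun ε hε => by
    refine ((DRShift.whp_drRisk_lt h_compact h_regular hB hβ₀ hs hid hY hCr h_N h_M hneg
      hε).comp_hasLaw h_sample).mono_ae (Eventually.of_forall fun n => ?_)
    filter_upwards [h_argmin n] with ω hmin hω
    by_contra! hcon
    exact absurd (hmin.2 hβ₀) (not_le.2 (hω _ hmin.1 hcon))
  refine ⟨hG, fun x => ?_⟩
  have hgm := h_regular.measurable_gdot h_interior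
  set v : Fin k → ℝ := (DRShift.gramMatrix S g β₀)⁻¹ *ᵥ DRShift.gdot g β₀ x
  have hvar : DRShift.asympVar S g β₀ x =
      ∫ z, (-((∑ a, v a * DRShift.gdot g β₀ z.1 a) * S.noise z)) ^ 2 ∂S.trainLaw := by
    rw [DRShift.asympVar_eq, DRShift.dotProduct_noiseMatrix_mulVec h_overlap hY hf hCr hgm hgd]
    simp only [neg_sq]
    rfl
  have hum : Measurable fun x => ∑ a, v a * DRShift.gdot g β₀ x a :=
    Finset.measurable_fun_sum _ fun a _ => (hgm a).const_mul _
  have hub : ∀ x, |∑ a, v a * DRShift.gdot g β₀ x a| ≤ ∑ a, |v a| * B := fun x => by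
    refine (Finset.abs_sum_le_sum_abs _ _).trans (Finset.sum_le_sum fun a _ => ?_)
    rw [abs_mul]
    exact mul_le_mul_of_nonneg_left (hgd x a) (abs_nonneg _)
  have hξm : Measurable fun z : 𝒳 × ℝ =>
      -((∑ a, v a * DRShift.gdot g β₀ z.1 a) * S.noise z) :=
    ((hum.comp measurable_fst).mul S.measurable_noise).neg
  have hξb : MemLp (fun z : 𝒳 × ℝ => -((∑ a, v a * DRShift.gdot g β₀ z.1 a) * S.noise z)) 2
      S.trainLaw := by
    refine MemLp.of_bound hξm.aestronglyMeasurable ((∑ a, |v a| * B) * ((C + B) * Cr))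
      ((DRShift.ae_abs_noise_le hY hf hCr).mono fun z hz => ?_)
    rw [norm_neg, Real.norm_eq_abs, abs_mul]
    exact mul_le_mul (hub z.1) hz (abs_nonneg _) ((abs_nonneg _).trans (hub z.1))
  have hξ0 : ∫ z : 𝒳 × ℝ, -((∑ a, v a * DRShift.gdot g β₀ z.1 a) * S.noise z) ∂S.trainLaw = 0 := by
    rw [integral_neg, DRShift.integral_mul_noise hY hf hCr hum hub, neg_zero]
  refine ⟨hvar ▸ integral_nonneg fun z => sq_nonneg _, ?_⟩
  rw [hvar]
  refine tendstoInDistribution_of_tendstoInMeasure_sub _ _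
    (DRShift.tendstoInDistribution_linear_part h_N h_sample hξm hξb hξ0) ?_ fun n => ?_
  · refine DRShift.tendstoInMeasure_iff_whp.2 fun ε hε =>
      ((DRShift.smallInProb_linearization h_regular h_interior hs hf hgd hY hCr h_N h_sample h_fhat
        h_rhat hneg hG hJ h_βhat h_argmin hcons x).whp_abs_lt hε).mono fun n ω hω => ?_
    rw [Real.dist_eq]
    simpa using hω
  · exact ((DRShift.aemeasurable_model_comp h_regular h_compact.isClosed hβ₀ (h_βhat n)
      ((h_argmin n).mono fun ω hω => hω.1) x).const_sub _).const_mul _
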